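/- **Setting.** Let $N\ge 0$ be even, $c>0$, $L>0$, $\mathsf h,x\in\mathbb R$ and $t\in\mathbb C$ (real time is $t\in\mathbb R$). Put $$h(\lambda,\mu)=\frac{\lambda-\mu+ic}{ic},\quad t(\lambda,\mu)=\frac{(ic)^2}{(\lambda-\mu)(\lambda-\mu+ic)},\quad K(\lambda,\mu)=\frac{2c}{c^2+(\lambda-\mu)^2},\quad \tau(\lambda)=it\lambda^2-ix\lambda .$$ For real $v_1,\dots,v_M$ let $\mathcal G(v)=\det_M\big(\delta_{jk}[L+\sum_lK(v_j,v_l)]-K(v_j,v_k)\big)$. Let $\mu_1,\dots,\mu_N\in\mathbb R$ be the ground state: $L\mu_j+\sum_k i\ln\frac{ic+\mu_j-\mu_k}{ic-\mu_j+\mu_k}=2\pi(j-\frac{N+1}2)$. For $\lambda\in\mathbb R^{N+1}$ let $\tilde\varphi_j(\lambda)=L\lambda_j+\sum_{k}i\ln\frac{h(\lambda_j,\lambda_k)}{h(\lambda_k,\lambda_j)}$; the intermediate states are the sets $\lambda_1<\dots<\lambda_{N+1}$ with $\tilde\varphi_j(\lambda)\in2\pi\mathbb Z$ for all $j$. Let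 $$S_{jk}=t(\mu_k,\lambda_j)\frac{\prod_m h(\mu_m,\lambda_j)}{\prod_p h(\lambda_p,\lambda_j)}-t(\lambda_j,\mu_k)\frac{\prod_m h(\lambda_j,\mu_m)}{\prod_p h(\lambda_j,\lambda_p)},\qquad 1\le j\le N+1,\ 1\le k\le N,$$ $\mathcal M(\lambda)=\sum_{\ell=1}^{N+1}(-1)^{\ell-1}\det S^{(\ell)}$ with $S^{(\ell)}$ equal to $S$ without row $\ell$, and $C_N=e^{-i\mathsf ht}c^{-2N}/\mathcal G(\mu)$. The form-factor series is $$\langle\psi(0,0)\psi^\dagger(x,t)\rangle_N=\sum_{\{\lambda\}}A(\lambda),\quad A(\lambda)=\frac{C_N}{\prod_{j,k}h(\mu_j,\mu_k)}\,\frac{\prod_{j,k}h(\lambda_j,\lambda_k)\,\mathcal M(\lambda)^2\,e^{\sum_j\tau(\lambda_j)-\sum_m\tau(\mu_m)}}{\mathcal G(\lambda)},$$ summed over all intermediate states, and its Poisson-transformed integrand is, for $n\in\mathbb Z^{N+1}$, $\lambda\in\mathbb R^{N+1}$, $$I_n(\lambda)=\frac{C_N\prod_m e^{-\tau(\mu_m)}}{\prod_{j,k}h(\mu_j,\mu_k)}\frac1{(2\pi)^{N+1}}\prod_{j,k}h(\lambda_j,\lambda_k)\prod_je^{\tau(\lambda_j)}\Big[(1+\partial_\alpha)\det_N(S_{jj}S_{jk}-\alpha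 S_{jj}S_{N+1\,k})\Big]_{\alpha=0}\prod_{j}e^{iL\lambda_jn_j}\Big(\prod_k\frac{h(\lambda_k,\lambda_j)}{h(\lambda_j,\lambda_k)}\Big)^{n_j}.$$ **Dual fields.** In an auxiliary Bose Fock space with vacuum $|0)$, dual vacuum $(0|$, $(0|0)=1$, $p_a(\lambda)|0)=0$, $(0|q_a(\lambda)=0$, the only non-zero commutators are $[p_0(\lambda),q_0(\mu)]=\ln(h(\lambda,\mu)h(\mu,\lambda))$, $[p_{D_j}(\lambda),q_{D_j}(\mu)]=\ln h(\lambda,\mu)$, $[p_{A_j}(\lambda),q_{A_j}(\mu)]=\ln h(\mu,\lambda)$ ($j=1,2$), $[p_1(\lambda),q_1(\mu)]=\ln\frac{h(\lambda,\mu)}{h(\mu,\lambda)}$, $[p_2(\lambda),q_2(\mu)]=\ln\frac{h(\mu,\lambda)}{h(\lambda,\mu)}$. The dual fields $\phi_0=q_0+p_0$, $\phi_{A_j}=q_{A_j}+p_{D_j}$, $\phi_{D_j}=q_{D_j}+p_{A_j}$, $\phi_1=q_1+p_2$, $\phi_2=q_2+p_1$ all commute. Let $\psi=\phi_0+\phi_{A_1}+\phi_{D_2}+\phi_2$,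 $\widehat S_{jk}=t(\mu_k,\lambda_j)e^{-\phi_{D_1}(\lambda_j)}-t(\lambda_j,\mu_k)e^{-\phi_{A_2}(\lambda_j)}$, $\hat\gamma_1(\lambda_j)=e^{iL\lambda_jn_j+\tau(\lambda_j)+\psi(\lambda_j)+n_j\phi_1(\lambda_j)}$, $\hat\gamma_2(\mu)=e^{-\frac12(\tau(\mu)+\psi(\mu))}$, $(\mathrm B|=(0|\prod_{m=1}^Ne^{p_0(\mu_m)}e^{p_1(\mu_m)}$, and $$\widehat I_n(\lambda)=\frac{C_N}{(2\pi)^{N+1}}(\mathrm B|\Big(\hat\gamma_1(\lambda_{N+1})+\partial_\alpha\Big)\det_N\Big(\widehat S_{jj}\widehat S_{jk}\hat\gamma_1(\lambda_j)\hat\gamma_2(\mu_j)\hat\gamma_2(\mu_k)-\alpha\widehat S_{jj}\widehat S_{N+1\,k}\hat\gamma_1(\lambda_j)\hat\gamma_1(\lambda_{N+1})\hat\gamma_2(\mu_j)\hat\gamma_2(\mu_k)\Big)\Big|_{\alpha=0}|0).$$ **Theorem.** (1) For all $n\in\mathbb Z^{N+1}$ and all $\lambda\in\mathbb R^{N+1}$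 with $\lambda_j\ne\mu_k$ for all $j,k$: $\widehat I_n(\lambda)=I_n(\lambda)$. Assume from now on that no real solution $\lambda$ of $\tilde\varphi_j(\lambda)\in2\pi\mathbb Z$ ($j=1,\dots,N+1$) has some $\lambda_j$ equal to some $\mu_k$. (2) If $\operatorname{Im}t>0$, the form-factor series converges absolutely and $$\langle\psi(0,0)\psi^\dagger(x,t)\rangle_N=\sum_{n\in\mathbb Z^{N+1}}\int d^{N+1}\lambda\,I_n(\lambda)=\sum_{n\in\mathbb Z^{N+1}}\int d^{N+1}\lambda\,\widehat I_n(\lambda),$$ where $\sum_n\int F_n$ denotes $$\lim_{\delta\to0+}\lim_{\varepsilon\to0+}\sum_n e^{-\varepsilon\sum_jn_j^2}\int F_n(\lambda)\prod_{j,k}\frac{(\lambda_j-\mu_k)^2}{(\lambda_j-\mu_k)^2+\delta^2}\,d^{N+1}\lambda$$ (all these sums and integrals converging absolutely). (3) Summing over $n$ gives the determinant representation $$\langle\psi(0,0)\psi^\dagger(x,t)\rangle_N=C_N\,(\mathrm B|\Big(G_N+\partial_\alpha\Big)\det_N\big(\widehat U_{jk}-\alpha\widehat Q_j\widehat Q_k\big)\Big|_{\alpha=0}|0),$$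 with $\lambda_n$ the real root of $L\lambda_n-i\phi_1(\lambda_n)=2\pi n$, $2\pi\hat\rho(\lambda)=1-\frac iL\phi_1'(\lambda)$, $\hat s_j(\lambda)=t(\mu_j,\lambda)e^{-\phi_{D_1}(\lambda)}-t(\lambda,\mu_j)e^{-\phi_{A_2}(\lambda)}$, $$G_N=\frac1L\sum_{n\in\mathbb Z}\frac{e^{(\psi+\tau)(\lambda_n)}}{2\pi\hat\rho(\lambda_n)},\qquad \widehat Q_j=\frac1L\sum_{n\in\mathbb Z}\frac{e^{(\psi+\tau)(\lambda_n)-\frac12(\psi+\tau)(\mu_j)}}{2\pi\hat\rho(\lambda_n)}\hat s_j(\lambda_n),$$ $$\widehat U_{jk}=\frac1L\sum_{n\in\mathbb Z}\frac{e^{(\psi+\tau)(\lambda_n)-\frac12(\psi+\tau)(\mu_j)-\frac12(\psi+\tau)(\mu_k)}}{2\pi\hat\rho(\lambda_n)}\hat s_j(\lambda_n)\hat s_k(\lambda_n).$$ Here the sums are taken out of the determinant by multilinearity (root indices $n_1,\dots,n_{N+1}$: row $j$ has its own root $\lambda_{n_j}$; $G_N$ and $\widehat Q_k$ have $\lambda_{n_{N+1}}$).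 A product of functions of the operator roots is $\prod_jF_j(\lambda_{n_j})=\int d^{N+1}\lambda\prod_j\delta(\lambda_j-\lambda_{n_j})F_j(\lambda_j)$ with $\delta(y)=\lim_{\varepsilon\to0+}\frac1{2\varepsilon}1_{|y|\le\varepsilon}$, the limit being taken after the vacuum expectation value; functionals of $\phi_1$ act on vectors $\prod_me^{\beta_m\phi_2(u_m)}|0)$ (times exponentials of the fields $\phi_0,\phi_{A_j},\phi_{D_j}$), where each $p_2(u)$ is a number. Precisely: for every $t\in\mathbb C$ and $n\in\mathbb Z^{N+1}$ the resulting limit $R(n)$ of integrals exists; $R(n)=0$ if two of the $n_j$ coincide; for $n_1<\dots<n_{N+1}$ and $\lambda$ with $\tilde\varphi_j(\lambda)=2\pi n_j$ one has $\sum_{\sigma\in S_{N+1}}R(n_{\sigma(1)},\dots,n_{\sigma(N+1)})=A(\lambda)$; and if $\operatorname{Im}t>0$, $\sum_{n\in\mathbb Z^{N+1}}R(n)$ converges absolutely to $\langle\psi(0,0)\psi^\dagger(x,t)\rangle_N$. -/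

import Mathlib

open Filter Topology

noncomputable section

namespace DualFields

/-! ### Scalar functions of the model and the Bethe equations -/

/-- `h(a,b) = (a - b + ic)/(ic)`. -/
def hfun (c a b : ℝ) : ℂ := ((a : ℂ) - b + Complex.I * c) / (Complex.I * c)

/-- `t(a,b) = (ic)² / ((a - b)(a - b + ic))`. -/
def tfun (c a b : ℝ) : ℂ :=
  (Complex.I * c) ^ 2 / (((a : ℂ) - b) * ((a : ℂ) - b + Complex.I * c))

/-- `K(a,b) = 2c / (c² + (a - b)²)`. -/
def Kfun (c a b : ℝ) : ℝ := 2 * c / (c ^ 2 + (a - b) ^ 2)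

/-- `τ(a) = i t a² - i x a`. -/
def tau (x : ℝ) (t : ℂ) (a : ℝ) : ℂ := Complex.I * t * (a : ℂ) ^ 2 - Complex.I * x * a

/-- The matrix `δ_{jk} [L + ∑_l K(v_j, v_l)] - K(v_j, v_k)` of derivatives of the logarithmic
Bethe equations. -/
def gaudin {M : ℕ} (c L : ℝ) (v : Fin M → ℝ) : Matrix (Fin M) (Fin M) ℝ :=
  Matrix.of fun j k => (if j = k then L + ∑ l, Kfun c (v j) (v l) else 0) - Kfun c (v j) (v k)

/-- The logarithmic Bethe equations of the `N`-particle ground state: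
`L μ_j + ∑_k i ln ((ic + μ_j - μ_k)/(ic - μ_j + μ_k)) = 2π (j - (N+1)/2)`, `j = 1, …, N`. -/
def IsGroundState {N : ℕ} (c L : ℝ) (μ : Fin N → ℝ) : Prop :=
  ∀ j : Fin N, (L : ℂ) * μ j + ∑ k, Complex.I *
      Complex.log ((Complex.I * c + μ j - μ k) / (Complex.I * c - μ j + μ k))
    = 2 * Real.pi * (((j : ℕ) : ℂ) + 1 - ((N : ℂ) + 1) / 2)

/-- The logarithmic Bethe equations `φ̃_j(l) = 2π n_j` with integers `n_j`, where
`φ̃_j(l) = L l_j + ∑_k i ln (h(l_j,l_k)/h(l_k,l_j))`. For real arguments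
`h(a,b)/h(b,a)` has modulus one and is never `-1`, so the principal logarithm is its smooth branch
vanishing at `a = b`. -/
def IsBethe {M : ℕ} (c L : ℝ) (n : Fin M → ℤ) (l : Fin M → ℝ) : Prop :=
  ∀ j : Fin M, (L : ℂ) * l j + ∑ k, Complex.I *
      Complex.log (hfun c (l j) (l k) / hfun c (l k) (l j)) = 2 * Real.pi * (n j : ℂ)

/-- The eigenstates with `N + 1` particles: increasing sets of `N + 1` real solutions of the Bethe
equations. -/
def ExcitedState (N : ℕ) (c L : ℝ) : Type :=
  {l : Fin (N + 1) → ℝ // StrictMono l ∧ ∃ n : Fin (N + 1) → ℤ, IsBethe c L n l}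

/-! ### The form-factor series -/

variable {N : ℕ}

/-- `S_{jk} = t(μ_k,l_j) ∏_m h(μ_m,l_j) / ∏_p h(l_p,l_j) - t(l_j,μ_k) ∏_m h(l_j,μ_m) / ∏_p h(l_j,l_p)`,
with `j` in `1, …, N+1` and `k` in `1, …, N`. -/
def Smat (c : ℝ) (μ : Fin N → ℝ) (l : Fin (N + 1) → ℝ) (j : Fin (N + 1)) (k : Fin N) : ℂ :=
  tfun c (μ k) (l j) * ((∏ m, hfun c (μ m) (l j)) / ∏ p, hfun c (l p) (l j))
    - tfun c (l j) (μ k) * ((∏ m, hfun c (l j) (μ m)) / ∏ p, hfun c (l j) (l p))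

/-- `∑_ℓ (-1)^{ℓ-1} det S^{(ℓ)}`, where `S^{(ℓ)}` is `S` without its `ℓ`-th row. -/
def Mi (c : ℝ) (μ : Fin N → ℝ) (l : Fin (N + 1) → ℝ) : ℂ :=
  ∑ r : Fin (N + 1), (-1) ^ (r : ℕ) *
    (Matrix.of fun j k : Fin N => Smat c μ l (r.succAbove j) k).det

/-- `Δ({l}) = (∏_{j,k} h(l_j,l_k)) Mi² exp(∑_j τ(l_j) - ∑_m τ(μ_m))`. -/
def Delta (c x : ℝ) (t : ℂ) (μ : Fin N → ℝ) (l : Fin (N + 1) → ℝ) : ℂ :=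
  (∏ k, ∏ j, hfun c (l j) (l k)) * Mi c μ l ^ 2 *
    Complex.exp ((∑ j, tau x t (l j)) - ∑ m, tau x t (μ m))

/-- The prefactor `e^{-i h t} c^{-2N} / det_N (∂φ_j/∂μ_k)`. -/
def prefactor (c L hch : ℝ) (t : ℂ) (μ : Fin N → ℝ) : ℂ :=
  Complex.exp (-Complex.I * hch * t) / (c : ℂ) ^ (2 * N) / ((gaudin c L μ).det : ℂ)

/-- The contribution of the intermediate state `l` to the form-factor series. -/
def formFactorTerm (c L hch x : ℝ) (t : ℂ) (μ : Fin N → ℝ) (l : Fin (N + 1) → ℝ) : ℂ :=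
  prefactor c L hch t μ / (∏ j, ∏ k, hfun c (μ j) (μ k)) *
    (Delta c x t μ l / ((gaudin c L l).det : ℂ))

/-- The finite-volume correlation function `⟨ψ(0,0) ψ†(x,t)⟩_N`, as the sum over all intermediate
states of its form-factor series. -/
def correlation (c L hch x : ℝ) (t : ℂ) (μ : Fin N → ℝ) : ℂ :=
  ∑' s : ExcitedState N c L, formFactorTerm c L hch x t μ s.1

/-- `(∏_{j,k} h(l_j,l_k)) ∏_j e^{τ(l_j)} (1 + ∂_α) det_N (S_jj S_jk - α S_jj S_{N+1,k})` at `α = 0`;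
`α` is the polynomial variable. -/
def DeltaTilde (c x : ℝ) (t : ℂ) (μ : Fin N → ℝ) (l : Fin (N + 1) → ℝ) : ℂ :=
  let P : Polynomial ℂ := (Matrix.of fun j k : Fin N =>
    Polynomial.C (Smat c μ l j.castSucc j * Smat c μ l j.castSucc k) -
      Polynomial.X * Polynomial.C (Smat c μ l j.castSucc j * Smat c μ l (Fin.last N) k)).det
  (∏ j, ∏ k, hfun c (l j) (l k)) * (∏ j, Complex.exp (tau x t (l j))) *
    (P + Polynomial.derivative P).eval 0

/-- The summand/integrand of the Poisson-transformed form-factor series. -/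
def correlatorIntegrand (c L hch x : ℝ) (t : ℂ) (μ : Fin N → ℝ)
    (n : Fin (N + 1) → ℤ) (l : Fin (N + 1) → ℝ) : ℂ :=
  prefactor c L hch t μ * (∏ m, Complex.exp (-tau x t (μ m))) /
      (∏ j, ∏ k, hfun c (μ j) (μ k)) *
    (1 / (2 * Real.pi : ℂ) ^ (N + 1)) *
    (DeltaTilde c x t μ l *
      ∏ j, (Complex.exp (Complex.I * L * l j * n j) *
        (∏ k, hfun c (l k) (l j) / hfun c (l j) (l k)) ^ (n j)))

/-! ### The auxiliary Fock space and the dual fields -/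

/-- Labels of the dual fields `φ_0, φ_{A_1}, φ_{A_2}, φ_{D_1}, φ_{D_2}, φ_1, φ_2`. -/
inductive DualField : Type
  | f0 | A1 | A2 | D1 | D2 | f1 | f2

open DualField

/-- The c-number commutators `[p_a(u), q_b(v)]`. -/
def kappa (c : ℝ) (a b : DualField) (u v : ℝ) : ℂ :=
  match a, b with
  | f0, f0 => Complex.log (hfun c u v * hfun c v u)
  | D1, D1 => Complex.log (hfun c u v)
  | D2, D2 => Complex.log (hfun c u v)
  | A1, A1 => Complex.log (hfun c v u)
  | A2, A2 => Complex.log (hfun c v u)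
  | f1, f1 => Complex.log (hfun c u v / hfun c v u)
  | f2, f2 => Complex.log (hfun c v u / hfun c u v)
  | _, _ => 0

/-- The momentum paired with a coordinate in a dual field: `φ_a = q_a + p_{a.conj}`. -/
def DualField.conj : DualField → DualField
  | f0 => f0
  | A1 => D1
  | A2 => D2
  | D1 => A1
  | D2 => A2
  | f1 => f2
  | f2 => f1

/-- The auxiliary Fock space in the holomorphic (Bargmann-Fock) representation: vectors are
functions of the classical values `z_a(u)` of the creation operators `q_a(u)`. -/
abbrev Fock : Type := (DualField → ℝ → ℂ) → ℂ

/-- The vacuum `|0)`. -/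
def vac : Fock := fun _ => 1

/-- The dual vacuum `(0|`. -/
def dualVac : Fock →ₗ[ℂ] ℂ where
  toFun Ψ := Ψ 0
  map_add' _ _ := rfl
  map_smul' _ _ := rfl

/-- The coordinate `q_a(u)`: multiplication by `z_a(u)`. -/
def qOp (a : DualField) (u : ℝ) (Ψ : Fock) : Fock := fun z => z a u * Ψ z

/-- The shift of the classical values generated by `s p_a(u)`. -/
def shift (c : ℝ) (a : DualField) (u : ℝ) (s : ℂ) (z : DualField → ℝ → ℂ) :
    DualField → ℝ → ℂ := fun b v => z b v + s * kappa c a b u v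

/-- The momentum `p_a(u)`: the derivative along the direction `[p_a(u), q_b(v)]`. -/
def pOp (c : ℝ) (a : DualField) (u : ℝ) (Ψ : Fock) : Fock :=
  fun z => deriv (fun s : ℂ => Ψ (shift c a u s z)) 0

/-- `e^{β q_a(u)}`. -/
def qExp (a : DualField) (u : ℝ) (β : ℂ) : Module.End ℂ Fock where
  toFun Ψ := fun z => Complex.exp (β * z a u) * Ψ z
  map_add' _ _ := by funext z; simp [mul_add]
  map_smul' _ _ := by funext z; simp [mul_left_comm]

/-- `e^{β p_a(u)}`, a translation. -/
def pExp (c : ℝ) (a : DualField) (u : ℝ) (β : ℂ) : Module.End ℂ Fock where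
  toFun Ψ := fun z => Ψ (shift c a u β z)
  map_add' _ _ := rfl
  map_smul' _ _ := rfl

/-- The exponential `e^{β φ_a(u)}` of the dual field `φ_a(u) = q_a(u) + p_{a.conj}(u)`, which is
`e^{β² [p,q]/2} e^{β q} e^{β p}` because `[p,q]` is a number. -/
def phiExp (c : ℝ) (a : DualField) (u : ℝ) (β : ℂ) : Module.End ℂ Fock :=
  Complex.exp (β ^ 2 / 2 * kappa c a.conj a u u) • (qExp a u β * pExp c a.conj u β)

theorem pOp_vac (c : ℝ) (a : DualField) (u : ℝ) : pOp c a u vac = 0 := by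
  funext z; simp [pOp, vac]

theorem dualVac_qOp (a : DualField) (u : ℝ) (Ψ : Fock) : dualVac (qOp a u Ψ) = 0 := by
  simp [dualVac, qOp]

theorem dualVac_vac : dualVac vac = 1 := rfl

theorem shift_zero (c : ℝ) (a : DualField) (u : ℝ) (z : DualField → ℝ → ℂ) :
    shift c a u 0 z = z := by
  funext b v; simp [shift]

/-- `[p_a(u), q_b(v)] = kappa c a b u v` on every vector that is differentiable in the direction
of `p_a(u)`. -/
theorem pOp_qOp_commutator (c : ℝ) (a b : DualField) (u v : ℝ) (Ψ : Fock)
    (z : DualField → ℝ → ℂ)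
    (hΨ : DifferentiableAt ℂ (fun s : ℂ => Ψ (shift c a u s z)) 0) :
    pOp c a u (qOp b v Ψ) z - qOp b v (pOp c a u Ψ) z = kappa c a b u v * Ψ z := by
  have h1 : HasDerivAt (fun s : ℂ => z b v + s * kappa c a b u v) (kappa c a b u v) 0 := by
    simpa using ((hasDerivAt_id (0 : ℂ)).mul_const (kappa c a b u v)).const_add (z b v)
  have h2 := h1.mul hΨ.hasDerivAt
  have h3 : pOp c a u (qOp b v Ψ) z = _ := h2.deriv
  rw [h3]
  simp only [qOp, pOp, shift_zero]
  ring

/-- `e^{β p}` is the translation group generated by `p`. -/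
theorem hasDerivAt_pExp (c : ℝ) (a : DualField) (u : ℝ) (β : ℂ) (Ψ : Fock)
    (z : DualField → ℝ → ℂ)
    (hΨ : DifferentiableAt ℂ (fun s : ℂ => Ψ (shift c a u s (shift c a u β z))) 0) :
    HasDerivAt (fun s : ℂ => pExp c a u s Ψ z) (pExp c a u β (pOp c a u Ψ) z) β := by
  have h1 := hΨ.hasDerivAt
  have h3 : HasDerivAt (fun s : ℂ => Ψ (shift c a u s (shift c a u β z)))
      (deriv (fun s : ℂ => Ψ (shift c a u s (shift c a u β z))) 0) (β - β) := by
    simpa using h1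
  have h4 := HasDerivAt.comp_sub_const β β h3
  refine h4.congr_of_eventuallyEq (Eventually.of_forall fun s => ?_)
  change Ψ (shift c a u s z) = Ψ (shift c a u (s - β) (shift c a u β z))
  congr 1
  funext b v
  simp only [shift]
  ring

/-- The kernel `[p_{a.conj}(u), q_b(v)]` is symmetric, so that all dual fields commute. -/
theorem kappa_conj_symm (c : ℝ) (a b : DualField) (u v : ℝ) :
    kappa c a.conj b u v = kappa c b.conj a v u := by
  cases a <;> cases b <;> simp [kappa, DualField.conj, mul_comm]

theorem phiExp_commute (c : ℝ) (a b : DualField) (u v : ℝ) (β γ : ℂ) :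
    phiExp c a u β * phiExp c b v γ = phiExp c b v γ * phiExp c a u β := by
  ext Ψ z
  have hs : shift c b.conj v γ (shift c a.conj u β z)
      = shift c a.conj u β (shift c b.conj v γ z) := by
    funext d w; simp only [shift]; ring
  simp only [phiExp, qExp, pExp, Module.End.mul_apply, LinearMap.smul_apply, LinearMap.coe_mk,
    AddHom.coe_mk, Pi.smul_apply, smul_eq_mul]
  rw [hs]
  simp only [shift]
  rw [mul_add γ, mul_add β, Complex.exp_add, Complex.exp_add, kappa_conj_symm c b a v u]
  ring_nf

/-- The algebra of operators generated by the exponentials of the dual fields. -/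
def dualSubalgebra (c : ℝ) : Subalgebra ℂ (Module.End ℂ Fock) :=
  Algebra.adjoin ℂ {T | ∃ (a : DualField) (u : ℝ) (β : ℂ), T = phiExp c a u β}

theorem dualSubalgebra_comm (c : ℝ) (S T : dualSubalgebra c) : S * T = T * S :=
  (Algebra.isMulCommutative_adjoin ℂ (by
    rintro _ ⟨a, u, β, rfl⟩ _ ⟨b, v, γ, rfl⟩
    exact phiExp_commute c a b u v β γ)).is_comm.comm S T

/-- The same algebra, as a commutative ring. -/
def DualAlgebra (c : ℝ) : Type := dualSubalgebra c

instance (c : ℝ) : CommRing (DualAlgebra c) where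
  __ := (inferInstance : Ring (dualSubalgebra c))
  mul_comm := dualSubalgebra_comm c

instance (c : ℝ) : Algebra ℂ (DualAlgebra c) :=
  (inferInstance : Algebra ℂ (dualSubalgebra c))

/-- The action of the commutative algebra of dual fields on the Fock space. -/
def toEnd (c : ℝ) : DualAlgebra c →ₐ[ℂ] Module.End ℂ Fock := (dualSubalgebra c).val

/-- `e^{β φ_a(u)}` as an element of the commutative algebra of dual fields. -/
def E (c : ℝ) (a : DualField) (u : ℝ) (β : ℂ) : DualAlgebra c :=
  (⟨phiExp c a u β, Algebra.subset_adjoin ⟨a, u, β, rfl⟩⟩ : dualSubalgebra c)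

theorem toEnd_E (c : ℝ) (a : DualField) (u : ℝ) (β : ℂ) : toEnd c (E c a u β) = phiExp c a u β :=
  rfl

/-- `e^{β ψ(u)}` for `ψ = φ_0 + φ_{A_1} + φ_{D_2} + φ_2`. -/
def psiExp (c u : ℝ) (β : ℂ) : DualAlgebra c :=
  E c f0 u β * E c A1 u β * E c D2 u β * E c f2 u β

/-- `Ŝ = t(m,u) e^{-φ_{D_1}(u)} - t(u,m) e^{-φ_{A_2}(u)}` for `u = l_j`, `m = μ_k`. -/
def Shat (c u m : ℝ) : DualAlgebra c :=
  tfun c m u • E c D1 u (-1) - tfun c u m • E c A2 u (-1)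

/-- `γ̂_1 = exp(i L u n + τ(u) + ψ(u) + n φ_1(u))` for `u = l_j`, `n = n_j`. -/
def gamma1 (c L x : ℝ) (t : ℂ) (u : ℝ) (n : ℤ) : DualAlgebra c :=
  Complex.exp (Complex.I * L * u * n + tau x t u) • (psiExp c u 1 * E c f1 u n)

/-- `γ̂_2 = exp(-(τ(m) + ψ(m))/2)`. -/
def gamma2 (c x : ℝ) (t : ℂ) (m : ℝ) : DualAlgebra c :=
  Complex.exp (-(1 / 2) * tau x t m) • psiExp c m (-(1 / 2))

/-- The operator `(γ̂_1(l_{N+1}) + ∂_α) det_N (Ŝ_jj Ŝ_jk γ̂_1(l_j) γ̂_2(μ_j) γ̂_2(μ_k)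
  - α Ŝ_jj Ŝ_{N+1,k} γ̂_1(l_j) γ̂_1(l_{N+1}) γ̂_2(μ_j) γ̂_2(μ_k))` at `α = 0`;
`α` is the polynomial variable. -/
def detOperator (c L x : ℝ) (t : ℂ) (μ : Fin N → ℝ)
    (n : Fin (N + 1) → ℤ) (l : Fin (N + 1) → ℝ) : DualAlgebra c :=
  let g : Fin (N + 1) → DualAlgebra c := fun j => gamma1 c L x t (l j) (n j)
  let g' : Fin N → DualAlgebra c := fun k => gamma2 c x t (μ k)
  let S : Fin (N + 1) → Fin N → DualAlgebra c := fun j k => Shat c (l j) (μ k)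
  let P : Polynomial (DualAlgebra c) := (Matrix.of fun j k : Fin N =>
    Polynomial.C (S j.castSucc j * S j.castSucc k * g j.castSucc * g' j * g' k) -
      Polynomial.X * Polynomial.C
        (S j.castSucc j * S (Fin.last N) k * g j.castSucc * g (Fin.last N) * g' j * g' k)).det
  (Polynomial.C (g (Fin.last N)) * P + Polynomial.derivative P).eval 0

/-- The matrix element `(0| ∏_m (e^{p_0(μ_m)} e^{p_1(μ_m)}) Ψ`. -/
def bra (c : ℝ) (μ : Fin N → ℝ) (Ψ : Fock) : ℂ :=
  dualVac ((List.ofFn fun m : Fin N => pExp c f0 (μ m) 1 * pExp c f1 (μ m) 1).prod Ψ)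

/-- The summand/integrand of the dual-field representation of the correlation function. -/
def dualFieldIntegrand (c L hch x : ℝ) (t : ℂ) (μ : Fin N → ℝ)
    (n : Fin (N + 1) → ℤ) (l : Fin (N + 1) → ℝ) : ℂ :=
  prefactor c L hch t μ * ((1 / (2 * Real.pi : ℂ) ^ (N + 1)) *
    bra c μ (toEnd c (detOperator c L x t μ n l) vac))

/-! ### The meaning of the sum over `n` of the integrals over `l` -/

/-- A cut-off near the poles `l_j = μ_k` of the integrands; it tends to `1` off the poles as
`δ → 0`. -/
def poleCutoff (δ : ℝ) (μ : Fin N → ℝ) (l : Fin (N + 1) → ℝ) : ℝ :=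
  ∏ j, ∏ k, ((l j - μ k) ^ 2 / ((l j - μ k) ^ 2 + δ ^ 2))

/-- `∑_{n ∈ ℤ^{N+1}} ∫ d^{N+1}l F n l = s`, in the following regularised sense (each `F n` has
non-integrable poles at `l_j = μ_k`, and `∑_n e^{inu}` converges only in the summability sense in
which it is `2π ∑_m δ(u - 2πm)`): the poles are cut off at scale `δ`, the sum over `n` is a Gaussian
mean, and the limits are taken in the order `ε → 0`, `δ → 0`. All regularised integrals and sums
converge absolutely. -/
def HasSumIntegral (μ : Fin N → ℝ) (F : (Fin (N + 1) → ℤ) → (Fin (N + 1) → ℝ) → ℂ) (s : ℂ) :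
    Prop :=
  (∀ δ > 0, ∀ n, MeasureTheory.Integrable (fun l => (poleCutoff δ μ l : ℂ) * F n l)) ∧
  (∀ δ > 0, ∀ ε > 0, Summable fun n : Fin (N + 1) → ℤ =>
    (Real.exp (-ε * ∑ j, (n j : ℝ) ^ 2) : ℂ) * ∫ l, (poleCutoff δ μ l : ℂ) * F n l) ∧
  ∃ S : ℝ → ℂ,
    (∀ δ > 0, Tendsto (fun ε : ℝ => ∑' n : Fin (N + 1) → ℤ,
      (Real.exp (-ε * ∑ j, (n j : ℝ) ^ 2) : ℂ) * ∫ l, (poleCutoff δ μ l : ℂ) * F n l)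
      (𝓝[>] 0) (𝓝 (S δ))) ∧
    Tendsto S (𝓝[>] 0) (𝓝 s)

/-! ### The representation after summation over `n` -/

/-- A functional `G[φ_1]` of the dual field `φ_1 = q_1 + p_2`, on common eigenvectors `Ψ` of all the
`p_2(u)` (such as `∏_m e^{φ_2(u_m)} |0)`): there `p_2(u)` is its eigenvalue and `q_1(u)` is
multiplication by `z_1(u)`. -/
def phi1Functional (c : ℝ) (G : (ℝ → ℂ) → ℂ) (Ψ : Fock) : Fock :=
  fun z => G (fun u => z f1 u + pOp c f2 u Ψ z / Ψ z) * Ψ z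

theorem phi1Functional_of_eigen (c : ℝ) (G : (ℝ → ℂ) → ℂ) (Ψ : Fock) (f : ℝ → ℂ)
    (hΨ : ∀ u z, pOp c f2 u Ψ z = f u * Ψ z) (z : DualField → ℝ → ℂ) :
    phi1Functional c G Ψ z = G (fun u => z f1 u + f u) * Ψ z := by
  by_cases h : Ψ z = 0
  · simp [phi1Functional, h]
  · simp [phi1Functional, hΨ, h]

/-- On these eigenvectors the functional `e^{β f(u)}` of `φ_1` is the operator `e^{β φ_1(u)}`. -/
theorem phi1Functional_exp (c : ℝ) (Ψ : Fock) (f : ℝ → ℂ) (u : ℝ) (β : ℂ)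
    (hΨ : ∀ u z, pOp c f2 u Ψ z = f u * Ψ z)
    (hΨ' : ∀ z, pExp c f2 u β Ψ z = Complex.exp (β * f u) * Ψ z) :
    phi1Functional c (fun φ => Complex.exp (β * φ u)) Ψ = phiExp c f1 u β Ψ := by
  funext z
  rw [phi1Functional_of_eigen c _ Ψ f hΨ]
  have h : phiExp c f1 u β Ψ z = Complex.exp (β * z f1 u) * pExp c f2 u β Ψ z := by
    simp [phiExp, kappa, DualField.conj, qExp]
  rw [h, hΨ', mul_add, Complex.exp_add]
  ring

open Classical in
/-- The real root `l_n` of `L l - i φ_1(l) = 2π n`, as a functional of `φ_1`. -/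
def rootOf (L : ℝ) (n : ℤ) (φ : ℝ → ℂ) : ℝ :=
  if h : ∃ r : ℝ, (L : ℂ) * r - Complex.I * φ r = 2 * Real.pi * (n : ℂ) then h.choose else 0

/-- `2π ρ̂(u) = 1 - (i/L) φ_1'(u)`, as a functional of `φ_1`. -/
def twoPiRho (L u : ℝ) (φ : ℝ → ℂ) : ℂ := 1 - Complex.I / L * deriv φ u

/-- The approximation `(2ε)⁻¹ 1_{|y| ≤ ε}` of the delta function. -/
def deltaApprox (ε y : ℝ) : ℂ := if |y| ≤ ε then (1 / (2 * ε) : ℝ) else 0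

/-- `∏_{j=1}^{N+1} δ_ε(l_j - l_{n_j}) / (L · 2π ρ̂(l_j))`, as a functional of `φ_1`. -/
def rootWeight (L ε : ℝ) (n : Fin (N + 1) → ℤ) (l : Fin (N + 1) → ℝ) (φ : ℝ → ℂ) : ℂ :=
  ∏ j, deltaApprox ε (l j - rootOf L (n j) φ) / (L * twoPiRho L (l j) φ)

/-- The summand `e^{ψ(u) + τ(u)}` of `L · 2π ρ̂ · G_N`. -/
def gHat (c x : ℝ) (t : ℂ) (u : ℝ) : DualAlgebra c := Complex.exp (tau x t u) • psiExp c u 1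

/-- The summand of `Û_{jk}` for `m = μ_j`, `m' = μ_k`, at the root `u`, without
`1/(L · 2π ρ̂(u))`. -/
def uHat (c x : ℝ) (t : ℂ) (u m m' : ℝ) : DualAlgebra c :=
  Complex.exp (tau x t u - 1 / 2 * (tau x t m + tau x t m')) •
      (psiExp c u 1 * psiExp c m (-(1 / 2)) * psiExp c m' (-(1 / 2))) *
    (tfun c m' u • E c D1 u (-1) - tfun c u m' • E c A2 u (-1)) *
    (tfun c m u • E c D1 u (-1) - tfun c u m • E c A2 u (-1))

/-- The summand of `Q̂_j` for `m = μ_j`, at the root `u`, without `1/(L · 2π ρ̂(u))`. -/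
def qHat (c x : ℝ) (t : ℂ) (u m : ℝ) : DualAlgebra c :=
  Complex.exp (tau x t u - 1 / 2 * tau x t m) • (psiExp c u 1 * psiExp c m (-(1 / 2))) *
    (tfun c m u • E c D1 u (-1) - tfun c u m • E c A2 u (-1))

/-- `(G_N + ∂_α) det_N (Û_jk - α Q̂_j Q̂_k)` at `α = 0`, with the summations pulled out by
multilinearity: row `j` of the determinant has its own root `l_j`, and `G_N` and the factor `Q̂_k`
have the root `l_{N+1}`. -/
def rootDetOperator (c x : ℝ) (t : ℂ) (μ : Fin N → ℝ) (l : Fin (N + 1) → ℝ) : DualAlgebra c :=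
  let P : Polynomial (DualAlgebra c) := (Matrix.of fun j k : Fin N =>
    Polynomial.C (uHat c x t (l j.castSucc) (μ j) (μ k)) -
      Polynomial.X * Polynomial.C
        (qHat c x t (l j.castSucc) (μ j) * qHat c x t (l (Fin.last N)) (μ k))).det
  (Polynomial.C (gHat c x t (l (Fin.last N))) * P + Polynomial.derivative P).eval 0

/-- The integrand whose integral over `l`, as `ε → 0`, is the term with roots
`l_{n_1}, …, l_{n_{N+1}}` of the representation
`e^{-iht} c^{-2N} / det_N(∂φ_j/∂μ_k) · (0| ∏_m (e^{p_0(μ_m)} e^{p_1(μ_m)})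
  (G_N + ∂_α) det_N (Û_jk - α Q̂_j Q̂_k) |0)` at `α = 0`. Operator functions of the roots are
`F(l_n) = ∫ δ(l - l_n) F(l) dl`. -/
def rootIntegrand (c L hch x : ℝ) (t : ℂ) (μ : Fin N → ℝ) (ε : ℝ)
    (n : Fin (N + 1) → ℤ) (l : Fin (N + 1) → ℝ) : ℂ :=
  prefactor c L hch t μ * bra c μ (phi1Functional c (rootWeight L ε n l)
    (toEnd c (rootDetOperator c x t μ l) vac))

end DualFields

end

noncomputable section

namespace DualFields

/-! ### Rank-one perturbations of determinants -/

section Determinants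

variable {R : Type*} [CommRing R] {N : ℕ}

/-! Algebra. The expression `(g + ∂_α) det (a - α b dᵀ)` at `α = 0` is a bordered determinant. In
both integrands the weights factor out of its rows and columns, leaving `∏_j S_jj · det [S | 1]`,
with a last column of ones (`eval_zero_det_bordered`). Over commuting operators this splits the
dual-field determinant into a part built from `Ŝ` and exponentials of `ψ` and `φ_1`. Acting on the
vacuum, the `ψ`-exponentials create a state with charges `+1` at the `λ_j` and `-1` at the `μ_m`. It
is a common eigenvector of the momenta occurring in `Ŝ` and in `φ_1`, and the bra is evaluation at a
classical point. Hence every operator becomes a number: `Ŝ` becomes `S`, `φ_1(u)` becomes `i ∑_k θ(u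
- λ_k)` with `θ(y) = 2 arctan(y/c)` (the bra cancels the sources `μ`), and the `ψ`-state gives `∏
h(λ_j,λ_k) / ∏ h(μ_j,μ_k)`. This is statement (1). Symmetrising over permutations of `λ` turns `∏
S_jj · det [S | 1]` into `det [S | 1]²` by the Leibniz formula, which is the squared form factor
(`sum_perm_smatDet`).

Bethe equations. The map `φ̃` expands the supremum norm by at least `L` and has the Gaudin matrix,
of determinant at least `L^M`, as derivative. It is therefore a global homeomorphism, smooth enough
for a change of variables, and intermediate states correspond to increasing integer vectors
(`excitedStateEquiv`).

Sum over integrals. The `n`-dependence of the integrand is the character `e^{i n·φ̃(λ)}`. In the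
variables `u = φ̃(λ)` the regularised integrals are Fourier coefficients. Their Gaussian means
become sums of heat kernels centred on `(2πℤ)^{N+1}` by the theta functional equation, and
concentrate there as `ε → 0` (`tendsto_tsum_gaussian_mul_integral`). The Jacobian supplies the norm
`1 / det` of each state. Removing the pole cut-off needs summability without it. Since `N` is even,
the phase factor at each `μ_k` is `-1`, so the poles of `S` cancel on Bethe solutions
(`norm_Smat_betheRoots_le`), and for `Im t > 0` the Gaussian beats the remaining exponential growth.

Operator roots. With `φ_1` replaced by its value, the approximate delta functions become the
indicator of a small cell around a Bethe solution. After rescaling by `ε` the cell tends to a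
parallelepiped of volume `2^M ∏_j (L + ∑_k K) / det`. The product cancels the weights `L · 2πρ̂`,
again leaving `1 / det` (`tendsto_integral_rootCell`). -/

theorem det_fromBlocks_border (a : Matrix (Fin N) (Fin N) R) (b d : Fin N → R) (x g : R) :
    (Matrix.fromBlocks a (Matrix.of fun j (_ : Fin 1) => b j) (Matrix.of fun (_ : Fin 1) k => x * d k)
        (Matrix.of fun _ _ => g)).det
      = x * (Matrix.fromBlocks a (Matrix.of fun j (_ : Fin 1) => b j)
          (Matrix.of fun (_ : Fin 1) k => d k) 0).det + g * a.det := by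
  set A := Matrix.fromBlocks a (Matrix.of fun j (_ : Fin 1) => b j)
    (Matrix.of fun (_ : Fin 1) k => d k) 0 with hA
  have h0 : (Matrix.fromBlocks a (Matrix.of fun j (_ : Fin 1) => b j)
      (Matrix.of fun (_ : Fin 1) k => x * d k) (Matrix.of fun _ _ => g))
      = A.updateRow (Sum.inr 0) (x • (Sum.elim d (0 : Fin 1 → R)) + g • Sum.elim (0 : Fin N → R) (1 : Fin 1 → R)) := by
    ext i k
    rcases i with i | i
    · rw [Matrix.updateRow_ne (by simp)]
      rcases k with k | k <;> simp [hA]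
    · obtain rfl := Subsingleton.elim i 0
      rw [Matrix.updateRow_self]
      rcases k with k | k <;> simp
  have h1 : A.updateRow (Sum.inr 0) (Sum.elim d (0 : Fin 1 → R)) = A := by
    ext i k
    rcases i with i | i
    · rw [Matrix.updateRow_ne (by simp)]
    · obtain rfl := Subsingleton.elim i 0
      rw [Matrix.updateRow_self]
      rcases k with k | k <;> simp [hA]
  have h2 : A.updateRow (Sum.inr 0) (Sum.elim (0 : Fin N → R) (1 : Fin 1 → R))
      = Matrix.fromBlocks a (Matrix.of fun j (_ : Fin 1) => b j) 0 1 := by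
    ext i k
    rcases i with i | i
    · rw [Matrix.updateRow_ne (by simp)]
      rcases k with k | k <;> simp [hA]
    · obtain rfl := Subsingleton.elim i 0
      rw [Matrix.updateRow_self]
      rcases k with k | k
      · simp
      · obtain rfl := Subsingleton.elim k 0
        simp
  rw [h0, Matrix.det_updateRow_add, Matrix.det_updateRow_smul, Matrix.det_updateRow_smul, h1, h2,
    Matrix.det_fromBlocks_zero₂₁, Matrix.det_one, mul_one]

/-- `(g + ∂_α) det (a - α b dᵀ)` at `α = 0` is a bordered determinant. -/
theorem eval_zero_det_rankOne (a : Fin N → Fin N → R) (b d : Fin N → R) (g : R)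
    (P : Polynomial R)
    (hP : P = (Matrix.of fun j k : Fin N =>
      Polynomial.C (a j k) - Polynomial.X * Polynomial.C (b j * d k)).det) :
    (Polynomial.C g * P + Polynomial.derivative P).eval 0
      = (Matrix.fromBlocks (Matrix.of a) (Matrix.of fun j (_ : Fin 1) => b j)
          (Matrix.of fun (_ : Fin 1) k => d k) (Matrix.of fun _ _ => g)).det := by
  have h1 : P = Polynomial.X * Polynomial.C (Matrix.fromBlocks (Matrix.of a)
      (Matrix.of fun j (_ : Fin 1) => b j) (Matrix.of fun (_ : Fin 1) k => d k) 0).det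
      + Polynomial.C (Matrix.of a).det := by
    -- With corner `1` and bottom row `α d`, the Schur complement is `a - α b dᵀ`; linearity in the
    -- bottom row then shows that `P` is affine in `α`.
    have h2 := det_fromBlocks_border ((Matrix.of a).map Polynomial.C)
      (fun j => Polynomial.C (b j)) (fun j => Polynomial.C (d j)) Polynomial.X 1
    have h3 : (Matrix.of fun _ _ : Fin 1 => (1 : Polynomial R)) = 1 := by
      ext i k
      obtain rfl := Subsingleton.elim i k
      simp
    rw [h3, Matrix.det_fromBlocks_one₂₂] at h2
    have h4 : P = ((Matrix.of a).map Polynomial.C -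
        (Matrix.of fun j (_ : Fin 1) => Polynomial.C (b j)) *
        Matrix.of fun (_ : Fin 1) k => Polynomial.X * Polynomial.C (d k)).det := by
      rw [hP]
      congr 1
      ext1 j k
      simp [Matrix.mul_apply]
      ring
    rw [h4, h2, RingHom.map_det, RingHom.map_det, one_mul]
    congr 3
    ext1 i k
    rcases i with i | i <;> rcases k with k | k <;> simp
  have h5 := det_fromBlocks_border (Matrix.of a) b d 1 g
  simp only [one_mul] at h5
  rw [h5, h1]
  simp
  ring

/-- The matrix `S` bordered by a last column of ones. -/
def bordered (S : Fin (N + 1) → Fin N → R) : Matrix (Fin (N + 1)) (Fin (N + 1)) R :=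
  Matrix.of fun i k => Fin.lastCases (motive := fun _ => R) 1 (fun k => S i k) k

@[simp] theorem bordered_castSucc (S : Fin (N + 1) → Fin N → R) (i : Fin (N + 1)) (k : Fin N) :
    bordered S i k.castSucc = S i k := by simp [bordered]

@[simp] theorem bordered_last (S : Fin (N + 1) → Fin N → R) (i : Fin (N + 1)) :
    bordered S i (Fin.last N) = 1 := by simp [bordered]

/-- In the bordered matrix, row `j ≤ N` carries `s_j w_j v_j`, the last row carries `w_{N+1}`, and
column `k ≤ N` carries `v_k`. Removing these factors leaves `S` with a column of ones; `v` appears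
once from the rows and once from the columns, hence squared. -/
theorem eval_zero_det_bordered (w : Fin (N + 1) → R) (v s : Fin N → R) (S : Fin (N + 1) → Fin N → R)
    (P : Polynomial R)
    (hP : P = (Matrix.of fun j k : Fin N =>
      Polynomial.C (s j * S j.castSucc k * w j.castSucc * v j * v k) -
        Polynomial.X * Polynomial.C
          (s j * S (Fin.last N) k * w j.castSucc * w (Fin.last N) * v j * v k)).det) :
    (Polynomial.C (w (Fin.last N)) * P + Polynomial.derivative P).eval 0
      = (∏ j, w j) * (∏ k, v k ^ 2) * (∏ k, s k) * (bordered S).det := by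
  rw [eval_zero_det_rankOne (fun j k => s j * S j.castSucc k * w j.castSucc * v j * v k)
    (fun j => s j * w j.castSucc * v j) (fun k => S (Fin.last N) k * w (Fin.last N) * v k)
    (w (Fin.last N)) P (by
      rw [hP]
      congr 1
      ext1 j k
      simp only [Matrix.of_apply]
      congr 3
      ring)]
  have h1 : (bordered S).det = ((bordered S).submatrix (finSumFinEquiv (m := N) (n := 1))
      (finSumFinEquiv (m := N) (n := 1))).det :=
    (Matrix.det_submatrix_equiv_self (finSumFinEquiv (m := N) (n := 1)) _).symm
  have h2 := Matrix.det_mul_column (Sum.elim (fun j : Fin N => s j * w j.castSucc * v j)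
      (fun _ : Fin 1 => w (Fin.last N)))
    (Matrix.of fun i k => (Sum.elim v (fun _ : Fin 1 => 1) k) *
      ((bordered S).submatrix (finSumFinEquiv (m := N) (n := 1))
      (finSumFinEquiv (m := N) (n := 1))) i k)
  rw [Matrix.det_mul_row] at h2
  rw [Fin.prod_univ_castSucc, h1]
  calc _ = _ := by
        congr 1
        ext i k
        have hl : Fin.natAdd N (0 : Fin 1) = Fin.last N := rfl
        have hc : ∀ i : Fin N, Fin.castAdd 1 i = i.castSucc := fun _ => rfl
        rcases i with i | i <;> rcases k with k | k
        · simp [hc]; ring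
        · obtain rfl := Subsingleton.elim k 0
          simp [hc, hl]
        · obtain rfl := Subsingleton.elim i 0
          simp [hc, hl]; ring
        · obtain rfl := Subsingleton.elim k 0
          obtain rfl := Subsingleton.elim i 0
          simp [hl]
    _ = _ := h2
    _ = _ := by
        simp only [Fintype.prod_sum_type, Sum.elim_inl, Sum.elim_inr, Finset.prod_const_one,
          Finset.univ_unique, Finset.prod_singleton, Finset.prod_mul_distrib, Finset.prod_pow]
        ring

/-- Expansion of the bordered determinant along its column of ones. -/
theorem det_bordered_eq_sum (S : Fin (N + 1) → Fin N → R) :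
    (bordered S).det = (-1) ^ N * ∑ r : Fin (N + 1), (-1) ^ (r : ℕ) *
      (Matrix.of fun j k : Fin N => S (r.succAbove j) k).det := by
  rw [Matrix.det_succ_column _ (Fin.last N), Finset.mul_sum]
  refine Finset.sum_congr rfl fun r _ => ?_
  rw [bordered_last, mul_one, Fin.val_last, pow_add, mul_comm ((-1 : R) ^ (r : ℕ)), mul_assoc]
  congr 3
  ext j k
  simp

/-- Permuting the rows changes the determinant by the sign of `σ`. The signed sum of the diagonal
products that remains is the Leibniz expansion of the same determinant, since the column of ones
contributes `1` to each term. -/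
theorem sum_perm_prod_mul_det_bordered (S : Fin (N + 1) → Fin N → R) :
    ∑ σ : Equiv.Perm (Fin (N + 1)),
        (∏ j : Fin N, S (σ j.castSucc) j) * (bordered fun i => S (σ i)).det
      = (bordered S).det ^ 2 := by
  have h1 : ∀ σ : Equiv.Perm (Fin (N + 1)), (bordered fun i => S (σ i)).det
      = (Equiv.Perm.sign σ : R) * (bordered S).det := fun σ => by
    rw [← Matrix.det_permute]
    rfl
  simp_rw [h1, sq]
  have h2 := Matrix.det_apply' (bordered S)
  generalize (bordered S).det = D at h2 ⊢
  nth_rewrite 2 [h2]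
  rw [Finset.sum_mul]
  refine Finset.sum_congr rfl fun σ _ => ?_
  rw [Fin.prod_univ_castSucc]
  simp
  ring

end Determinants

/-! ### Calculus of exponentials of dual fields -/

section FockSpace

open DualField

variable {N : ℕ}

theorem toEnd_E_apply (c : ℝ) (a : DualField) (u : ℝ) (β : ℂ) (Ψ : Fock) (z : DualField → ℝ → ℂ) :
    toEnd c (E c a u β) Ψ z = Complex.exp (β ^ 2 / 2 * kappa c a.conj a u u) *
      (Complex.exp (β * z a u) * Ψ (shift c a.conj u β z)) := rfl

theorem toEnd_injective (c : ℝ) : Function.Injective (toEnd c) := Subtype.val_injective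

/-- Moving the translation past `e^{γ q}` produces `e^{βγ [p,q]}`, which completes `β²/2 + γ²/2` to
`(β + γ)²/2`. -/
theorem E_mul_E (c : ℝ) (a : DualField) (u : ℝ) (β γ : ℂ) :
    E c a u β * E c a u γ = E c a u (β + γ) := by
  apply toEnd_injective
  ext Ψ z
  rw [map_mul, Module.End.mul_apply, toEnd_E_apply, toEnd_E_apply, toEnd_E_apply]
  have h : shift c a.conj u γ (shift c a.conj u β z) = shift c a.conj u (β + γ) z := by
    funext b v; simp only [shift]; ring
  rw [h]
  simp only [← mul_assoc, ← Complex.exp_add]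
  congr 2
  simp only [shift]
  ring

theorem psiExp_mul_psiExp (c u : ℝ) (β γ : ℂ) :
    psiExp c u β * psiExp c u γ = psiExp c u (β + γ) := by
  simp only [psiExp, ← E_mul_E]
  ring

/-- The action of a product of exponentials of dual fields, in normally ordered form. -/
theorem toEnd_prod_E {ι : Type*} (c : ℝ) (s : Finset ι) (a : ι → DualField) (u : ι → ℝ)
    (β : ι → ℂ) (Ψ : Fock) (z : DualField → ℝ → ℂ) :
    toEnd c (∏ i ∈ s, E c (a i) (u i) (β i)) Ψ z
      = Complex.exp (1 / 2 * ∑ i ∈ s, ∑ k ∈ s, β i * β k * kappa c (a i).conj (a k) (u i) (u k)) *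
        Complex.exp (∑ i ∈ s, β i * z (a i) (u i)) *
        Ψ (fun b v => z b v + ∑ i ∈ s, β i * kappa c (a i).conj b (u i) v) := by
  classical
  induction s using Finset.induction_on generalizing z with
  | empty => simp
  | insert i s hi ih =>
    rw [Finset.prod_insert hi, map_mul, Module.End.mul_apply, toEnd_E_apply, ih]
    simp only [Finset.sum_insert hi]
    have h1 : (fun b v => shift c (a i).conj (u i) (β i) z b v +
        ∑ k ∈ s, β k * kappa c (a k).conj b (u k) v)
        = fun b v => z b v + (β i * kappa c (a i).conj b (u i) v +
          ∑ k ∈ s, β k * kappa c (a k).conj b (u k) v) := by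
      funext b v; simp only [shift]; ring
    rw [h1]
    simp only [← mul_assoc, ← Complex.exp_add]
    congr 2
    simp only [shift, mul_add, Finset.sum_add_distrib]
    -- The translation produces each cross contraction once, whereas the halved double sum contains
    -- it in both orders; they agree by the symmetry of the kernel.
    have h2 : ∑ k ∈ s, β k * β i * kappa c (a k).conj (a i) (u k) (u i)
        = ∑ k ∈ s, β i * β k * kappa c (a i).conj (a k) (u i) (u k) :=
      Finset.sum_congr rfl fun k _ => by rw [kappa_conj_symm c (a k) (a i)]; ring
    have h3 : ∑ k ∈ s, β k * (β i * kappa c (a i).conj (a k) (u i) (u k))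
        = ∑ k ∈ s, β i * β k * kappa c (a i).conj (a k) (u i) (u k) :=
      Finset.sum_congr rfl fun k _ => by ring
    rw [h2, h3]
    ring

/-- The vector `∏_i e^{β_i ψ(v_i)} |0)`. -/
def psiState {σ : Type*} [Fintype σ] (c : ℝ) (v : σ → ℝ) (β : σ → ℂ) : Fock := fun z =>
  Complex.exp (1 / 2 * ∑ i, ∑ k, β i * β k *
      Complex.log (hfun c (v i) (v k) * hfun c (v k) (v i))) *
    Complex.exp (∑ i, β i * (z f0 (v i) + z A1 (v i) + z D2 (v i) + z f2 (v i)))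

/-- Among the components of `ψ` only `φ_0` contracts with a component of `ψ`: the partners
`φ_{D_1}`, `φ_{A_2}`, `φ_1` of the other three do not occur in it. -/
theorem toEnd_prod_psiExp_vac {σ : Type*} [Fintype σ] (c : ℝ) (v : σ → ℝ) (β : σ → ℂ) :
    toEnd c (∏ i, psiExp c (v i) (β i)) vac = psiState c v β := by
  have h1 : ∏ i, psiExp c (v i) (β i)
      = ∏ p : σ × Fin 4, E c (![f0, A1, D2, f2] p.2) (v p.1) (β p.1) := by
    rw [Fintype.prod_prod_type]
    refine Finset.prod_congr rfl fun i _ => ?_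
    simp [Fin.prod_univ_four, psiExp]
  rw [h1]
  funext z
  rw [toEnd_prod_E]
  simp only [vac, mul_one, psiState]
  congr 2
  · congr 1
    rw [Fintype.sum_prod_type]
    refine Finset.sum_congr rfl fun i _ => ?_
    simp [Fin.sum_univ_four, Fintype.sum_prod_type, kappa, DualField.conj]
  · rw [Fintype.sum_prod_type]
    refine Finset.sum_congr rfl fun i _ => ?_
    simp [Fin.sum_univ_four]
    ring

/-- Common eigenvectors of `e^{s p_{A_1}(u)}`, `e^{s p_{D_2}(u)}` and `e^{s p_2(u)}`. -/
structure IsEigenstate (c : ℝ) (a d f : ℝ → ℂ) (Ψ : Fock) : Prop where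
  shift_A1 : ∀ u s z, Ψ (shift c A1 u s z) = Complex.exp (s * a u) * Ψ z
  shift_D2 : ∀ u s z, Ψ (shift c D2 u s z) = Complex.exp (s * d u) * Ψ z
  shift_f2 : ∀ u s z, Ψ (shift c f2 u s z) = Complex.exp (s * f u) * Ψ z

theorem IsEigenstate.pOp {c : ℝ} {a d f : ℝ → ℂ} {Ψ : Fock} (h : IsEigenstate c a d f Ψ)
    (u : ℝ) (z : DualField → ℝ → ℂ) : pOp c f2 u Ψ z = f u * Ψ z := by
  have h1 : HasDerivAt (fun s : ℂ => Complex.exp (s * f u) * Ψ z)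
      (Complex.exp (0 * f u) * (1 * f u) * Ψ z) 0 :=
    (((hasDerivAt_id (0 : ℂ)).mul_const (f u)).cexp).mul_const _
  simp only [DualFields.pOp, h.shift_f2]
  rw [h1.deriv]
  simp

theorem IsEigenstate.smul {c : ℝ} {a d f : ℝ → ℂ} {Ψ : Fock} (h : IsEigenstate c a d f Ψ)
    (r : ℂ) : IsEigenstate c a d f (r • Ψ) := by
  refine ⟨fun u s w => ?_, fun u s w => ?_, fun u s w => ?_⟩
  · simp only [Pi.smul_apply, smul_eq_mul, h.shift_A1]; ring
  · simp only [Pi.smul_apply, smul_eq_mul, h.shift_D2]; ring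
  · simp only [Pi.smul_apply, smul_eq_mul, h.shift_f2]; ring

/-- The sources felt by `p_{A_1}`, `p_{D_2}` and `p_2` in the state `∏_i e^{β_i ψ(v_i)} |0)`. -/
theorem isEigenstate_psiState {σ : Type*} [Fintype σ] (c : ℝ) (v : σ → ℝ) (β : σ → ℂ) :
    IsEigenstate c (fun u => ∑ i, β i * Complex.log (hfun c (v i) u))
      (fun u => ∑ i, β i * Complex.log (hfun c u (v i)))
      (fun u => ∑ i, β i * Complex.log (hfun c (v i) u / hfun c u (v i))) (psiState c v β) := by
  constructor <;> intro u s z <;>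
  · simp only [psiState, shift, kappa]
    rw [mul_left_comm]
    congr 1
    rw [← Complex.exp_add, Finset.mul_sum, ← Finset.sum_add_distrib]
    congr 1
    refine Finset.sum_congr rfl fun i _ => ?_
    ring

/-- Pairs of an operator `X` and a number `χ` such that `X` preserves the eigenstates with given
sources and acts on them, evaluated at `z`, as `χ`. -/
def evalSubalgebra (c : ℝ) (a d f : ℝ → ℂ) (z : DualField → ℝ → ℂ) :
    Subalgebra ℂ (DualAlgebra c × ℂ) where
  carrier := {X | ∀ Ψ, IsEigenstate c a d f Ψ →
    IsEigenstate c a d f (toEnd c X.1 Ψ) ∧ toEnd c X.1 Ψ z = X.2 * Ψ z}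
  mul_mem' := by
    intro X Y hX hY Ψ hΨ
    -- The value of `X` is known only on eigenstates, so closure under products needs `Y` to map
    -- eigenstates to eigenstates with the same sources.
    obtain ⟨h1, h2⟩ := hY Ψ hΨ
    obtain ⟨h3, h4⟩ := hX _ h1
    simp only [Prod.fst_mul, Prod.snd_mul, map_mul, Module.End.mul_apply]
    exact ⟨h3, by rw [h4, h2, mul_assoc]⟩
  add_mem' := by
    intro X Y hX hY Ψ hΨ
    obtain ⟨h1, h2⟩ := hY Ψ hΨ
    obtain ⟨h3, h4⟩ := hX Ψ hΨ
    simp only [Prod.fst_add, Prod.snd_add, map_add, LinearMap.add_apply]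
    refine ⟨⟨fun u s w => ?_, fun u s w => ?_, fun u s w => ?_⟩, by
      rw [Pi.add_apply, h4, h2, add_mul]⟩
    · rw [Pi.add_apply, Pi.add_apply, h1.shift_A1, h3.shift_A1, mul_add]
    · rw [Pi.add_apply, Pi.add_apply, h1.shift_D2, h3.shift_D2, mul_add]
    · rw [Pi.add_apply, Pi.add_apply, h1.shift_f2, h3.shift_f2, mul_add]
  algebraMap_mem' := by
    intro r Ψ hΨ
    change IsEigenstate c a d f (r • Ψ) ∧ (r • Ψ) z = r * Ψ z
    exact ⟨hΨ.smul r, rfl⟩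

/-- In `φ_{D_1} = q_{D_1} + p_{A_1}` the momentum acts on an eigenstate as a number. The factor
`e^{-q_{D_1}}` is invariant under the three translations, so the sources are kept, and it equals `1`
at `z`. -/
theorem E_D1_mem_evalSubalgebra (c : ℝ) (a d f : ℝ → ℂ) (z : DualField → ℝ → ℂ)
    (hz : ∀ u, z D1 u = 0) (u : ℝ) :
    (E c D1 u (-1), Complex.exp (-a u)) ∈ evalSubalgebra c a d f z := by
  intro Ψ hΨ
  have h : ∀ w, toEnd c (E c D1 u (-1)) Ψ w
      = Complex.exp (-w D1 u) * (Complex.exp (-a u) * Ψ w) := fun w => by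
    rw [toEnd_E_apply]
    simp [kappa, DualField.conj, hΨ.shift_A1]
  refine ⟨⟨fun v s w => ?_, fun v s w => ?_, fun v s w => ?_⟩, by rw [h]; simp [hz]⟩
  · simp only [h, hΨ.shift_A1]; simp only [shift, kappa]; ring_nf
  · simp only [h, hΨ.shift_D2]; simp only [shift, kappa]; ring_nf
  · simp only [h, hΨ.shift_f2]; simp only [shift, kappa]; ring_nf

theorem E_A2_mem_evalSubalgebra (c : ℝ) (a d f : ℝ → ℂ) (z : DualField → ℝ → ℂ)
    (hz : ∀ u, z A2 u = 0) (u : ℝ) :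
    (E c A2 u (-1), Complex.exp (-d u)) ∈ evalSubalgebra c a d f z := by
  intro Ψ hΨ
  have h : ∀ w, toEnd c (E c A2 u (-1)) Ψ w
      = Complex.exp (-w A2 u) * (Complex.exp (-d u) * Ψ w) := fun w => by
    rw [toEnd_E_apply]
    simp [kappa, DualField.conj, hΨ.shift_D2]
  refine ⟨⟨fun v s w => ?_, fun v s w => ?_, fun v s w => ?_⟩, by rw [h]; simp [hz]⟩
  · simp only [h, hΨ.shift_A1]; simp only [shift, kappa]; ring_nf
  · simp only [h, hΨ.shift_D2]; simp only [shift, kappa]; ring_nf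
  · simp only [h, hΨ.shift_f2]; simp only [shift, kappa]; ring_nf

/-- The operator `∏_j Ŝ_jj det [Ŝ | 1]` of the dual-field determinants. -/
def shatDet (c : ℝ) (μ : Fin N → ℝ) (l : Fin (N + 1) → ℝ) : DualAlgebra c :=
  (∏ j : Fin N, Shat c (l j.castSucc) (μ j)) * (bordered fun j k => Shat c (l j) (μ k)).det

theorem shatDet_mem_evalSubalgebra (c : ℝ) (a d f : ℝ → ℂ) (z : DualField → ℝ → ℂ)
    (hz : ∀ u, z D1 u = 0) (hz' : ∀ u, z A2 u = 0) (μ : Fin N → ℝ) (l : Fin (N + 1) → ℝ)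
    (S : Fin (N + 1) → Fin N → ℂ)
    (hS : ∀ j k, S j k = tfun c (μ k) (l j) * Complex.exp (-a (l j))
      - tfun c (l j) (μ k) * Complex.exp (-d (l j))) :
    (shatDet c μ l, (∏ j : Fin N, S j.castSucc j) * (bordered S).det)
      ∈ evalSubalgebra c a d f z := by
  have h1 : ∀ j k, (Shat c (l j) (μ k), S j k) ∈ evalSubalgebra c a d f z := fun j k => by
    have h2 := (evalSubalgebra c a d f z).sub_mem
      ((evalSubalgebra c a d f z).smul_mem (E_D1_mem_evalSubalgebra c a d f z hz (l j))
        (tfun c (μ k) (l j)))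
      ((evalSubalgebra c a d f z).smul_mem (E_A2_mem_evalSubalgebra c a d f z hz' (l j))
        (tfun c (l j) (μ k)))
    rw [hS]
    exact h2
  -- The determinant is formed once in the commutative ring of pairs; its two coordinate projections
  -- are ring homomorphisms and give the operator and its value.
  let X : Fin (N + 1) → Fin N → evalSubalgebra c a d f z := fun j k => ⟨_, h1 j k⟩
  let F : evalSubalgebra c a d f z →+* DualAlgebra c :=
    (RingHom.fst _ _).comp (evalSubalgebra c a d f z).val.toRingHom
  let G : evalSubalgebra c a d f z →+* ℂ :=
    (RingHom.snd _ _).comp (evalSubalgebra c a d f z).val.toRingHom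
  have h2 : ∀ {R : Type} [CommRing R] (φ : evalSubalgebra c a d f z →+* R),
      φ ((∏ j : Fin N, X j.castSucc j) * (bordered X).det)
        = (∏ j : Fin N, φ (X j.castSucc j)) * (bordered fun j k => φ (X j k)).det := by
    intro R _ φ
    rw [map_mul, map_prod, RingHom.map_det]
    congr 2
    ext i k
    refine Fin.lastCases ?_ (fun k => ?_) k <;> simp
  have h3 := ((∏ j : Fin N, X j.castSucc j) * (bordered X).det).2
  have h4 : (((∏ j : Fin N, X j.castSucc j) * (bordered X).det : evalSubalgebra c a d f z) :
      DualAlgebra c × ℂ) = (shatDet c μ l, (∏ j : Fin N, S j.castSucc j) * (bordered S).det) :=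
    Prod.ext (h2 F) (h2 G)
  rwa [h4] at h3

/-- The classical point at which `(0| ∏_m e^{p_0(μ_m)} e^{p_1(μ_m)}` evaluates. -/
def braPoint (c : ℝ) (μ : Fin N → ℝ) : DualField → ℝ → ℂ := fun b v =>
  ∑ m, (kappa c f0 b (μ m) v + kappa c f1 b (μ m) v)

/-- The dual vacuum evaluates at the origin, and the exponentials of momenta translate this point by
the sum of their shifts. -/
theorem bra_apply (c : ℝ) (μ : Fin N → ℝ) (Ψ : Fock) : bra c μ Ψ = Ψ (braPoint c μ) := by
  have h : ∀ (s : List ℝ) (z : DualField → ℝ → ℂ),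
      (s.map fun m => pExp c f0 m 1 * pExp c f1 m 1).prod Ψ z
        = Ψ fun b v => z b v + (s.map fun m => kappa c f0 b m v + kappa c f1 b m v).sum := by
    intro s
    induction s with
    | nil => intro z; simp
    | cons m s ih =>
      intro z
      rw [List.map_cons, List.prod_cons, Module.End.mul_apply, Module.End.mul_apply]
      change (s.map fun m => pExp c f0 m 1 * pExp c f1 m 1).prod Ψ
        (shift c f1 m 1 (shift c f0 m 1 z)) = _
      rw [ih]
      congr 1
      funext b v
      simp only [shift, List.map_cons, List.sum_cons]
      ring
  have h2 : (List.ofFn fun m : Fin N => pExp c f0 (μ m) 1 * pExp c f1 (μ m) 1)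
      = (List.ofFn μ).map fun m => pExp c f0 m 1 * pExp c f1 m 1 := by
    rw [List.map_ofFn]; rfl
  rw [bra, h2]
  change ((List.ofFn μ).map fun m => pExp c f0 m 1 * pExp c f1 m 1).prod Ψ 0 = _
  rw [h]
  congr 1
  funext b v
  simp [braPoint, List.map_ofFn, List.sum_ofFn]

end FockSpace

/-! ### Vacuum expectation values -/

section Vacuum

open DualField

variable {N : ℕ} {c : ℝ}

theorem hfun_eq (hc : 0 < c) (a b : ℝ) : hfun c a b = 1 + ((-((a - b) / c) : ℝ) : ℂ) * Complex.I := by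
  have h : (c : ℂ) ≠ 0 := by exact_mod_cast hc.ne'
  rw [hfun]
  field_simp
  push_cast
  field_simp
  ring_nf
  rw [Complex.I_sq]
  ring

theorem hfun_ne_zero (hc : 0 < c) (a b : ℝ) : hfun c a b ≠ 0 := by
  intro h
  have := congrArg Complex.re h
  rw [hfun_eq hc] at this
  simp at this

/-- Both factors have real part `1`, so each argument is less than `π/2` in absolute value and no
branch cut is crossed. -/
theorem log_hfun_mul (hc : 0 < c) (a b : ℝ) :
    Complex.log (hfun c a b * hfun c b a)
      = Complex.log (hfun c a b) + Complex.log (hfun c b a) := by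
  have h : ∀ a b, |Complex.arg (hfun c a b)| < Real.pi / 2 := fun a b => by
    rw [Complex.abs_arg_lt_pi_div_two_iff]
    left
    rw [hfun_eq hc]
    simp
  have h1 := abs_lt.1 (h a b)
  have h2 := abs_lt.1 (h b a)
  refine Complex.log_mul (hfun_ne_zero hc _ _) (hfun_ne_zero hc _ _) ⟨?_, ?_⟩ <;> linarith

/-- The classical value of `φ_1`, fed by sources at the rapidities `l`. -/
def phiValue (c : ℝ) (l : Fin (N + 1) → ℝ) (u : ℝ) : ℂ :=
  ∑ k, Complex.log (hfun c (l k) u / hfun c u (l k))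

theorem exp_phiValue (hc : 0 < c) (l : Fin (N + 1) → ℝ) (u : ℝ) :
    Complex.exp (phiValue c l u) = ∏ k, hfun c (l k) u / hfun c u (l k) := by
  rw [phiValue, Complex.exp_sum]
  exact Finset.prod_congr rfl fun k _ =>
    Complex.exp_log (div_ne_zero (hfun_ne_zero hc _ _) (hfun_ne_zero hc _ _))

/-- The charges of the sources `l_j` and `μ_m` of `ψ`. -/
def charge (N : ℕ) : Fin (N + 1) ⊕ Fin N → ℂ := Sum.elim 1 (-1)

/-- The factors `e^{p_0(μ_m)}` of the bra cancel the cross contractions between `l` and `μ`, and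
turn the `μ`–`μ` contraction from a numerator into a denominator. -/
theorem psiState_braPoint (hc : 0 < c) (μ : Fin N → ℝ) (l : Fin (N + 1) → ℝ) :
    psiState c (Sum.elim l μ) (charge N) (braPoint c μ)
      = (∏ j, ∏ k, hfun c (l j) (l k)) / ∏ j, ∏ k, hfun c (μ j) (μ k) := by
  have h1 : ∀ {M : ℕ} (v : Fin M → ℝ), ∏ j, ∏ k, hfun c (v j) (v k)
      = Complex.exp (∑ j, ∑ k, Complex.log (hfun c (v j) (v k))) := fun v => by
    simp only [Complex.exp_sum, Complex.exp_log (hfun_ne_zero hc _ _)]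
  rw [h1, h1, ← Complex.exp_sub, psiState, ← Complex.exp_add]
  congr 1
  simp only [braPoint, kappa, charge, Fintype.sum_sum_type, Sum.elim_inl, Sum.elim_inr,
    log_hfun_mul hc, Pi.one_apply, Pi.neg_apply, add_zero, Finset.sum_const_zero, one_mul, mul_one,
    neg_mul, mul_neg, Finset.sum_neg_distrib, Finset.sum_add_distrib]
  rw [Finset.sum_comm (f := fun (i : Fin N) (j : Fin (N + 1)) => Complex.log (hfun c (μ i) (l j))),
    Finset.sum_comm (f := fun (i : Fin N) (j : Fin (N + 1)) => Complex.log (hfun c (l j) (μ i))),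
    Finset.sum_comm (f := fun (i j : Fin N) => Complex.log (hfun c (μ j) (μ i))),
    Finset.sum_comm (f := fun (i j : Fin (N + 1)) => Complex.log (hfun c (l j) (l i)))]
  ring

/-- The value of `φ_1` in the matrix element `(0| ∏_m e^{p_0(μ_m)} e^{p_1(μ_m)} ⋯`: the sources `μ`
cancel. -/
theorem braPoint_f1_add (μ : Fin N → ℝ) (l : Fin (N + 1) → ℝ) (u : ℝ) :
    braPoint c μ f1 u + ∑ i, charge N i *
      Complex.log (hfun c (Sum.elim l μ i) u / hfun c u (Sum.elim l μ i)) = phiValue c l u := by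
  simp [braPoint, kappa, charge, phiValue, Fintype.sum_sum_type]

theorem exp_neg_sum_charge (F : ℝ → ℂ) (hF : ∀ v, F v ≠ 0) (μ : Fin N → ℝ)
    (l : Fin (N + 1) → ℝ) :
    Complex.exp (-∑ i, charge N i * Complex.log (F (Sum.elim l μ i)))
      = (∏ m, F (μ m)) / ∏ p, F (l p) := by
  have : -∑ i, charge N i * Complex.log (F (Sum.elim l μ i))
      = ∑ m, Complex.log (F (μ m)) - ∑ p, Complex.log (F (l p)) := by
    simp [charge, Fintype.sum_sum_type]
    ring
  rw [this, Complex.exp_sub, Complex.exp_sum, Complex.exp_sum]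
  simp only [Complex.exp_log (hF _)]

/-- `∏_j S_jj det [S | 1]`. -/
def smatDet (c : ℝ) (μ : Fin N → ℝ) (l : Fin (N + 1) → ℝ) : ℂ :=
  (∏ j : Fin N, Smat c μ l j.castSucc j) * (bordered (Smat c μ l)).det

/-- The bra contains only `p_0` and `p_1`, so its point has no `D_1` or `A_2` component. The
eigenvalues of the momenta in `e^{-φ_{D_1}}` and `e^{-φ_{A_2}}` are exactly the quotients of
products of `h` in `S`. -/
theorem shatDet_mem (hc : 0 < c) (μ : Fin N → ℝ) (l : Fin (N + 1) → ℝ) :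
    (shatDet c μ l, smatDet c μ l) ∈ evalSubalgebra c
      (fun u => ∑ i, charge N i * Complex.log (hfun c (Sum.elim l μ i) u))
      (fun u => ∑ i, charge N i * Complex.log (hfun c u (Sum.elim l μ i)))
      (fun u => ∑ i, charge N i *
        Complex.log (hfun c (Sum.elim l μ i) u / hfun c u (Sum.elim l μ i)))
      (braPoint c μ) := by
  refine shatDet_mem_evalSubalgebra c _ _ _ _ (fun u => by simp [braPoint, kappa])
    (fun u => by simp [braPoint, kappa]) μ l _ fun j k => ?_
  rw [exp_neg_sum_charge (fun v => hfun c v (l j)) (fun v => hfun_ne_zero hc _ _),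
    exp_neg_sum_charge (fun v => hfun c (l j) v) (fun v => hfun_ne_zero hc _ _)]
  rfl

theorem prod_psiExp_eq (μ : Fin N → ℝ) (l : Fin (N + 1) → ℝ) :
    (∏ j, psiExp c (l j) 1) * ∏ k, psiExp c (μ k) (-1)
      = ∏ i, psiExp c (Sum.elim l μ i) (charge N i) := by
  simp [charge, Fintype.prod_sum_type]

theorem gamma2_sq (x : ℝ) (t : ℂ) (m : ℝ) :
    gamma2 c x t m ^ 2 = Complex.exp (-tau x t m) • psiExp c m (-1) := by
  rw [pow_two (gamma2 c x t m), gamma2, smul_mul_smul_comm, ← Complex.exp_add, psiExp_mul_psiExp,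
    show -(1 / 2 : ℂ) + -(1 / 2) = -1 by norm_num,
    show -(1 / 2) * tau x t m + -(1 / 2) * tau x t m = -tau x t m by ring]

theorem uHat_eq (x : ℝ) (t : ℂ) (u m m' : ℝ) : uHat c x t u m m'
    = Shat c u m * Shat c u m' * gHat c x t u * gamma2 c x t m * gamma2 c x t m' := by
  have h : uHat c x t u m m' = Complex.exp (tau x t u - 1 / 2 * (tau x t m + tau x t m')) •
      (psiExp c u 1 * psiExp c m (-(1 / 2)) * psiExp c m' (-(1 / 2))) *
        Shat c u m' * Shat c u m := by rw [uHat, Shat, Shat]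
  have h2 : tau x t u - 1 / 2 * (tau x t m + tau x t m')
    = tau x t u + -(1 / 2) * tau x t m + -(1 / 2) * tau x t m' := by ring
  rw [h, h2, Complex.exp_add, Complex.exp_add]
  simp only [gHat, gamma2, Algebra.smul_def, map_mul]
  ring

theorem qHat_eq (x : ℝ) (t : ℂ) (u m : ℝ) :
    qHat c x t u m = Shat c u m * gHat c x t u * gamma2 c x t m := by
  have h : qHat c x t u m = Complex.exp (tau x t u - 1 / 2 * tau x t m) •
      (psiExp c u 1 * psiExp c m (-(1 / 2))) * Shat c u m := by rw [qHat, Shat]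
  have h2 : tau x t u - 1 / 2 * tau x t m = tau x t u + -(1 / 2) * tau x t m := by ring
  rw [h, h2, Complex.exp_add]
  simp only [gHat, gamma2, Algebra.smul_def, map_mul]
  ring

/-- Once `uHat` and `qHat` are factorised, this is the bordered identity with weights `gHat` and
`gamma2`. The square of `gamma2` carries `e^{-ψ(μ)}`, which is the charge `-1` of the source `μ`. -/
theorem rootDetOperator_eq (x : ℝ) (t : ℂ) (μ : Fin N → ℝ) (l : Fin (N + 1) → ℝ) :
    rootDetOperator c x t μ l
      = ((∏ j, Complex.exp (tau x t (l j))) * ∏ m, Complex.exp (-tau x t (μ m))) •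
        (shatDet c μ l * ∏ i, psiExp c (Sum.elim l μ i) (charge N i)) := by
  rw [rootDetOperator]
  rw [eval_zero_det_bordered (fun j => gHat c x t (l j)) (fun k => gamma2 c x t (μ k))
    (fun k => Shat c (l k.castSucc) (μ k)) (fun j k => Shat c (l j) (μ k)) _ (by
      congr 1
      ext1 j k
      have h : ∀ a b d e f g : DualAlgebra c, a * b * d * (e * f * g) = a * e * b * f * d * g :=
        fun a b d e f g => by ring
      simp only [Matrix.of_apply, uHat_eq, qHat_eq, h])]
  simp only [gamma2_sq, gHat, Finset.prod_smul]
  rw [← prod_psiExp_eq, shatDet]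
  simp only [Algebra.smul_def, map_mul]
  ring

theorem detOperator_eq (L x : ℝ) (t : ℂ) (μ : Fin N → ℝ) (n : Fin (N + 1) → ℤ)
    (l : Fin (N + 1) → ℝ) :
    detOperator c L x t μ n l
      = ((∏ j, Complex.exp (Complex.I * L * l j * n j)) *
          ((∏ j, Complex.exp (tau x t (l j))) * ∏ m, Complex.exp (-tau x t (μ m)))) •
        (shatDet c μ l * ((∏ j, E c f1 (l j) (n j)) *
          ∏ i, psiExp c (Sum.elim l μ i) (charge N i))) := by
  rw [detOperator]
  rw [eval_zero_det_bordered (fun j => gamma1 c L x t (l j) (n j)) (fun k => gamma2 c x t (μ k))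
    (fun k => Shat c (l k.castSucc) (μ k)) (fun j k => Shat c (l j) (μ k)) _ rfl]
  simp only [gamma2_sq, gamma1, Finset.prod_smul, Finset.prod_mul_distrib, Complex.exp_add]
  rw [← prod_psiExp_eq, shatDet]
  simp only [Algebra.smul_def, map_mul]
  ring

/-- The common factor of the integrands after taking the vacuum expectation value. -/
def vevFactor (c x : ℝ) (t : ℂ) (μ : Fin N → ℝ) (l : Fin (N + 1) → ℝ) : ℂ :=
  ((∏ j, Complex.exp (tau x t (l j))) * ∏ m, Complex.exp (-tau x t (μ m))) *
    (smatDet c μ l *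
      ((∏ j, ∏ k, hfun c (l j) (l k)) / ∏ j, ∏ k, hfun c (μ j) (μ k)))

/-- The commuting factors are ordered so that `ψ` acts first, then `φ_1`, then `shatDet`. The
exponentials of `φ_1` only multiply by functions of `z_1`, which the three translations do not move,
so the state reaching `shatDet` still has the same sources. -/
theorem bra_detOperator (hc : 0 < c) (L x : ℝ) (t : ℂ) (μ : Fin N → ℝ) (n : Fin (N + 1) → ℤ)
    (l : Fin (N + 1) → ℝ) :
    bra c μ (toEnd c (detOperator c L x t μ n l) vac)
      = vevFactor c x t μ l * ∏ j, (Complex.exp (Complex.I * L * l j * n j) *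
        (∏ k, hfun c (l k) (l j) / hfun c (l j) (l k)) ^ (n j)) := by
  set f : ℝ → ℂ := fun u => ∑ i, charge N i *
    Complex.log (hfun c (Sum.elim l μ i) u / hfun c u (Sum.elim l μ i)) with hf
  have hΨ := isEigenstate_psiState c (Sum.elim l μ) (charge N)
  set Ψ := psiState c (Sum.elim l μ) (charge N) with hΨd
  have h1 : toEnd c (∏ j, E c f1 (l j) (n j)) Ψ
      = fun z => Complex.exp (∑ j, (n j : ℂ) * (z f1 (l j) + f (l j))) * Ψ z := by
    funext z
    rw [toEnd_prod_E]
    have h2 : Ψ (fun b v => z b v + ∑ j, (n j : ℂ) * kappa c f1.conj b (l j) v)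
        = Complex.exp (∑ j, (n j : ℂ) * f (l j)) * Ψ z := by
      simp only [hΨd, psiState, kappa, DualField.conj, hf, mul_zero, Finset.sum_const_zero,
        add_zero]
      rw [mul_left_comm]
      congr 1
      rw [← Complex.exp_add]
      congr 1
      simp only [Finset.mul_sum]
      rw [Finset.sum_comm, ← Finset.sum_add_distrib]
      refine Finset.sum_congr rfl fun i _ => ?_
      simp only [mul_add, Finset.mul_sum]
      rw [add_comm, add_assoc, add_assoc, add_assoc]
      simp only [mul_left_comm]
      ring
    rw [h2, ← mul_assoc, ← Complex.exp_add, ← Complex.exp_add]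
    congr 2
    simp [kappa, DualField.conj, mul_add, Finset.sum_add_distrib]
  have h3 : IsEigenstate c (fun u => ∑ i, charge N i * Complex.log (hfun c (Sum.elim l μ i) u))
      (fun u => ∑ i, charge N i * Complex.log (hfun c u (Sum.elim l μ i))) f (toEnd c (∏ j, E c f1 (l j) (n j)) Ψ) := by
    rw [h1]
    refine ⟨fun u s z => ?_, fun u s z => ?_, fun u s z => ?_⟩
    · rw [hΨ.shift_A1]
      simp only [shift, kappa]
      ring_nf
    · rw [hΨ.shift_D2]
      simp only [shift, kappa]
      ring_nf
    · have h2 : Ψ (shift c f2 u s z) = Complex.exp (s * f u) * Ψ z := hΨ.shift_f2 u s z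
      rw [h2]
      simp only [shift, kappa]
      ring_nf
  have h4 := ((shatDet_mem hc μ l) _ h3).2
  dsimp only at h4
  rw [bra_apply, detOperator_eq, map_smul, LinearMap.smul_apply, Pi.smul_apply, map_mul,
    Module.End.mul_apply, map_mul, Module.End.mul_apply, toEnd_prod_psiExp_vac, h4, h1]
  dsimp only
  rw [hΨd, psiState_braPoint hc]
  have h5 : Complex.exp (∑ j, (n j : ℂ) * (braPoint c μ f1 (l j) + f (l j)))
      = ∏ j, (∏ k, hfun c (l k) (l j) / hfun c (l j) (l k)) ^ (n j) := by
    rw [Complex.exp_sum]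
    refine Finset.prod_congr rfl fun j _ => ?_
    rw [braPoint_f1_add, Complex.exp_int_mul, exp_phiValue hc]
  rw [h5, Finset.prod_mul_distrib, smul_eq_mul, vevFactor]
  ring

/-- The vacuum expectation value of a functional of `φ_1` times the root determinant. -/
theorem bra_phi1Functional_rootDetOperator (hc : 0 < c) (x : ℝ) (t : ℂ) (μ : Fin N → ℝ)
    (l : Fin (N + 1) → ℝ) (G : (ℝ → ℂ) → ℂ) :
    bra c μ (phi1Functional c G (toEnd c (rootDetOperator c x t μ l) vac))
      = G (phiValue c l) * vevFactor c x t μ l := by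
  have hΨ := isEigenstate_psiState c (Sum.elim l μ) (charge N)
  obtain ⟨h3, h4⟩ := (shatDet_mem hc μ l) _ hΨ
  dsimp only at h3 h4
  have h5 : toEnd c (rootDetOperator c x t μ l) vac =
      ((∏ j, Complex.exp (tau x t (l j))) * ∏ m, Complex.exp (-tau x t (μ m))) •
        toEnd c (shatDet c μ l) (psiState c (Sum.elim l μ) (charge N)) := by
    rw [rootDetOperator_eq, map_smul, LinearMap.smul_apply, map_mul, Module.End.mul_apply,
      toEnd_prod_psiExp_vac]
  rw [bra_apply, phi1Functional_of_eigen c G _ (fun u => ∑ i, charge N i *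
    Complex.log (hfun c (Sum.elim l μ i) u / hfun c u (Sum.elim l μ i)))]
  · simp only [braPoint_f1_add]
    rw [h5, Pi.smul_apply, h4, psiState_braPoint hc, vevFactor, smul_eq_mul]
  · intro u z
    rw [h5]
    exact (h3.smul _).pOp u z

theorem DeltaTilde_eq (x : ℝ) (t : ℂ) (μ : Fin N → ℝ) (l : Fin (N + 1) → ℝ) :
    DeltaTilde c x t μ l = (∏ j, ∏ k, hfun c (l j) (l k)) * (∏ j, Complex.exp (tau x t (l j))) *
      smatDet c μ l := by
  rw [DeltaTilde, smatDet]
  congr 1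
  have h := eval_zero_det_bordered (fun _ : Fin (N + 1) => (1 : ℂ)) (fun _ : Fin N => (1 : ℂ))
    (fun k => Smat c μ l k.castSucc k) (Smat c μ l) _ rfl
  simpa using h

theorem correlatorIntegrand_eq (L hch x : ℝ) (t : ℂ) (μ : Fin N → ℝ)
    (n : Fin (N + 1) → ℤ) (l : Fin (N + 1) → ℝ) :
    correlatorIntegrand c L hch x t μ n l = prefactor c L hch t μ *
      (1 / (2 * Real.pi : ℂ) ^ (N + 1)) * (vevFactor c x t μ l *
        ∏ j, (Complex.exp (Complex.I * L * l j * n j) *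
          (∏ k, hfun c (l k) (l j) / hfun c (l j) (l k)) ^ (n j))) := by
  rw [correlatorIntegrand, DeltaTilde_eq, vevFactor]
  ring

theorem dualFieldIntegrand_eq_correlatorIntegrand (hc : 0 < c) (L hch x : ℝ) (t : ℂ)
    (μ : Fin N → ℝ) (n : Fin (N + 1) → ℤ) (l : Fin (N + 1) → ℝ) :
    dualFieldIntegrand c L hch x t μ n l = correlatorIntegrand c L hch x t μ n l := by
  rw [correlatorIntegrand_eq, dualFieldIntegrand, bra_detOperator hc]
  ring

theorem rootIntegrand_eq (hc : 0 < c) (L hch x : ℝ) (t : ℂ) (μ : Fin N → ℝ) (ε : ℝ)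
    (n : Fin (N + 1) → ℤ) (l : Fin (N + 1) → ℝ) :
    rootIntegrand c L hch x t μ ε n l = prefactor c L hch t μ *
      (rootWeight L ε n l (phiValue c l) * vevFactor c x t μ l) := by
  rw [rootIntegrand, bra_phi1Functional_rootDetOperator hc]

theorem Smat_comp_perm (μ : Fin N → ℝ) (l : Fin (N + 1) → ℝ) (σ : Equiv.Perm (Fin (N + 1)))
    (j : Fin (N + 1)) : Smat c μ (l ∘ σ) j = Smat c μ l (σ j) := by
  funext k
  simp only [Smat, Function.comp_apply]
  rw [Equiv.prod_comp σ fun p => hfun c (l p) (l (σ j)),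
    Equiv.prod_comp σ fun p => hfun c (l (σ j)) (l p)]

/-- Permuting the rapidities permutes the rows of `S`. The alternating sum of minors is the
expansion of the bordered determinant up to `(-1)^N`, which disappears on squaring. -/
theorem sum_perm_smatDet (μ : Fin N → ℝ) (l : Fin (N + 1) → ℝ) :
    ∑ σ : Equiv.Perm (Fin (N + 1)), smatDet c μ (l ∘ σ) = Mi c μ l ^ 2 := by
  have h1 : ∀ σ : Equiv.Perm (Fin (N + 1)), Smat c μ (l ∘ σ) = fun i => Smat c μ l (σ i) :=
    fun σ => funext fun j => Smat_comp_perm μ l σ j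
  simp only [smatDet, h1]
  rw [sum_perm_prod_mul_det_bordered, det_bordered_eq_sum, mul_pow, ← pow_mul, mul_comm N 2,
    pow_mul]
  simp [Mi]

theorem sum_perm_vevFactor (x : ℝ) (t : ℂ) (μ : Fin N → ℝ) (l : Fin (N + 1) → ℝ) :
    ∑ σ : Equiv.Perm (Fin (N + 1)), vevFactor c x t μ (l ∘ σ)
      = Delta c x t μ l / ∏ j, ∏ k, hfun c (μ j) (μ k) := by
  have h1 : ∀ σ : Equiv.Perm (Fin (N + 1)), vevFactor c x t μ (l ∘ σ)
      = ((∏ j, Complex.exp (tau x t (l j))) * ∏ m, Complex.exp (-tau x t (μ m))) *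
        ((∏ j, ∏ k, hfun c (l j) (l k)) / ∏ j, ∏ k, hfun c (μ j) (μ k)) *
        smatDet c μ (l ∘ σ) := fun σ => by
    simp only [vevFactor, Function.comp_apply]
    rw [Equiv.prod_comp σ fun j => Complex.exp (tau x t (l j)),
      Equiv.prod_comp σ fun j => ∏ k, hfun c (l j) (l (σ k))]
    simp only [fun j => Equiv.prod_comp σ fun k => hfun c (l j) (l k)]
    ring
  simp only [h1]
  rw [← Finset.mul_sum, sum_perm_smatDet, Delta, Complex.exp_sub, Complex.exp_sum, Complex.exp_sum]
  simp only [Complex.exp_neg, Finset.prod_inv_distrib]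
  rw [Finset.prod_comm]
  ring

theorem smatDet_eq_zero {μ : Fin N → ℝ} {l : Fin (N + 1) → ℝ} {j k : Fin (N + 1)} (hjk : j ≠ k)
    (h : l j = l k) : smatDet c μ l = 0 := by
  rw [smatDet, Matrix.det_zero_of_row_eq hjk, mul_zero]
  have h1 : Smat c μ l j = Smat c μ l k := by
    funext m
    simp only [Smat, h]
  ext i
  simp only [bordered, Matrix.of_apply, h1]

end Vacuum

/-! ### The Bethe equations -/

section Bethe

variable {M : ℕ} {c L : ℝ}

/-- The two-particle scattering phase. -/
def phase (c y : ℝ) : ℝ := 2 * Real.arctan (y / c)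

/-- The numbers `h(a,b)` and `h(b,a)` are `1 ∓ i(a - b)/c`, so this is the logarithmic formula for
the arctangent. -/
theorem log_hfun_div (hc : 0 < c) (a b : ℝ) :
    Complex.I * Complex.log (hfun c a b / hfun c b a) = phase c (a - b) := by
  have h1 := Complex.ofReal_arctan (-((a - b) / c))
  rw [Real.arctan_neg, Complex.arctan] at h1
  have h2 : hfun c b a = 1 - ((-((a - b) / c) : ℝ) : ℂ) * Complex.I := by
    rw [hfun_eq hc]
    push_cast
    ring
  rw [hfun_eq hc a b, h2, phase]
  rw [Complex.ofReal_neg] at h1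
  rw [Complex.ofReal_mul, Complex.ofReal_ofNat]
  linear_combination 2 * h1

theorem log_hfun_div' (hc : 0 < c) (a b : ℝ) :
    Complex.log (hfun c b a / hfun c a b) = Complex.I * phase c (a - b) := by
  have h := log_hfun_div hc b a
  have h2 : phase c (a - b) = -phase c (b - a) := by
    rw [phase, phase, ← neg_sub b a, neg_div, Real.arctan_neg]
    ring
  rw [h2, Complex.ofReal_neg, ← h]
  ring_nf
  rw [Complex.I_sq]
  ring

theorem strictMono_phase (hc : 0 < c) : StrictMono (phase c) := fun a b hab => by
  have : a / c < b / c := by gcongr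
  have := Real.arctan_strictMono this
  simp only [phase]
  linarith

theorem abs_phase_le (y : ℝ) : |phase c y| ≤ Real.pi := by
  rw [abs_le, phase]
  constructor <;> linarith [Real.arctan_lt_pi_div_two (y / c), Real.neg_pi_div_two_lt_arctan (y / c)]

theorem hasStrictDerivAt_phase (hc : 0 < c) (y : ℝ) :
    HasStrictDerivAt (phase c) (2 * c / (c ^ 2 + y ^ 2)) y := by
  have h := (((hasStrictDerivAt_id y).div_const c).arctan).const_mul 2
  have h2 : 2 * c / (c ^ 2 + y ^ 2) = 2 * (1 / (1 + (y / c) ^ 2) * (1 / c)) := by field_simp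
  rw [h2]
  exact h

theorem continuous_phase : Continuous (phase c) := by
  unfold phase
  fun_prop

theorem abs_phase_sub_le (hc : 0 < c) (a b : ℝ) : |phase c a - phase c b| ≤ 2 / c * |a - b| := by
  have h := Convex.norm_image_sub_le_of_norm_hasDerivWithin_le (f := phase c)
    (f' := fun y => 2 * c / (c ^ 2 + y ^ 2)) (C := 2 / c) (s := Set.univ) (x := b) (y := a)
    (fun y _ => (hasStrictDerivAt_phase hc y).hasDerivAt.hasDerivWithinAt) (fun y _ => by
      rw [Real.norm_of_nonneg (by positivity), div_le_div_iff₀ (by positivity) hc]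
      nlinarith [sq_nonneg y]) convex_univ trivial trivial
  simpa [Real.norm_eq_abs] using h

/-- `L r + ∑_k θ(r - l_k)`. -/
def counting (c L : ℝ) (l : Fin M → ℝ) (r : ℝ) : ℝ := L * r + ∑ k, phase c (r - l k)

theorem strictMono_counting (hc : 0 < c) (hL : 0 < L) (l : Fin M → ℝ) :
    StrictMono (counting c L l) := fun a b hab => by
  have h1 : L * a < L * b := by gcongr
  have h2 : ∑ k, phase c (a - l k) ≤ ∑ k, phase c (b - l k) :=
    Finset.sum_le_sum fun k _ => (strictMono_phase hc).monotone (by linarith)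
  simp only [counting]
  linarith

theorem continuous_counting (l : Fin M → ℝ) : Continuous (counting c L l) := by
  unfold counting
  have := continuous_phase (c := c)
  fun_prop

theorem abs_counting_sub_le_pi (l : Fin M → ℝ) (r : ℝ) :
    |counting c L l r - L * r| ≤ M * Real.pi := by
  rw [counting, add_sub_cancel_left]
  refine (Finset.abs_sum_le_sum_abs _ _).trans ?_
  refine (Finset.sum_le_sum fun k _ => abs_phase_le _).trans ?_
  simp

theorem abs_counting_sub_le (hc : 0 < c) (hL : 0 < L) (l : Fin M → ℝ) (r r' : ℝ) :
    |counting c L l r - counting c L l r'| ≤ (L + M * (2 / c)) * |r - r'| := by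
  have h1 : counting c L l r - counting c L l r'
      = L * (r - r') + ∑ k, (phase c (r - l k) - phase c (r' - l k)) := by
    simp only [counting, Finset.sum_sub_distrib]
    ring
  rw [h1]
  refine (abs_add_le _ _).trans ?_
  rw [abs_mul, abs_of_pos hL, add_mul]
  refine add_le_add_right ((Finset.abs_sum_le_sum_abs _ _).trans ?_) _
  refine (Finset.sum_le_sum fun k _ => abs_phase_sub_le hc _ _).trans ?_
  simp [mul_assoc]

theorem surjective_counting (hL : 0 < L) (l : Fin M → ℝ) :
    Function.Surjective (counting c L l) := by
  refine (continuous_counting l).surjective ?_ ?_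
  · refine tendsto_atTop_mono (f := fun r => L * r - M * Real.pi) (fun r => ?_)
      (tendsto_atTop_add_const_right _ _ (tendsto_id.const_mul_atTop hL))
    linarith [(abs_le.1 (abs_counting_sub_le_pi (c := c) (L := L) l r)).1]
  · refine tendsto_atBot_mono (f := fun r => L * r + M * Real.pi) (fun r => ?_)
      (tendsto_atBot_add_const_right _ _ (tendsto_id.const_mul_atBot hL))
    linarith [(abs_le.1 (abs_counting_sub_le_pi (c := c) (L := L) l r)).2]

/-- The left-hand sides `φ̃_j` of the logarithmic Bethe equations. -/
def bethe (c L : ℝ) (l : Fin M → ℝ) : Fin M → ℝ := fun j => counting c L l (l j)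

theorem isBethe_iff (hc : 0 < c) (n : Fin M → ℤ) (l : Fin M → ℝ) :
    IsBethe c L n l ↔ bethe c L l = fun j => 2 * Real.pi * (n j : ℝ) := by
  rw [IsBethe, funext_iff]
  refine forall_congr' fun j => ?_
  simp only [log_hfun_div hc, bethe, counting]
  exact_mod_cast Iff.rfl

/-- The Bethe map is expanding in the supremum norm. -/
theorem mul_norm_sub_le_norm_bethe_sub (hc : 0 < c) (hL : 0 < L) (l l' : Fin M → ℝ) :
    L * ‖l - l'‖ ≤ ‖bethe c L l - bethe c L l'‖ := by
  rcases isEmpty_or_nonempty (Fin M) with h | h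
  · simp [Subsingleton.elim l l']
  obtain ⟨j, hj⟩ := Finite.exists_max fun j => |l j - l' j|
  have h1 : ‖l - l'‖ ≤ |l j - l' j| :=
    (pi_norm_le_iff_of_nonneg (abs_nonneg _)).2 fun k => hj k
  -- At the coordinate with the largest displacement, taken nonnegative, every difference `l_j -
  -- l_k` is at least `l'_j - l'_k`; the increasing phases therefore only add to the linear term.
  have key : ∀ l l' : Fin M → ℝ, (∀ k, |l k - l' k| ≤ |l j - l' j|) → 0 ≤ l j - l' j →
      L * |l j - l' j| ≤ |bethe c L l j - bethe c L l' j| := by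
    intro l l' hj h0
    rw [abs_of_nonneg h0] at hj ⊢
    refine le_trans ?_ (le_abs_self _)
    have h2 : ∑ k, phase c (l' j - l' k) ≤ ∑ k, phase c (l j - l k) :=
      Finset.sum_le_sum fun k _ => (strictMono_phase hc).monotone (by
        linarith [(abs_le.1 (hj k)).2])
    simp only [bethe, counting]
    linarith
  have h2 : L * |l j - l' j| ≤ |bethe c L l j - bethe c L l' j| := by
    rcases le_total 0 (l j - l' j) with h0 | h0
    · exact key l l' hj h0
    · have := key l' l (fun k => by rw [abs_sub_comm, abs_sub_comm (l' j)]; exact hj k)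
        (by linarith)
      rwa [abs_sub_comm, abs_sub_comm (bethe c L l' j)] at this
  calc L * ‖l - l'‖ ≤ L * |l j - l' j| := by gcongr
    _ ≤ _ := h2
    _ ≤ _ := norm_le_pi_norm (bethe c L l - bethe c L l') j

theorem bethe_injective (hc : 0 < c) (hL : 0 < L) :
    Function.Injective (bethe c L : (Fin M → ℝ) → Fin M → ℝ) := fun l l' h => by
  have := mul_norm_sub_le_norm_bethe_sub hc hL l l'
  rw [h, sub_self, norm_zero] at this
  have h2 : ‖l - l'‖ ≤ 0 := by
    by_contra! h3
    nlinarith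
  exact sub_eq_zero.1 (norm_le_zero_iff.1 h2)

theorem gaudin_mulVec (l v : Fin M → ℝ) (j : Fin M) :
    (gaudin c L l).mulVec v j = L * v j + ∑ k, Kfun c (l j) (l k) * (v j - v k) := by
  simp only [gaudin, Matrix.mulVec, dotProduct, Matrix.of_apply, sub_mul, ite_mul, zero_mul,
    Finset.sum_sub_distrib, Finset.sum_ite_eq, Finset.mem_univ, if_true, mul_sub, add_mul,
    Finset.sum_mul]
  ring

theorem Kfun_nonneg (hc : 0 < c) (a b : ℝ) : 0 ≤ Kfun c a b := by
  unfold Kfun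
  positivity

theorem gaudin_isHermitian (l : Fin M → ℝ) : (gaudin c L l).IsHermitian := by
  ext j k
  have h : Kfun c (l k) (l j) = Kfun c (l j) (l k) := by
    rw [Kfun, Kfun, ← neg_sub (l j), neg_sq]
  simp only [gaudin, Matrix.conjTranspose_apply, Matrix.of_apply, star_trivial, h]
  congr 1
  by_cases hjk : j = k
  · subst hjk; rfl
  · rw [if_neg hjk, if_neg (Ne.symm hjk)]

/-- Every eigenvalue is at least `L`: at the component of largest modulus of an eigenvector, the
differences weighted by `K ≥ 0` have the sign of that component. -/
theorem pow_le_det_gaudin (hc : 0 < c) (hL : 0 < L) (l : Fin M → ℝ) :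
    L ^ M ≤ (gaudin c L l).det := by
  have hG := gaudin_isHermitian (c := c) (L := L) l
  have key : ∀ i, L ≤ hG.eigenvalues i := by
    intro i
    have h1 := hG.mulVec_eigenvectorBasis i
    set w : Fin M → ℝ := ⇑(hG.eigenvectorBasis i) with hw
    have hw0 : w ≠ 0 := by
      intro h0
      have := hG.eigenvectorBasis.toBasis.ne_zero i
      rw [OrthonormalBasis.coe_toBasis] at this
      exact this (by ext j; exact congrFun h0 j)
    have h1' : ∀ j, (gaudin c L l).mulVec w j = hG.eigenvalues i * w j := fun j => congrFun h1 j
    have : Nonempty (Fin M) := ⟨i⟩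
    obtain ⟨j, hj⟩ := Finite.exists_max fun j => |w j|
    have hj0 : 0 < |w j| := by
      obtain ⟨k, hk⟩ := Function.ne_iff.1 hw0
      exact lt_of_lt_of_le (abs_pos.2 hk) (hj k)
    have h2 := h1' j
    rw [gaudin_mulVec] at h2
    rcases lt_or_ge (w j) 0 with hs | hs
    · rw [abs_of_neg hs] at hj hj0
      have h3 : ∑ k, Kfun c (l j) (l k) * (w j - w k) ≤ 0 :=
        Finset.sum_nonpos fun k _ => mul_nonpos_of_nonneg_of_nonpos (Kfun_nonneg hc _ _)
          (by linarith [neg_le_abs (w k), hj k])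
      nlinarith
    · rw [abs_of_nonneg hs] at hj hj0
      have h3 : 0 ≤ ∑ k, Kfun c (l j) (l k) * (w j - w k) :=
        Finset.sum_nonneg fun k _ => mul_nonneg (Kfun_nonneg hc _ _)
          (by linarith [le_abs_self (w k), hj k])
      nlinarith
  rw [hG.det_eq_prod_eigenvalues]
  calc L ^ M = ∏ _i : Fin M, L := by simp
    _ ≤ _ := Finset.prod_le_prod (fun _ _ => hL.le) fun i _ => key i

theorem det_gaudin_pos (hc : 0 < c) (hL : 0 < L) (l : Fin M → ℝ) : 0 < (gaudin c L l).det :=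
  (pow_pos hL M).trans_le (pow_le_det_gaudin hc hL l)

theorem hasStrictFDerivAt_bethe (hc : 0 < c) (l : Fin M → ℝ) :
    HasStrictFDerivAt (bethe c L) (Matrix.toLin' (gaudin c L l)).toContinuousLinearMap l := by
  refine hasStrictFDerivAt_pi'' fun j => ?_
  have h1 : ∀ k, HasStrictFDerivAt (fun v : Fin M → ℝ => v k)
      (ContinuousLinearMap.proj (R := ℝ) (φ := fun _ : Fin M => ℝ) k) l :=
    fun k => (ContinuousLinearMap.proj (R := ℝ) (φ := fun _ : Fin M => ℝ) k).hasStrictFDerivAt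
  have h2 := ((h1 j).const_mul L).add (HasStrictFDerivAt.fun_sum (u := Finset.univ) fun k _ =>
    (hasStrictDerivAt_phase hc (l j - l k)).comp_hasStrictFDerivAt l ((h1 j).sub (h1 k)))
  refine h2.congr_fderiv ?_
  ext1 v
  simp only [add_apply, smul_apply, ContinuousLinearMap.coe_comp, Function.comp_apply, ContinuousLinearMap.proj_apply,
    LinearMap.coe_toContinuousLinearMap', Matrix.toLin'_apply, gaudin_mulVec, smul_eq_mul,
    sum_apply, sub_apply, Kfun]

theorem continuous_bethe : Continuous (bethe c L : (Fin M → ℝ) → Fin M → ℝ) := by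
  unfold bethe counting
  have := continuous_phase (c := c)
  fun_prop

theorem isOpenMap_bethe (hc : 0 < c) (hL : 0 < L) :
    IsOpenMap (bethe c L : (Fin M → ℝ) → Fin M → ℝ) := by
  rw [isOpenMap_iff_nhds_le]
  intro l
  refine ((hasStrictFDerivAt_bethe hc l).map_nhds_eq_of_surj ?_).ge
  rw [LinearMap.range_eq_top]
  intro v
  have h := Matrix.isUnit_iff_isUnit_det (gaudin c L l) |>.2 (det_gaudin_pos hc hL l).ne'.isUnit
  obtain ⟨w, hw⟩ := (Matrix.mulVec_surjective_iff_isUnit.2 h) v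
  exact ⟨w, hw⟩

/-- The range is open because the derivative is invertible everywhere, and closed because the map is
uniformly continuous and expanding on a complete space; `ℝ^M` is connected. -/
theorem bethe_surjective (hc : 0 < c) (hL : 0 < L) :
    Function.Surjective (bethe c L : (Fin M → ℝ) → Fin M → ℝ) := by
  have h1 : IsClosed (Set.range (bethe c L : (Fin M → ℝ) → Fin M → ℝ)) := by
    have h2 : AntilipschitzWith (Real.toNNReal L⁻¹) (bethe c L : (Fin M → ℝ) → Fin M → ℝ) :=
      AntilipschitzWith.of_le_mul_dist fun l l' => by
        rw [dist_eq_norm, dist_eq_norm, Real.coe_toNNReal _ (by positivity),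
          ← div_eq_inv_mul, le_div_iff₀ hL, mul_comm]
        exact mul_norm_sub_le_norm_bethe_sub hc hL l l'
    have hu : UniformContinuous (bethe c L : (Fin M → ℝ) → Fin M → ℝ) := by
      have hp : UniformContinuous (phase c) := by
        have : LipschitzWith (Real.toNNReal (2 / c)) (phase c) :=
          LipschitzWith.of_dist_le_mul fun a b => by
            rw [Real.dist_eq, Real.dist_eq, Real.coe_toNNReal _ (by positivity)]
            exact abs_phase_sub_le hc a b
        exact this.uniformContinuous
      refine uniformContinuous_pi.2 fun j => ?_
      unfold bethe counting
      have hpr : ∀ k : Fin M, UniformContinuous fun l : Fin M → ℝ => l k := fun k =>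
        Pi.uniformContinuous_proj _ k
      refine UniformContinuous.add ((hpr j).const_mul' L) ?_
      have hs : (fun l : Fin M → ℝ => ∑ k, phase c (l j - l k))
          = ∑ k, phase c ∘ fun l : Fin M → ℝ => l j - l k := by
        ext l
        simp
      rw [hs]
      exact Finset.sum_induction _ _ (fun _ _ => UniformContinuous.add) uniformContinuous_const
        fun k _ => hp.comp ((hpr j).sub (hpr k))
    exact h2.isClosed_range hu
  have h3 : IsClopen (Set.range (bethe c L : (Fin M → ℝ) → Fin M → ℝ)) :=
    ⟨h1, (isOpenMap_bethe hc hL).isOpen_range⟩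
  rw [← Set.range_eq_univ]
  exact h3.eq_univ (Set.range_nonempty _)

/-- The Bethe map is a homeomorphism. -/
def betheHomeomorph (hc : 0 < c) (hL : 0 < L) : (Fin M → ℝ) ≃ₜ (Fin M → ℝ) :=
  (Equiv.ofBijective (bethe c L) ⟨bethe_injective hc hL, bethe_surjective hc hL⟩)
    |>.toHomeomorphOfContinuousOpen continuous_bethe (isOpenMap_bethe hc hL)

/-- The solution of the Bethe equations with quantum numbers `n`. -/
def betheRoots (hc : 0 < c) (hL : 0 < L) (n : Fin M → ℤ) : Fin M → ℝ :=
  (betheHomeomorph hc hL).symm fun j => 2 * Real.pi * (n j : ℝ)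

theorem bethe_betheRoots (hc : 0 < c) (hL : 0 < L) (n : Fin M → ℤ) :
    bethe c L (betheRoots hc hL n) = fun j => 2 * Real.pi * (n j : ℝ) :=
  (betheHomeomorph hc hL).apply_symm_apply _

theorem isBethe_iff_eq_betheRoots (hc : 0 < c) (hL : 0 < L) (n : Fin M → ℤ) (l : Fin M → ℝ) :
    IsBethe c L n l ↔ l = betheRoots hc hL n := by
  rw [isBethe_iff hc, ← bethe_betheRoots hc hL n, (bethe_injective hc hL).eq_iff]

theorem bethe_comp_perm (l : Fin M → ℝ) (σ : Equiv.Perm (Fin M)) :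
    bethe c L (l ∘ σ) = bethe c L l ∘ σ := by
  funext j
  simp only [bethe, counting, Function.comp_apply]
  rw [Equiv.sum_comp σ fun k => phase c (l (σ j) - l k)]

theorem betheRoots_comp_perm (hc : 0 < c) (hL : 0 < L) (n : Fin M → ℤ) (σ : Equiv.Perm (Fin M)) :
    betheRoots hc hL (n ∘ σ) = betheRoots hc hL n ∘ σ := by
  apply bethe_injective hc hL
  rw [bethe_comp_perm, bethe_betheRoots, bethe_betheRoots]
  rfl

theorem gaudin_comp_perm (l : Fin M → ℝ) (σ : Equiv.Perm (Fin M)) :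
    (gaudin c L (l ∘ σ)).det = (gaudin c L l).det := by
  rw [← Matrix.det_submatrix_equiv_self σ (gaudin c L l)]
  congr 1
  ext j k
  simp only [gaudin, Matrix.of_apply, Matrix.submatrix_apply, Function.comp_apply,
    σ.injective.eq_iff]
  rw [Equiv.sum_comp σ fun p => Kfun c (l (σ j)) (l p)]

/-- For a fixed solution all rapidities are preimages of `2π n_j` under one strictly increasing
counting function. -/
theorem betheRoots_lt_iff (hc : 0 < c) (hL : 0 < L) (n : Fin M → ℤ) (j k : Fin M) :
    betheRoots hc hL n j < betheRoots hc hL n k ↔ n j < n k := by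
  have h := congrFun (bethe_betheRoots hc hL n)
  rw [← (strictMono_counting hc hL (betheRoots hc hL n)).lt_iff_lt]
  have hj := h j
  have hk := h k
  simp only [bethe] at hj hk
  rw [hj, hk, mul_lt_mul_iff_right₀ (by positivity), Int.cast_lt]

theorem betheRoots_eq_iff (hc : 0 < c) (hL : 0 < L) (n : Fin M → ℤ) (j k : Fin M) :
    betheRoots hc hL n j = betheRoots hc hL n k ↔ n j = n k := by
  rw [le_antisymm_iff, le_antisymm_iff (a := n j), ← not_lt, ← not_lt, ← not_lt (b := n j),
    ← not_lt (a := n j), betheRoots_lt_iff, betheRoots_lt_iff]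

theorem abs_bethe_sub_le (l : Fin M → ℝ) (j : Fin M) :
    |bethe c L l j - L * l j| ≤ M * Real.pi := abs_counting_sub_le_pi l (l j)

theorem phiValue_eq {N : ℕ} (hc : 0 < c) (l : Fin (N + 1) → ℝ) (u : ℝ) :
    phiValue c l u = Complex.I * ((∑ k, phase c (u - l k) : ℝ) : ℂ) := by
  simp only [phiValue, log_hfun_div' hc]
  push_cast
  rw [Finset.mul_sum]

/-- With the classical value of `φ_1`, the function `L r - i φ_1(r)` is the counting function of
`l`. It is surjective, so the default value in `rootOf` is never taken. -/
theorem rootOf_phiValue {N : ℕ} (hc : 0 < c) (hL : 0 < L) (l : Fin (N + 1) → ℝ) (n : ℤ) :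
    counting c L l (rootOf L n (phiValue c l)) = 2 * Real.pi * (n : ℝ) := by
  have h1 : ∀ r : ℝ, (L : ℂ) * r - Complex.I * phiValue c l r = 2 * Real.pi * (n : ℂ) ↔
      counting c L l r = 2 * Real.pi * (n : ℝ) := fun r => by
    have : (L : ℂ) * r - Complex.I * phiValue c l r = (counting c L l r : ℂ) := by
      rw [phiValue_eq hc, counting, ← mul_assoc, Complex.I_mul_I]
      push_cast
      ring
    rw [this]
    exact_mod_cast Iff.rfl
  have h2 : ∃ r : ℝ, (L : ℂ) * r - Complex.I * phiValue c l r = 2 * Real.pi * (n : ℂ) := by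
    obtain ⟨r, hr⟩ := surjective_counting (c := c) hL l (2 * Real.pi * (n : ℝ))
    exact ⟨r, (h1 r).2 hr⟩
  rw [rootOf, dif_pos h2]
  exact (h1 _).1 h2.choose_spec

/-- The weight `L · 2πρ̂` is the derivative of the counting function with the sources `l` held
fixed. -/
theorem twoPiRho_phiValue {N : ℕ} (hc : 0 < c) (hL : 0 < L) (l : Fin (N + 1) → ℝ) (u : ℝ) :
    L * twoPiRho L u (phiValue c l) = ((L + ∑ k, Kfun c u (l k) : ℝ) : ℂ) := by
  have h1 : HasDerivAt (fun r : ℝ => ∑ k, phase c (r - l k)) (∑ k, Kfun c u (l k)) u :=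
    HasDerivAt.fun_sum fun k _ =>
      (hasStrictDerivAt_phase hc (u - l k)).hasDerivAt.comp_sub_const u (l k)
  have h2 : deriv (phiValue c l) u = Complex.I * ((∑ k, Kfun c u (l k) : ℝ) : ℂ) := by
    rw [funext (phiValue_eq hc l)]
    exact (h1.ofReal_comp.const_mul Complex.I).deriv
  have h3 : (L : ℂ) ≠ 0 := by exact_mod_cast hL.ne'
  rw [twoPiRho, h2]
  field_simp
  ring_nf
  rw [Complex.I_sq]
  push_cast
  ring

end Bethe

/-! ### Small cells around a solution of the Bethe equations -/

section Cells

open MeasureTheory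

variable {M : ℕ} {c L : ℝ}

/-- The configurations in which each rapidity is within `ε` of its root. -/
def rootCell (c L : ℝ) (m : Fin M → ℝ) (ε : ℝ) : Set (Fin M → ℝ) :=
  {l | ∀ j, counting c L l (l j - ε) ≤ m j ∧ m j ≤ counting c L l (l j + ε)}

theorem measurableSet_rootCell (m : Fin M → ℝ) (ε : ℝ) : MeasurableSet (rootCell c L m ε) := by
  have hp := continuous_phase (c := c)
  have h : ∀ (j : Fin M) (s : ℝ), Continuous fun l : Fin M → ℝ => counting c L l (l j + s) :=
    fun j s => by
      unfold counting
      fun_prop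
  rw [rootCell, Set.ofPred_forall]
  refine MeasurableSet.iInter fun j => ?_
  rw [Set.ofPred_and]
  refine ((isClosed_le ?_ continuous_const).inter (isClosed_le continuous_const (h j ε))).measurableSet
  simpa only [sub_eq_add_neg] using h j (-ε)

/-- The counting function has Lipschitz constant `L + 2M/c`, so in the cell the Bethe map is within
that multiple of `ε` of its value at `l`. Expansion by `L` pulls this back to a distance. -/
theorem rootCell_subset_closedBall (hc : 0 < c) (hL : 0 < L) (l : Fin M → ℝ) {ε : ℝ} (hε : 0 ≤ ε) :
    rootCell c L (bethe c L l) ε ⊆ Metric.closedBall l ((L + M * (2 / c)) / L * ε) := by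
  intro v hv
  have hB : 0 ≤ L + M * (2 / c) := by positivity
  have h1 : ‖bethe c L v - bethe c L l‖ ≤ (L + M * (2 / c)) * ε := by
    refine (pi_norm_le_iff_of_nonneg (by positivity)).2 fun j => ?_
    have h2 := abs_counting_sub_le hc hL v (v j) (v j - ε)
    have h3 := abs_counting_sub_le hc hL v (v j + ε) (v j)
    rw [sub_sub_cancel, abs_of_nonneg hε] at h2
    rw [add_sub_cancel_left, abs_of_nonneg hε] at h3
    rw [Pi.sub_apply, Real.norm_eq_abs, abs_le]
    have h4 := hv j
    have h5 : bethe c L v j = counting c L v (v j) := rfl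
    rw [h5]
    constructor <;> linarith [abs_le.1 h2, abs_le.1 h3]
  have h2 := mul_norm_sub_le_norm_bethe_sub hc hL v l
  rw [Metric.mem_closedBall, dist_eq_norm, div_mul_eq_mul_div, le_div_iff₀ hL]
  linarith

/-- Moving all rapidities along `y` contributes the Gaudin matrix; the extra displacement `sε` of
the evaluation point contributes only the derivative at fixed sources. The values `s = ±1` give the
two inequalities defining the cell. -/
theorem hasDerivAt_counting_ray (hc : 0 < c) (l y : Fin M → ℝ) (j : Fin M) (s : ℝ) :
    HasDerivAt (fun ε : ℝ => counting c L (l + ε • y) ((l + ε • y) j + s * ε))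
      ((gaudin c L l).mulVec y j + s * (L + ∑ k, Kfun c (l j) (l k))) 0 := by
  have h1 : ∀ k, HasDerivAt (fun ε : ℝ => (l + ε • y) k) (y k) 0 := fun k => by
    simpa using ((hasDerivAt_id (0 : ℝ)).mul_const (y k)).const_add (l k)
  have h2 : HasDerivAt (fun ε : ℝ => (l + ε • y) j + s * ε) (y j + s) 0 := by
    simpa using (h1 j).fun_add ((hasDerivAt_id' (0 : ℝ)).const_mul s)
  have h3 : ∀ k, HasDerivAt (fun ε : ℝ => phase c ((l + ε • y) j + s * ε - (l + ε • y) k))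
      (Kfun c (l j) (l k) * (y j + s - y k)) 0 := fun k => by
    have h4 := hasStrictDerivAt_phase hc ((l + (0 : ℝ) • y) j + s * 0 - (l + (0 : ℝ) • y) k)
    have h5 := HasDerivAt.comp (0 : ℝ) h4.hasDerivAt (h2.sub (h1 k))
    exact h5.congr_deriv (by simp [Kfun])
  have h4 := (h2.const_mul L).add (HasDerivAt.fun_sum (u := Finset.univ) fun k _ => h3 k)
  refine h4.congr_deriv ?_
  rw [gaudin_mulVec]
  simp only [mul_add, mul_sub, Finset.sum_add_distrib, Finset.sum_sub_distrib, Finset.mul_sum]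
  have : ∀ k, Kfun c (l j) (l k) * s = s * Kfun c (l j) (l k) := fun k => mul_comm _ _
  simp only [this]
  ring

theorem eventually_counting_ray_pos (hc : 0 < c) (l y : Fin M → ℝ) (j : Fin M) (s : ℝ)
    (h : 0 < (gaudin c L l).mulVec y j + s * (L + ∑ k, Kfun c (l j) (l k))) :
    ∀ᶠ ε in 𝓝[>] (0 : ℝ),
      bethe c L l j < counting c L (l + ε • y) ((l + ε • y) j + s * ε) := by
  have h1 := (hasDerivAt_counting_ray (L := L) hc l y j s).tendsto_slope_zero_right
  filter_upwards [h1.eventually_const_lt h, self_mem_nhdsWithin] with ε h2 hε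
  have hε : 0 < ε := hε
  rw [smul_eq_mul, zero_add] at h2
  have h3 := (pos_iff_pos_of_mul_pos h2).1 (inv_pos.2 hε)
  simp only [zero_smul, add_zero, mul_zero, sub_pos] at h3
  exact h3

theorem eventually_counting_ray_neg (hc : 0 < c) (l y : Fin M → ℝ) (j : Fin M) (s : ℝ)
    (h : (gaudin c L l).mulVec y j + s * (L + ∑ k, Kfun c (l j) (l k)) < 0) :
    ∀ᶠ ε in 𝓝[>] (0 : ℝ),
      counting c L (l + ε • y) ((l + ε • y) j + s * ε) < bethe c L l j := by
  have h1 := (hasDerivAt_counting_ray (L := L) hc l y j s).tendsto_slope_zero_right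
  filter_upwards [h1.eventually_lt_const h, self_mem_nhdsWithin] with ε h2 hε
  have hε : 0 < ε := hε
  rw [smul_eq_mul, zero_add] at h2
  have h3 := (pos_iff_neg_of_mul_neg h2).1 (inv_pos.2 hε)
  simp only [zero_smul, add_zero, mul_zero, sub_neg] at h3
  exact h3

/-- The limiting shape of the cells. -/
def limitCell (c L : ℝ) (l : Fin M → ℝ) : Set (Fin M → ℝ) :=
  {y | ∀ j, |(gaudin c L l).mulVec y j| ≤ L + ∑ k, Kfun c (l j) (l k)}

theorem limitCell_eq (l : Fin M → ℝ) :
    limitCell c L l = Matrix.toLin' (gaudin c L l) ⁻¹'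
      Set.Icc (fun j => -(L + ∑ k, Kfun c (l j) (l k))) (fun j => L + ∑ k, Kfun c (l j) (l k)) := by
  ext y
  simp only [limitCell, Set.mem_ofPred_eq, abs_le, Set.mem_preimage, Matrix.toLin'_apply,
    Set.mem_Icc, Pi.le_def, forall_and]

/-- The limiting shape is the preimage of a box under the Gaudin matrix, so its volume is that of
the box divided by the determinant. -/
theorem volume_limitCell (hc : 0 < c) (hL : 0 < L) (l : Fin M → ℝ) :
    (volume (limitCell c L l)).toReal
      = 2 ^ M * (∏ j, (L + ∑ k, Kfun c (l j) (l k))) / (gaudin c L l).det := by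
  have hd := det_gaudin_pos hc hL l
  have h1 : ∀ j, 0 < L + ∑ k, Kfun c (l j) (l k) := fun j =>
    add_pos_of_pos_of_nonneg hL (Finset.sum_nonneg fun k _ => Kfun_nonneg hc _ _)
  rw [limitCell_eq, Measure.addHaar_preimage_linearMap _ (by rw [LinearMap.det_toLin']; exact hd.ne'),
    LinearMap.det_toLin', ENNReal.toReal_mul, Real.volume_Icc_pi_toReal
      (fun j => by linarith [h1 j]), ENNReal.toReal_ofReal (abs_nonneg _), abs_of_pos (inv_pos.2 hd)]
  have h2 : ∀ j, (L + ∑ k, Kfun c (l j) (l k)) - -(L + ∑ k, Kfun c (l j) (l k))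
      = 2 * (L + ∑ k, Kfun c (l j) (l k)) := fun j => by ring
  simp only [h2, Finset.prod_mul_distrib, Finset.prod_const, Finset.card_univ, Fintype.card_fin]
  field_simp

theorem ae_mulVec_ne (hc : 0 < c) (hL : 0 < L) (l : Fin M → ℝ) (j : Fin M) (d : ℝ) :
    ∀ᵐ y : Fin M → ℝ, (gaudin c L l).mulVec y j ≠ d := by
  have h1 : {y | ¬ (gaudin c L l).mulVec y j ≠ d}
      = Matrix.toLin' (gaudin c L l) ⁻¹' {v | v j = d} := by
    ext y
    simp
  rw [ae_iff, h1, Measure.addHaar_preimage_linearMap _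
    (by rw [LinearMap.det_toLin']; exact (det_gaudin_pos hc hL l).ne')]
  have h2 : (volume : Measure (Fin M → ℝ)) {v | v j = d} = 0 := by
    rw [volume_pi]
    exact Measure.pi_hyperplane (fun _ : Fin M => (volume : Measure ℝ)) j d
  rw [h2, mul_zero]

theorem norm_le_near {g : (Fin M → ℝ) → ℂ} {l : Fin M → ℝ} (hg : ContinuousAt g l) :
    ∃ r > 0, ∀ v, ‖v - l‖ ≤ r → ‖g v‖ ≤ ‖g l‖ + 1 := by
  have h1 : ∀ᶠ v in 𝓝 l, ‖g v‖ < ‖g l‖ + 1 := hg.norm.eventually_lt_const (by linarith)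
  obtain ⟨r, hr, h2⟩ := Metric.eventually_nhds_iff.1 h1
  refine ⟨r / 2, by positivity, fun v hv => (h2 ?_).le⟩
  rw [dist_eq_norm]
  linarith

/-- The cell average `(2ε)^{-M} 1_{cell}` acts in the limit as a delta function at the solution. -/
theorem tendsto_integral_rootCell (hc : 0 < c) (hL : 0 < L) (l : Fin M → ℝ)
    (g : (Fin M → ℝ) → ℂ) (hg : Measurable g) (hgc : ContinuousAt g l) :
    (∀ᶠ ε in 𝓝[>] (0 : ℝ), Integrable
      ((rootCell c L (bethe c L l) ε).indicator fun v => ((1 / (2 * ε) : ℝ) : ℂ) ^ M * g v)) ∧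
    Tendsto (fun ε : ℝ => ∫ v, (rootCell c L (bethe c L l) ε).indicator
      (fun v => ((1 / (2 * ε) : ℝ) : ℂ) ^ M * g v) v) (𝓝[>] 0)
      (𝓝 (((∏ j, (L + ∑ k, Kfun c (l j) (l k))) / (gaudin c L l).det : ℝ) * g l)) := by
  obtain ⟨r, hr, hgr⟩ := norm_le_near hgc
  set C := (L + M * (2 / c)) / L with hC
  have hC0 : 0 < C := by positivity
  set K := ‖g l‖ + 1 with hK
  have hK0 : 0 < K := by positivity
  have hsmall : ∀ᶠ ε in 𝓝[>] (0 : ℝ), 0 < ε ∧ C * ε ≤ r := by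
    filter_upwards [Ioo_mem_nhdsGT (show (0 : ℝ) < r / C by positivity)] with ε hε
    refine ⟨hε.1, ?_⟩
    have := hε.2.le
    rwa [le_div_iff₀ hC0, mul_comm] at this
  constructor
  · filter_upwards [hsmall] with ε hε
    rw [integrable_indicator_iff (measurableSet_rootCell _ _)]
    refine Measure.integrableOn_of_bounded (M := ‖((1 / (2 * ε) : ℝ) : ℂ) ^ M‖ * K) ?_ ?_ ?_
    · exact ((measure_mono (rootCell_subset_closedBall hc hL l hε.1.le)).trans_lt
        measure_closedBall_lt_top).ne
    · exact (measurable_const.mul hg).aestronglyMeasurable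
    · refine (ae_restrict_mem (measurableSet_rootCell _ _)).mono fun v hv => ?_
      have h1 := rootCell_subset_closedBall hc hL l hε.1.le hv
      rw [Metric.mem_closedBall, dist_eq_norm] at h1
      rw [norm_mul]
      gcongr
      exact hgr v (h1.trans hε.2)
  -- The substitution `v = l + ε y` absorbs `ε^{-M}` and leaves `2^{-M}`; the rescaled cells stay in
  -- the fixed ball of radius `C`.
  · have hresc : ∀ᶠ ε in 𝓝[>] (0 : ℝ), ∫ y, (rootCell c L (bethe c L l) ε).indicator
        (fun v => (1 / 2 : ℂ) ^ M * g v) (l + ε • y)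
        = ∫ v, (rootCell c L (bethe c L l) ε).indicator
          (fun v => ((1 / (2 * ε) : ℝ) : ℂ) ^ M * g v) v := by
      filter_upwards [hsmall] with ε hε
      have h1 := Measure.integral_comp_smul volume (fun y => (rootCell c L (bethe c L l) ε).indicator
        (fun v => (1 / 2 : ℂ) ^ M * g v) (l + y)) ε
      have h2 := integral_add_left_eq_self (μ := volume)
        ((rootCell c L (bethe c L l) ε).indicator fun v => (1 / 2 : ℂ) ^ M * g v) l
      rw [h1, h2, ← integral_smul]
      congr 1
      funext v
      rw [← Set.indicator_const_smul_apply]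
      congr 1
      funext v
      rw [Module.finrank_fin_fun, abs_of_pos (by have := hε.1; positivity), Complex.real_smul,
        ← mul_assoc]
      congr 1
      push_cast
      rw [← inv_pow, ← mul_pow]
      congr 1
      rw [one_div, one_div, mul_inv, mul_comm]
    refine Tendsto.congr' hresc ?_
    have hlim : ((∏ j, (L + ∑ k, Kfun c (l j) (l k))) / (gaudin c L l).det : ℝ) * g l
        = ∫ y, (limitCell c L l).indicator (fun _ => (1 / 2 : ℂ) ^ M * g l) y := by
      have hms : MeasurableSet (limitCell c L l) := by
        rw [limitCell_eq]
        exact measurableSet_Icc.preimage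
          (Matrix.toLin' (gaudin c L l)).continuous_of_finiteDimensional.measurable
      rw [integral_indicator_const _ hms, Measure.real, volume_limitCell hc hL, Complex.real_smul]
      push_cast
      rw [one_div, inv_pow]
      field_simp
    rw [hlim]
    refine tendsto_integral_filter_of_dominated_convergence
      ((Metric.closedBall (0 : Fin M → ℝ) C).indicator fun _ => ‖(1 / 2 : ℂ) ^ M‖ * K) ?_ ?_ ?_ ?_
    · refine Eventually.of_forall fun ε => Measurable.aestronglyMeasurable ?_
      exact ((measurable_const.mul hg).indicator (measurableSet_rootCell _ _)).comp (by fun_prop)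
    · filter_upwards [hsmall] with ε hε
      refine Eventually.of_forall fun y => ?_
      by_cases hy : l + ε • y ∈ rootCell c L (bethe c L l) ε
      · have h1 := rootCell_subset_closedBall hc hL l hε.1.le hy
        rw [Metric.mem_closedBall, dist_eq_norm] at h1
        rw [Set.indicator_of_mem hy, norm_mul]
        have h2 : y ∈ Metric.closedBall (0 : Fin M → ℝ) C := by
          rw [Metric.mem_closedBall, dist_zero_right]
          rw [add_sub_cancel_left, norm_smul, Real.norm_of_nonneg hε.1.le, mul_comm] at h1
          exact le_of_mul_le_mul_right h1 hε.1
        rw [Set.indicator_of_mem h2]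
        gcongr
        exact hgr _ (h1.trans hε.2)
      · rw [Set.indicator_of_notMem hy, norm_zero]
        exact Set.indicator_nonneg (fun _ _ => by positivity) _
    · rw [integrable_indicator_iff measurableSet_closedBall]
      exact integrableOn_const (measure_closedBall_lt_top.ne)
    -- On the faces of the parallelepiped the first-order derivative vanishes and does not decide
    -- membership. These faces are null sets; elsewhere the indicator is eventually constant as `ε →
    -- 0`.
    · have hae : ∀ᵐ y : Fin M → ℝ, ∀ j, (gaudin c L l).mulVec y j ≠ L + ∑ k, Kfun c (l j) (l k) ∧
          (gaudin c L l).mulVec y j ≠ -(L + ∑ k, Kfun c (l j) (l k)) :=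
        ae_all_iff.2 fun j => (ae_mulVec_ne hc hL l j _).and (ae_mulVec_ne hc hL l j _)
      filter_upwards [hae] with y hy
      have hcell : ∀ (ε : ℝ), l + ε • y ∈ rootCell c L (bethe c L l) ε ↔ ∀ j,
          counting c L (l + ε • y) ((l + ε • y) j + (-1) * ε) ≤ bethe c L l j ∧
          bethe c L l j ≤ counting c L (l + ε • y) ((l + ε • y) j + 1 * ε) := fun ε => by
        simp only [rootCell, Set.mem_ofPred_eq, one_mul, neg_mul, ← sub_eq_add_neg]
      by_cases hB : y ∈ limitCell c L l
      · have h1 : ∀ᶠ ε in 𝓝[>] (0 : ℝ), l + ε • y ∈ rootCell c L (bethe c L l) ε := by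
          simp only [hcell]
          refine eventually_all.2 fun j => ?_
          have h2 := abs_le.1 (hB j)
          have h3 := lt_of_le_of_ne h2.2 (hy j).1
          have h4 := lt_of_le_of_ne h2.1 (hy j).2.symm
          filter_upwards [eventually_counting_ray_neg (L := L) hc l y j (-1) (by linarith),
            eventually_counting_ray_pos (L := L) hc l y j 1 (by linarith)] with ε h5 h6
          exact ⟨h5.le, h6.le⟩
        rw [Set.indicator_of_mem hB]
        have h2 : Tendsto (fun ε : ℝ => (1 / 2 : ℂ) ^ M * g (l + ε • y)) (𝓝[>] 0)
            (𝓝 ((1 / 2 : ℂ) ^ M * g l)) := by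
          refine Tendsto.const_mul _ (hgc.tendsto.comp ?_)
          have h3 : Tendsto (fun ε : ℝ => l + ε • y) (𝓝 0) (𝓝 (l + (0 : ℝ) • y)) :=
            Continuous.tendsto (by fun_prop) 0
          rw [zero_smul, add_zero] at h3
          exact h3.mono_left nhdsWithin_le_nhds
        refine h2.congr' ?_
        filter_upwards [h1] with ε h3
        rw [Set.indicator_of_mem h3]
      · rw [Set.indicator_of_notMem hB]
        have h1 : ∀ᶠ ε in 𝓝[>] (0 : ℝ), l + ε • y ∉ rootCell c L (bethe c L l) ε := by
          obtain ⟨j, hj⟩ : ∃ j, L + ∑ k, Kfun c (l j) (l k) < |(gaudin c L l).mulVec y j| := by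
            simpa [limitCell] using hB
          simp only [hcell]
          rcases lt_abs.1 hj with hj | hj
          · filter_upwards [eventually_counting_ray_pos (L := L) hc l y j (-1) (by linarith)]
              with ε h2 h3
            exact absurd (h3 j).1 (not_le.2 h2)
          · filter_upwards [eventually_counting_ray_neg (L := L) hc l y j 1 (by linarith)]
              with ε h2 h3
            exact absurd (h3 j).2 (not_le.2 h2)
        refine tendsto_const_nhds.congr' ?_
        filter_upwards [h1] with ε h3
        rw [Set.indicator_of_notMem h3]

end Cells

/-! ### The terms of the root representation -/

section RootTerms

open MeasureTheory

variable {N : ℕ} {c L : ℝ}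

theorem measurable_vevFactor (x : ℝ) (t : ℂ) (μ : Fin N → ℝ) :
    Measurable (vevFactor c x t μ) := by
  have hh : ∀ f g : (Fin (N + 1) → ℝ) → ℝ, Measurable f → Measurable g →
      Measurable fun l => hfun c (f l) (g l) := fun f g hf hg => by
    unfold hfun
    fun_prop
  have ht : ∀ f g : (Fin (N + 1) → ℝ) → ℝ, Measurable f → Measurable g →
      Measurable fun l => tfun c (f l) (g l) := fun f g hf hg => by
    unfold tfun
    fun_prop
  have hp : ∀ j : Fin (N + 1), Measurable fun l : Fin (N + 1) → ℝ => l j := fun j =>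
    measurable_pi_apply j
  have hS : ∀ j k, Measurable fun l => Smat c μ l j k := fun j k => by
    unfold Smat
    refine Measurable.sub (Measurable.mul (ht _ _ measurable_const (hp j)) (Measurable.div ?_ ?_))
      (Measurable.mul (ht _ _ (hp j) measurable_const) (Measurable.div ?_ ?_))
    · exact Finset.measurable_fun_prod _ fun m _ => hh _ _ measurable_const (hp j)
    · exact Finset.measurable_fun_prod _ fun m _ => hh _ _ (hp m) (hp j)
    · exact Finset.measurable_fun_prod _ fun m _ => hh _ _ (hp j) measurable_const
    · exact Finset.measurable_fun_prod _ fun m _ => hh _ _ (hp j) (hp m)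
  have hB : ∀ i k, Measurable fun l => bordered (Smat c μ l) i k := fun i k => by
    refine Fin.lastCases ?_ (fun k => ?_) k
    · simp only [bordered_last]
      exact measurable_const
    · simp only [bordered_castSucc]
      exact hS i k
  unfold vevFactor smatDet
  refine Measurable.mul (Measurable.mul ?_ measurable_const) (Measurable.mul (Measurable.mul ?_ ?_)
    (Measurable.div ?_ measurable_const))
  · refine Finset.measurable_fun_prod _ fun j _ => ?_
    unfold tau
    fun_prop
  · exact Finset.measurable_fun_prod _ fun j _ => hS _ _
  · simp only [Matrix.det_apply]
    refine Finset.measurable_fun_sum _ fun σ _ => Measurable.const_smul ?_ _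
    exact Finset.measurable_fun_prod _ fun j _ => hB _ _
  · exact Finset.measurable_fun_prod _ fun j _ => Finset.measurable_fun_prod _ fun k _ =>
      hh _ _ (hp j) (hp k)

theorem tfun_denominator_ne_zero (hc : 0 < c) {a b : ℝ} (hab : a ≠ b) :
    ((a : ℂ) - b) * ((a : ℂ) - b + Complex.I * c) ≠ 0 := by
  refine mul_ne_zero (sub_ne_zero.2 (by exact_mod_cast hab)) fun h => ?_
  have := congrArg Complex.im h
  simp at this
  exact hc.ne' this

theorem continuousAt_vevFactor (hc : 0 < c) (x : ℝ) (t : ℂ) (μ : Fin N → ℝ)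
    {l : Fin (N + 1) → ℝ} (hl : ∀ j k, l j ≠ μ k) : ContinuousAt (vevFactor c x t μ) l := by
  have hh : ∀ f g : (Fin (N + 1) → ℝ) → ℝ, ContinuousAt f l → ContinuousAt g l →
      ContinuousAt (fun l => hfun c (f l) (g l)) l := fun f g hf hg => by
    unfold hfun
    fun_prop
  have ht : ∀ f g : (Fin (N + 1) → ℝ) → ℝ, ContinuousAt f l → ContinuousAt g l → f l ≠ g l →
      ContinuousAt (fun l => tfun c (f l) (g l)) l := fun f g hf hg hfg => by
    unfold tfun
    refine ContinuousAt.div (by fun_prop) (by fun_prop) (tfun_denominator_ne_zero hc hfg)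
  have hp : ∀ j : Fin (N + 1), ContinuousAt (fun l : Fin (N + 1) → ℝ => l j) l := fun j =>
    continuousAt_apply j l
  have hprod : ∀ {K : ℕ} (f : Fin K → (Fin (N + 1) → ℝ) → ℂ), (∀ i, ContinuousAt (f i) l) →
      ContinuousAt (fun v => ∏ i, f i v) l := fun f hf => tendsto_finsetProd _ fun i _ => hf i
  have hne : ∀ {K : ℕ} (f g : Fin K → ℝ), ∏ i, hfun c (f i) (g i) ≠ 0 := fun f g =>
    Finset.prod_ne_zero_iff.2 fun _ _ => hfun_ne_zero hc _ _
  have hS : ∀ j k, ContinuousAt (fun l => Smat c μ l j k) l := fun j k => by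
    unfold Smat
    refine ContinuousAt.sub
      (ContinuousAt.mul (ht _ _ continuousAt_const (hp j) (hl j k).symm)
        (ContinuousAt.div ?_ ?_ (hne _ _)))
      (ContinuousAt.mul (ht _ _ (hp j) continuousAt_const (hl j k))
        (ContinuousAt.div ?_ ?_ (hne _ _)))
    · exact hprod _ fun m => hh _ _ continuousAt_const (hp j)
    · exact hprod _ fun m => hh _ _ (hp m) (hp j)
    · exact hprod _ fun m => hh _ _ (hp j) continuousAt_const
    · exact hprod _ fun m => hh _ _ (hp j) (hp m)
  have hB : ∀ i k, ContinuousAt (fun l => bordered (Smat c μ l) i k) l := fun i k => by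
    refine Fin.lastCases ?_ (fun k => ?_) k
    · simp only [bordered_last]
      exact continuousAt_const
    · simp only [bordered_castSucc]
      exact hS i k
  unfold vevFactor smatDet
  refine ContinuousAt.mul (ContinuousAt.mul ?_ continuousAt_const)
    (ContinuousAt.mul (ContinuousAt.mul ?_ ?_) (ContinuousAt.div_const ?_ _))
  · refine hprod _ fun j => ?_
    unfold tau
    fun_prop
  · exact hprod _ fun j => hS _ _
  · simp only [Matrix.det_apply]
    refine tendsto_finsetSum _ fun σ _ => ContinuousAt.const_smul ?_ _
    exact hprod _ fun j => hB _ _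
  · exact hprod _ fun j => hprod _ fun k => hh _ _ (hp j) (hp k)

/-- The contribution of a solution `l` of the Bethe equations to the root representation. -/
def rootTerm (c L hch x : ℝ) (t : ℂ) (μ : Fin N → ℝ) (l : Fin (N + 1) → ℝ) : ℂ :=
  prefactor c L hch t μ * (vevFactor c x t μ l / ((gaudin c L l).det : ℂ))

theorem sum_perm_rootTerm (hch x : ℝ) (t : ℂ) (μ : Fin N → ℝ) (l : Fin (N + 1) → ℝ) :
    ∑ σ : Equiv.Perm (Fin (N + 1)), rootTerm c L hch x t μ (l ∘ σ)
      = formFactorTerm c L hch x t μ l := by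
  simp only [rootTerm, gaudin_comp_perm]
  rw [← Finset.mul_sum, ← Finset.sum_div, sum_perm_vevFactor, formFactorTerm]
  ring

/-- The operator roots depend on the integration variables themselves. Applying the increasing
counting function to `|l_j - l_{n_j}| ≤ ε` removes the roots and gives the two explicit inequalities
of the cell. -/
theorem rootIntegrand_eq_indicator (hc : 0 < c) (hL : 0 < L) (hch x : ℝ) (t : ℂ) (μ : Fin N → ℝ)
    {ε : ℝ} (n : Fin (N + 1) → ℤ) :
    rootIntegrand c L hch x t μ ε n
      = (rootCell c L (fun j => 2 * Real.pi * (n j : ℝ)) ε).indicator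
        fun l => ((1 / (2 * ε) : ℝ) : ℂ) ^ (N + 1) * (prefactor c L hch t μ *
          (vevFactor c x t μ l / ((∏ j, (L + ∑ k, Kfun c (l j) (l k)) : ℝ) : ℂ))) := by
  funext l
  rw [rootIntegrand_eq hc, rootWeight]
  have h1 : ∀ j, |l j - rootOf L (n j) (phiValue c l)| ≤ ε ↔
      counting c L l (l j - ε) ≤ 2 * Real.pi * (n j : ℝ) ∧
        2 * Real.pi * (n j : ℝ) ≤ counting c L l (l j + ε) := fun j => by
    rw [← rootOf_phiValue hc hL l (n j), (strictMono_counting hc hL l).le_iff_le,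
      (strictMono_counting hc hL l).le_iff_le, abs_le]
    constructor <;> rintro ⟨h1, h2⟩ <;> constructor <;> linarith
  simp only [deltaApprox, twoPiRho_phiValue hc hL, h1]
  by_cases hl : l ∈ rootCell c L (fun j => 2 * Real.pi * (n j : ℝ)) ε
  · rw [Set.indicator_of_mem hl]
    rw [Finset.prod_congr rfl fun j _ => by rw [if_pos (hl j)]]
    simp only [Finset.prod_div_distrib, Finset.prod_const, Finset.card_univ, Fintype.card_fin,
      Complex.ofReal_prod]
    ring
  · rw [Set.indicator_of_notMem hl]
    obtain ⟨j, hj⟩ : ∃ j, ¬ (counting c L l (l j - ε) ≤ 2 * Real.pi * (n j : ℝ) ∧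
        2 * Real.pi * (n j : ℝ) ≤ counting c L l (l j + ε)) := by
      simpa only [rootCell, Set.mem_ofPred_eq, not_forall] using hl
    rw [Finset.prod_eq_zero (Finset.mem_univ j) (by rw [if_neg hj, zero_div])]
    simp

/-- The product `∏_j (L + ∑_k K)` in the limiting cell volume cancels the weights `L · 2πρ̂`; the
assumption on the roots gives continuity of the integrand at the solution. -/
theorem tendsto_integral_rootIntegrand (hc : 0 < c) (hL : 0 < L) (hch x : ℝ) (t : ℂ)
    (μ : Fin N → ℝ) (n : Fin (N + 1) → ℤ) (hn : ∀ j k, betheRoots hc hL n j ≠ μ k) :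
    (∀ᶠ ε in 𝓝[>] (0 : ℝ), Integrable (rootIntegrand c L hch x t μ ε n)) ∧
    Tendsto (fun ε : ℝ => ∫ l, rootIntegrand c L hch x t μ ε n l) (𝓝[>] 0)
      (𝓝 (rootTerm c L hch x t μ (betheRoots hc hL n))) := by
  have hpos : ∀ (l : Fin (N + 1) → ℝ) j, 0 < L + ∑ k, Kfun c (l j) (l k) := fun l j =>
    add_pos_of_pos_of_nonneg hL (Finset.sum_nonneg fun k _ => Kfun_nonneg hc _ _)
  have hK : Continuous fun l : Fin (N + 1) → ℝ => ∏ j, (L + ∑ k, Kfun c (l j) (l k)) := by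
    unfold Kfun
    refine continuous_finsetProd _ fun j _ => continuous_const.add
      (continuous_finsetSum _ fun k _ => Continuous.div (by fun_prop) (by fun_prop) fun l => ?_)
    positivity
  have hKC := Complex.continuous_ofReal.comp hK
  have hne : ∀ l : Fin (N + 1) → ℝ, ((∏ j, (L + ∑ k, Kfun c (l j) (l k)) : ℝ) : ℂ) ≠ 0 := fun l =>
    Complex.ofReal_ne_zero.2 (Finset.prod_pos fun j _ => hpos l j).ne'
  have h := tendsto_integral_rootCell hc hL (betheRoots hc hL n)
    (fun l => prefactor c L hch t μ *
      (vevFactor c x t μ l / ((∏ j, (L + ∑ k, Kfun c (l j) (l k)) : ℝ) : ℂ)))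
    (measurable_const.mul ((measurable_vevFactor x t μ).div hKC.measurable))
    (continuousAt_const.mul ((continuousAt_vevFactor hc x t μ hn).div hKC.continuousAt (hne _)))
  rw [bethe_betheRoots] at h
  simp only [rootIntegrand_eq_indicator hc hL]
  refine ⟨h.1, ?_⟩
  convert h.2 using 2
  rw [rootTerm]
  have h1 := hne (betheRoots hc hL n)
  rw [Complex.ofReal_div]
  field_simp

end RootTerms

/-! ### Summation over ordered and unordered quantum numbers -/

section Ordering

variable {N : ℕ} {c L : ℝ}

theorem comp_perm_injective {M : ℕ} :
    Function.Injective fun p : {n : Fin M → ℤ // StrictMono n} × Equiv.Perm (Fin M) =>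
      (p.1.1 ∘ p.2 : Fin M → ℤ) := by
  rintro ⟨⟨n, hn⟩, σ⟩ ⟨⟨n', hn'⟩, σ'⟩ h
  dsimp only at h
  have h1 : Set.range n = Set.range n' := by
    rw [← σ.surjective.range_comp n, h, σ'.surjective.range_comp]
  obtain rfl : n = n' := (StrictMono.range_inj hn hn').1 h1
  have h2 : σ = σ' := Equiv.ext fun j => hn.injective (congrFun h j)
  rw [h2]

theorem mem_range_comp_perm {M : ℕ} {n : Fin M → ℤ} (hn : Function.Injective n) :
    n ∈ Set.range fun p : {n : Fin M → ℤ // StrictMono n} × Equiv.Perm (Fin M) =>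
      (p.1.1 ∘ p.2 : Fin M → ℤ) := by
  refine ⟨⟨⟨n ∘ Tuple.sort n, (Tuple.monotone_sort n).strictMono_of_injective
    (hn.comp (Tuple.sort n).injective)⟩, (Tuple.sort n)⁻¹⟩, ?_⟩
  funext j
  simp

theorem rootTerm_eq_zero (hc : 0 < c) (hL : 0 < L) (hch x : ℝ) (t : ℂ) (μ : Fin N → ℝ)
    {n : Fin (N + 1) → ℤ} (hn : ¬ Function.Injective n) :
    rootTerm c L hch x t μ (betheRoots hc hL n) = 0 := by
  obtain ⟨j, k, hjk, hne⟩ : ∃ j k, n j = n k ∧ j ≠ k := by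
    simpa [Function.Injective] using hn
  rw [rootTerm, vevFactor, smatDet_eq_zero hne ((betheRoots_eq_iff hc hL n j k).2 hjk)]
  simp

/-- Intermediate states are labelled by their increasing quantum numbers. -/
def excitedStateEquiv (N : ℕ) (hc : 0 < c) (hL : 0 < L) :
    {n : Fin (N + 1) → ℤ // StrictMono n} ≃ ExcitedState N c L :=
  Equiv.ofBijective (fun n => ⟨betheRoots hc hL n.1,
      fun _ _ hjk => (betheRoots_lt_iff hc hL n.1 _ _).2 (n.2 hjk),
      n.1, (isBethe_iff_eq_betheRoots hc hL _ _).2 rfl⟩) <| by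
    constructor
    · rintro ⟨n, hn⟩ ⟨n', hn'⟩ h
      have h1 : betheRoots hc hL n = betheRoots hc hL n' := congrArg Subtype.val h
      have h2 := bethe_betheRoots hc hL n
      rw [h1, bethe_betheRoots hc hL n'] at h2
      ext j
      have h3 := congrFun h2 j
      have h4 := mul_left_cancel₀ (by positivity) h3
      exact (Int.cast_injective h4).symm
    · rintro ⟨l, hl, n, hn⟩
      obtain rfl := (isBethe_iff_eq_betheRoots hc hL n l).1 hn
      exact ⟨⟨n, fun j k hjk => (betheRoots_lt_iff hc hL n j k).1 (hl hjk)⟩, rfl⟩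

/-- An injective integer vector is in exactly one way an increasing vector composed with a
permutation, and the other vectors contribute zero. -/
theorem hasSum_strictMono {M : ℕ} (R : (Fin M → ℤ) → ℂ)
    (hinj : ∀ n, ¬ Function.Injective n → R n = 0) (hR : Summable R) :
    HasSum (fun n : {n : Fin M → ℤ // StrictMono n} =>
      ∑ σ : Equiv.Perm (Fin M), R (n.1 ∘ σ)) (∑' n, R n) := by
  have h1 := (comp_perm_injective.hasSum_iff (f := R) fun n hn =>
    hinj n fun h => hn (mem_range_comp_perm h)).2 hR.hasSum
  exact h1.prod_fiberwise fun n => hasSum_fintype _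

theorem summable_and_hasSum_correlation (hc : 0 < c) (hL : 0 < L) (hch x : ℝ) (t : ℂ)
    (μ : Fin N → ℝ)
    (hR : Summable fun n => rootTerm c L hch x t μ (betheRoots hc hL n)) :
    (Summable fun s : ExcitedState N c L => formFactorTerm c L hch x t μ s.1) ∧
      HasSum (fun n => rootTerm c L hch x t μ (betheRoots hc hL n))
        (correlation c L hch x t μ) := by
  have h2 := hasSum_strictMono (fun n => rootTerm c L hch x t μ (betheRoots hc hL n))
    (fun n => rootTerm_eq_zero hc hL hch x t μ) hR
  simp only [betheRoots_comp_perm, sum_perm_rootTerm] at h2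
  have h4 : HasSum (fun s : ExcitedState N c L => formFactorTerm c L hch x t μ s.1)
      (∑' n, rootTerm c L hch x t μ (betheRoots hc hL n)) := by
    rw [← (excitedStateEquiv N hc hL).hasSum_iff]
    exact h2
  refine ⟨h4.summable, ?_⟩
  rw [correlation, h4.tsum_eq]
  exact hR.hasSum

end Ordering

/-! ### Bounds on the form factors -/

section Bounds

variable {N : ℕ} {c L : ℝ}

/-- The real part of `h` is `1`; products of `h` in denominators can thus be dropped from upper
bounds. -/
theorem one_le_norm_hfun (hc : 0 < c) (a b : ℝ) : 1 ≤ ‖hfun c a b‖ := by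
  have h := Complex.abs_re_le_norm (hfun c a b)
  rw [hfun_eq hc] at h ⊢
  simpa using h

theorem norm_hfun_le (hc : 0 < c) (a b : ℝ) :
    ‖hfun c a b‖ ≤ Real.exp (|a| / c) * Real.exp (|b| / c) := by
  rw [hfun_eq hc, ← Real.exp_add]
  refine (norm_add_le _ _).trans ?_
  rw [norm_mul, Complex.norm_I, mul_one, Complex.norm_real, Real.norm_eq_abs, abs_neg, abs_div,
    abs_of_pos hc, norm_one, ← add_div]
  have h1 : |a - b| / c ≤ (|a| + |b|) / c := by
    gcongr
    exact abs_sub a b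
  linarith [Real.add_one_le_exp ((|a| + |b|) / c)]

theorem norm_tfun_le (hc : 0 < c) (a b : ℝ) : ‖tfun c a b‖ ≤ c / |a - b| := by
  have h1 : c ≤ ‖(a : ℂ) - b + Complex.I * c‖ := by
    have h := Complex.abs_im_le_norm ((a : ℂ) - b + Complex.I * c)
    simp only [Complex.add_im, Complex.sub_im, Complex.ofReal_im, sub_zero, Complex.mul_im,
      Complex.I_re, zero_mul, Complex.I_im, Complex.ofReal_re, one_mul, zero_add,
      abs_of_pos hc] at h
    exact h
  have h2 : ‖(a : ℂ) - b‖ = |a - b| := by rw [← Complex.ofReal_sub, Complex.norm_real]; rfl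
  rw [tfun, norm_div, norm_mul, norm_pow, norm_mul, Complex.norm_I, one_mul, Complex.norm_real,
    Real.norm_of_nonneg hc.le, h2]
  rcases eq_or_ne a b with rfl | hab
  · simp
  have h3 : 0 < |a - b| := abs_pos.2 (sub_ne_zero.2 hab)
  rw [div_le_div_iff₀ (mul_pos h3 (hc.trans_le h1)) h3]
  calc c ^ 2 * |a - b| = c * (|a - b| * c) := by ring
    _ ≤ _ := by gcongr

/-- A bound for the products of `h(μ_m, y)`. -/
def hBound (c : ℝ) (μ : Fin N → ℝ) : ℝ := ∏ m, Real.exp (|μ m| / c)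

theorem prod_norm_hfun_left_le (hc : 0 < c) (μ : Fin N → ℝ) (y : ℝ) :
    ∏ m, ‖hfun c (μ m) y‖ ≤ hBound c μ * Real.exp (N / c * |y|) := by
  calc ∏ m, ‖hfun c (μ m) y‖ ≤ ∏ m, (Real.exp (|μ m| / c) * Real.exp (|y| / c)) :=
        Finset.prod_le_prod (fun _ _ => norm_nonneg _) fun m _ => norm_hfun_le hc _ _
    _ = _ := by
        rw [Finset.prod_mul_distrib, hBound, Finset.prod_const, ← Real.exp_nat_mul, Finset.card_univ,
          Fintype.card_fin, mul_div_assoc', div_mul_eq_mul_div]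

theorem prod_norm_hfun_right_le (hc : 0 < c) (μ : Fin N → ℝ) (y : ℝ) :
    ∏ m, ‖hfun c y (μ m)‖ ≤ hBound c μ * Real.exp (N / c * |y|) := by
  calc ∏ m, ‖hfun c y (μ m)‖ ≤ ∏ m, (Real.exp (|μ m| / c) * Real.exp (|y| / c)) :=
        Finset.prod_le_prod (fun _ _ => norm_nonneg _) fun m _ =>
          (norm_hfun_le hc _ _).trans_eq (mul_comm _ _)
    _ = _ := by
        rw [Finset.prod_mul_distrib, hBound, Finset.prod_const, ← Real.exp_nat_mul, Finset.card_univ,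
          Fintype.card_fin, mul_div_assoc', div_mul_eq_mul_div]

theorem hBound_nonneg (μ : Fin N → ℝ) : 0 ≤ hBound c μ :=
  Finset.prod_nonneg fun _ _ => (Real.exp_pos _).le

theorem norm_prod_div_prod_le {K K' : ℕ} (f : Fin K → ℂ) (g : Fin K' → ℂ) {B : ℝ}
    (hf : ∏ m, ‖f m‖ ≤ B) (hg : ∀ p, 1 ≤ ‖g p‖) : ‖(∏ m, f m) / ∏ p, g p‖ ≤ B := by
  rw [norm_div, norm_prod, norm_prod]
  have h1 : 1 ≤ ∏ p, ‖g p‖ := by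
    calc (1 : ℝ) = ∏ _p : Fin K', (1 : ℝ) := by simp
      _ ≤ _ := Finset.prod_le_prod (fun _ _ => zero_le_one) fun p _ => hg p
  exact (div_le_self (Finset.prod_nonneg fun _ _ => norm_nonneg _) h1).trans hf

/-- The matrix elements `S_{jk}` have at most simple poles. -/
theorem norm_Smat_le (hc : 0 < c) (μ : Fin N → ℝ) (l : Fin (N + 1) → ℝ) (j : Fin (N + 1))
    (k : Fin N) :
    ‖Smat c μ l j k‖ ≤ 2 * c * hBound c μ * Real.exp (N / c * |l j|) / |l j - μ k| := by
  have h1 := norm_prod_div_prod_le (fun m => hfun c (μ m) (l j)) (fun p => hfun c (l p) (l j))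
    (prod_norm_hfun_left_le hc μ (l j)) fun p => one_le_norm_hfun hc _ _
  have h2 := norm_prod_div_prod_le (fun m => hfun c (l j) (μ m)) (fun p => hfun c (l j) (l p))
    (prod_norm_hfun_right_le hc μ (l j)) fun p => one_le_norm_hfun hc _ _
  have h3 := norm_tfun_le hc (μ k) (l j)
  have h4 := norm_tfun_le hc (l j) (μ k)
  rw [abs_sub_comm] at h3
  rw [Smat]
  refine (norm_sub_le _ _).trans ?_
  rw [norm_mul, norm_mul]
  calc _ ≤ c / |l j - μ k| * (hBound c μ * Real.exp (N / c * |l j|))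
        + c / |l j - μ k| * (hBound c μ * Real.exp (N / c * |l j|)) := by gcongr
    _ = _ := by ring

theorem exp_neg_I_counting (hc : 0 < c) (μ : Fin N → ℝ) (y : ℝ) :
    Complex.exp (-Complex.I * (counting c L μ y : ℂ))
      = Complex.exp (-Complex.I * L * y) * ∏ m, hfun c y (μ m) / hfun c (μ m) y := by
  have h1 : ∀ m, hfun c y (μ m) / hfun c (μ m) y
      = Complex.exp (-Complex.I * (phase c (y - μ m) : ℂ)) := fun m => by
    rw [← log_hfun_div hc, ← mul_assoc, neg_mul, Complex.I_mul_I, neg_neg, one_mul,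
      Complex.exp_log (div_ne_zero (hfun_ne_zero hc _ _) (hfun_ne_zero hc _ _))]
  simp only [h1]
  rw [← Complex.exp_sum, ← Complex.exp_add, counting]
  congr 1
  push_cast
  rw [mul_add, Finset.mul_sum]
  ring

theorem counting_groundState (hc : 0 < c) {μ : Fin N → ℝ} (hμ : IsGroundState c L μ) (k : Fin N) :
    counting c L μ (μ k) = 2 * Real.pi * (((k : ℕ) : ℝ) + 1 - ((N : ℝ) + 1) / 2) := by
  have h1 := hμ k
  have h2 : ∀ m, (Complex.I * c + μ k - μ m) / (Complex.I * c - μ k + μ m)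
      = hfun c (μ k) (μ m) / hfun c (μ m) (μ k) := fun m => by
    have h3 : Complex.I * (c : ℂ) ≠ 0 :=
      mul_ne_zero Complex.I_ne_zero (by exact_mod_cast hc.ne')
    rw [hfun, hfun, div_div_div_cancel_right₀ h3]
    ring_nf
  simp only [h2, log_hfun_div hc] at h1
  rw [counting]
  apply Complex.ofReal_injective
  push_cast
  exact h1

/-- For even `N` the phase factor at the ground state rapidities is `-1`. -/
theorem exp_neg_I_counting_groundState (hN : Even N) (hc : 0 < c) {μ : Fin N → ℝ}
    (hμ : IsGroundState c L μ) (k : Fin N) :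
    Complex.exp (-Complex.I * (counting c L μ (μ k) : ℂ)) = -1 := by
  obtain ⟨q, hq⟩ := hN
  have h1 : -Complex.I * (counting c L μ (μ k) : ℂ)
      = Real.pi * Complex.I + (((q : ℤ) - ((k : ℕ) : ℤ) - 1 : ℤ) : ℂ) * (2 * Real.pi * Complex.I) := by
    rw [counting_groundState hc hμ]
    have h2 : (N : ℝ) = q + q := by rw [hq]; push_cast; ring
    rw [h2]
    push_cast
    ring
  rw [h1, Complex.exp_add, Complex.exp_int_mul_two_pi_mul_I, mul_one, Complex.exp_pi_mul_I]

/-- The expression vanishes at `y = μ_k` because `N` is even, and the phase is Lipschitz. -/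
theorem norm_one_add_exp_counting_le (hN : Even N) (hc : 0 < c) (hL : 0 < L) {μ : Fin N → ℝ}
    (hμ : IsGroundState c L μ) (k : Fin N) (y : ℝ) :
    ‖1 + Complex.exp (-Complex.I * (counting c L μ y : ℂ))‖ ≤ (L + N * (2 / c)) * |y - μ k| := by
  have h1 : 1 + Complex.exp (-Complex.I * (counting c L μ y : ℂ))
      = -(Complex.exp (Complex.I * ((-(counting c L μ y - counting c L μ (μ k)) : ℝ) : ℂ)) - 1) := by
    have h2 : -Complex.I * (counting c L μ y : ℂ)
        = Complex.I * ((-(counting c L μ y - counting c L μ (μ k)) : ℝ) : ℂ)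
          + -Complex.I * (counting c L μ (μ k) : ℂ) := by
      push_cast
      ring
    rw [h2, Complex.exp_add, exp_neg_I_counting_groundState hN hc hμ]
    ring
  rw [h1, norm_neg]
  refine (Real.norm_exp_I_mul_ofReal_sub_one_le).trans ?_
  rw [norm_neg, Real.norm_eq_abs]
  exact abs_counting_sub_le hc hL μ y (μ k)

/-- With `d = y - m`, the common denominator is `d (d² + c²)` and the numerator is `-c² (ic (1 + ρ)
+ d (1 - ρ))`. Both terms are of order `d`, so the pole cancels. At `d = 0` both values of `tfun`
are zero by the convention for division. -/
theorem norm_tfun_sub_tfun_mul_le (hc : 0 < c) (m y : ℝ) {ρ : ℂ} {B : ℝ} (hB : 0 ≤ B)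
    (hρ : ‖ρ‖ ≤ 1) (h : ‖1 + ρ‖ ≤ B * |y - m|) :
    ‖tfun c m y - tfun c y m * ρ‖ ≤ c * B + 2 := by
  rcases eq_or_ne y m with rfl | hym
  · simp [tfun]
    positivity
  have hd : (y : ℂ) - m ≠ 0 := sub_ne_zero.2 (by exact_mod_cast hym)
  have h1 := tfun_denominator_ne_zero hc hym
  have h2 := tfun_denominator_ne_zero hc hym.symm
  have h3 := right_ne_zero_of_mul h1
  have h4 := right_ne_zero_of_mul h2
  set d : ℂ := (y : ℂ) - m with hdd
  have h5 : (m : ℂ) - y = -d := by rw [hdd]; ring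
  rw [h5] at h4
  have h6 : (-d + Complex.I * c) * (d + Complex.I * c) = -(((y - m) ^ 2 + c ^ 2 : ℝ) : ℂ) := by
    push_cast
    rw [hdd]
    ring_nf
    rw [Complex.I_sq]
    ring
  have h7 : tfun c m y - tfun c y m * ρ
      = -(c : ℂ) ^ 2 * (Complex.I * c * (1 + ρ) + d * (1 - ρ)) /
        (d * (((y - m) ^ 2 + c ^ 2 : ℝ) : ℂ)) := by
    have h8 : (((y - m) ^ 2 + c ^ 2 : ℝ) : ℂ) = -((-d + Complex.I * c) * (d + Complex.I * c)) := by
      rw [h6, neg_neg]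
    rw [h8, tfun, tfun, h5, ← hdd]
    rw [mul_pow, Complex.I_sq, div_mul_eq_mul_div, div_sub_div _ _ (mul_ne_zero (neg_ne_zero.2 hd) h4)
      h1, div_eq_div_iff (mul_ne_zero (mul_ne_zero (neg_ne_zero.2 hd) h4) h1)
      (mul_ne_zero hd (neg_ne_zero.2 (mul_ne_zero h4 h3)))]
    ring
  have hdn : ‖d‖ = |y - m| := by rw [hdd, ← Complex.ofReal_sub, Complex.norm_real]; rfl
  have hpos : 0 < |y - m| := abs_pos.2 (sub_ne_zero.2 hym)
  have h9 : ‖Complex.I * c * (1 + ρ) + d * (1 - ρ)‖ ≤ (c * B + 2) * |y - m| := by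
    refine (norm_add_le _ _).trans ?_
    rw [norm_mul, norm_mul, norm_mul, Complex.norm_I, one_mul, Complex.norm_real,
      Real.norm_of_nonneg hc.le, hdn]
    have h10 : ‖1 - ρ‖ ≤ 2 := (norm_sub_le _ _).trans (by rw [norm_one]; linarith)
    calc _ ≤ c * (B * |y - m|) + |y - m| * 2 := by gcongr
      _ = _ := by ring
  rw [h7, norm_div, norm_mul, norm_mul, hdn, norm_neg, norm_pow, Complex.norm_real, Complex.norm_real,
    Real.norm_of_nonneg hc.le, Real.norm_of_nonneg (by positivity),
    div_le_iff₀ (by positivity)]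
  calc _ ≤ c ^ 2 * ((c * B + 2) * |y - m|) := by gcongr
    _ = (c * B + 2) * (|y - m| * c ^ 2) := by ring
    _ ≤ _ := by
      gcongr
      linarith [sq_nonneg (y - m)]

/-- On solutions of the Bethe equations the poles of `S_{jk}` cancel. -/
theorem norm_Smat_betheRoots_le (hN : Even N) (hc : 0 < c) (hL : 0 < L) {μ : Fin N → ℝ}
    (hμ : IsGroundState c L μ) (n : Fin (N + 1) → ℤ) (j : Fin (N + 1)) (k : Fin N) :
    ‖Smat c μ (betheRoots hc hL n) j k‖
      ≤ (c * (L + N * (2 / c)) + 2) * hBound c μ *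
        Real.exp (N / c * |betheRoots hc hL n j|) := by
  set l := betheRoots hc hL n with hl
  have hB : 0 ≤ L + N * (2 / c) := by positivity
  -- The exponentiated Bethe equation makes the ratio of the two products in `S` depend on `l_j`
  -- alone, so that the relative phase of its two terms is that of the ground-state counting
  -- function.
  have h1 : ∏ p, hfun c (l p) (l j) / hfun c (l j) (l p) = Complex.exp (-Complex.I * L * l j) := by
    rw [← exp_phiValue hc, phiValue_eq hc]
    have h2 := congrFun (bethe_betheRoots hc hL n) j
    rw [← hl, bethe, counting] at h2
    have h3 : Complex.I * ((∑ p, phase c (l j - l p) : ℝ) : ℂ)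
        = -Complex.I * L * l j + (n j : ℂ) * (2 * Real.pi * Complex.I) := by
      rw [eq_sub_of_add_eq' h2]
      push_cast
      ring
    rw [h3, Complex.exp_add, Complex.exp_int_mul_two_pi_mul_I, mul_one]
  have hne : ∀ {K : ℕ} (f g : Fin K → ℝ), ∏ i, hfun c (f i) (g i) ≠ 0 := fun f g =>
    Finset.prod_ne_zero_iff.2 fun _ _ => hfun_ne_zero hc _ _
  have h2 : Smat c μ l j k = (∏ m, hfun c (μ m) (l j)) / (∏ p, hfun c (l p) (l j)) *
      (tfun c (μ k) (l j) - tfun c (l j) (μ k) *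
        Complex.exp (-Complex.I * (counting c L μ (l j) : ℂ))) := by
    rw [exp_neg_I_counting hc, ← h1, Smat, Finset.prod_div_distrib, Finset.prod_div_distrib]
    have ha := hne (fun p => l p) (fun _ => l j)
    have hb := hne (fun p => μ p) (fun _ => l j)
    have hd := hne (fun _ => l j) (fun p => l p)
    field_simp
  have h3 := norm_prod_div_prod_le (fun m => hfun c (μ m) (l j)) (fun p => hfun c (l p) (l j))
    (prod_norm_hfun_left_le hc μ (l j)) fun p => one_le_norm_hfun hc _ _
  have h4 := norm_tfun_sub_tfun_mul_le hc (μ k) (l j) hB (ρ := Complex.exp (-Complex.I *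
    (counting c L μ (l j) : ℂ))) (by
      rw [Complex.norm_exp]
      simp) (norm_one_add_exp_counting_le hN hc hL hμ k (l j))
  rw [h2, norm_mul]
  calc _ ≤ (hBound c μ * Real.exp (N / c * |l j|)) * (c * (L + N * (2 / c)) + 2) := by
        gcongr
        exact mul_nonneg (hBound_nonneg μ) (Real.exp_pos _).le
    _ = _ := by ring

/-- One factor `v_i` controls row `i` in the diagonal product, the other in the Leibniz expansion.
The row without diagonal entry and the column of ones use `v_i ≤ D_i` instead. -/
theorem prod_sq_mul_norm_det_bordered_le (S : Fin (N + 1) → Fin N → ℂ) (v D : Fin (N + 1) → ℝ)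
    (hv : ∀ i, 0 ≤ v i) (h1 : ∀ i, v i ≤ D i) (h2 : ∀ i k, v i * ‖S i k‖ ≤ D i) :
    (∏ i, v i ^ 2) * ‖(∏ j : Fin N, S j.castSucc j) * (bordered S).det‖
      ≤ (N + 1).factorial * ∏ i, D i ^ 2 := by
  have hT : ∀ i k, v i * ‖bordered S i k‖ ≤ D i := fun i k => by
    refine Fin.lastCases ?_ (fun k => ?_) k
    · simpa using h1 i
    · simpa using h2 i k
  have hD : ∀ i, 0 ≤ D i := fun i => (hv i).trans (h1 i)
  have hs : (∏ i, v i) * ‖∏ j : Fin N, S j.castSucc j‖ ≤ ∏ i, D i := by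
    rw [norm_prod, Fin.prod_univ_castSucc, Fin.prod_univ_castSucc, mul_right_comm,
      ← Finset.prod_mul_distrib]
    have := h1 (Fin.last N)
    have := hv (Fin.last N)
    gcongr with j
    · exact Finset.prod_nonneg fun j _ => hD _
    · exact fun j _ => mul_nonneg (hv _) (norm_nonneg _)
    · exact h2 _ _
  have hdet : (∏ i, v i) * ‖(bordered S).det‖ ≤ (N + 1).factorial * ∏ i, D i := by
    rw [Matrix.det_apply]
    calc _ ≤ (∏ i, v i) * ∑ σ : Equiv.Perm (Fin (N + 1)), ∏ i, ‖bordered S (σ i) i‖ := by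
          have := Finset.prod_nonneg fun i (_ : i ∈ Finset.univ) => hv i
          gcongr
          refine (norm_sum_le _ _).trans (Finset.sum_le_sum fun σ _ => ?_)
          rw [← norm_prod]
          rcases Int.units_eq_one_or (Equiv.Perm.sign σ) with h | h <;> simp [h]
      _ = ∑ σ : Equiv.Perm (Fin (N + 1)), ∏ i, v (σ i) * ‖bordered S (σ i) i‖ := by
          rw [Finset.mul_sum]
          refine Finset.sum_congr rfl fun σ _ => ?_
          rw [Finset.prod_mul_distrib, Equiv.prod_comp σ v]
      _ ≤ ∑ σ : Equiv.Perm (Fin (N + 1)), ∏ i, D (σ i) := by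
          refine Finset.sum_le_sum fun σ _ => Finset.prod_le_prod
            (fun i _ => mul_nonneg (hv _) (norm_nonneg _)) fun i _ => hT _ _
      _ = _ := by
          simp only [fun σ : Equiv.Perm (Fin (N + 1)) => Equiv.prod_comp σ D]
          rw [Finset.sum_const, Finset.card_univ, Fintype.card_perm, Fintype.card_fin, nsmul_eq_mul]
  rw [norm_mul, Finset.prod_pow, Finset.prod_pow, sq, sq]
  calc _ = ((∏ i, v i) * ‖∏ j : Fin N, S j.castSucc j‖) * ((∏ i, v i) * ‖(bordered S).det‖) := by
        ring
    _ ≤ (∏ i, D i) * ((N + 1).factorial * ∏ i, D i) := by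
        gcongr
        · exact mul_nonneg (Finset.prod_nonneg fun i _ => hv i) (norm_nonneg _)
        · exact Finset.prod_nonneg fun i _ => hD i
    _ = _ := by ring

/-- Completing the square spends half of the Gaussian on the linear growth; the other half dominates
`1 + y²`. -/
theorem exp_sub_sq_le {a : ℝ} (ha : 0 < a) (κ : ℝ) :
    ∃ C : ℝ, 0 < C ∧ ∀ y : ℝ, Real.exp (κ * |y| - a * y ^ 2) ≤ C * (1 + y ^ 2)⁻¹ := by
  refine ⟨Real.exp (κ ^ 2 / (2 * a)) * (1 + 2 / a), by positivity, fun y => ?_⟩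
  have h1 : κ * |y| - a * y ^ 2 ≤ κ ^ 2 / (2 * a) - a / 2 * y ^ 2 := by
    have h2 : κ ^ 2 / (2 * a) - a / 2 * y ^ 2 - (κ * |y| - a * y ^ 2)
        = (κ - a * |y|) ^ 2 / (2 * a) := by
      field_simp
      rw [sub_sq, mul_pow, sq_abs]
      ring
    have : 0 ≤ (κ - a * |y|) ^ 2 / (2 * a) := by positivity
    linarith
  refine (Real.exp_le_exp.2 h1).trans ?_
  rw [sub_eq_add_neg, Real.exp_add, mul_assoc]
  gcongr
  rw [Real.exp_neg, ← div_eq_mul_inv, inv_eq_one_div, div_le_div_iff₀ (Real.exp_pos _) (by positivity)]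
  have h3 := Real.add_one_le_exp (a / 2 * y ^ 2)
  calc 1 * (1 + y ^ 2) ≤ (1 + 2 / a) * (a / 2 * y ^ 2 + 1) := by
        have h4 : (1 + 2 / a) * (a / 2 * y ^ 2 + 1) = 1 + y ^ 2 + 2 / a + a / 2 * y ^ 2 := by
          field_simp
          ring
        rw [h4]
        have : 0 ≤ 2 / a + a / 2 * y ^ 2 := by positivity
        linarith
    _ ≤ _ := by gcongr

theorem norm_exp_tau (x : ℝ) (t : ℂ) (y : ℝ) :
    ‖Complex.exp (tau x t y)‖ = Real.exp (-t.im * y ^ 2) := by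
  rw [Complex.norm_exp]
  congr 1
  rw [tau, ← Complex.ofReal_pow]
  simp only [Complex.sub_re, Complex.mul_re, Complex.mul_im, Complex.I_re, Complex.I_im,
    Complex.ofReal_re, Complex.ofReal_im]
  ring

/-- Gaussian decay of the vacuum expectation values for `t` in the upper half plane. -/
theorem prod_sq_mul_norm_vevFactor_le (hc : 0 < c) (x : ℝ) {t : ℂ} (ht : 0 < t.im)
    (μ : Fin N → ℝ) (K : ℝ) :
    ∃ C : ℝ, 0 < C ∧ ∀ l v : Fin (N + 1) → ℝ, (∀ i, 0 ≤ v i) →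
      (∀ i, v i ≤ K * Real.exp (N / c * |l i|)) →
      (∀ i k, v i * ‖Smat c μ l i k‖ ≤ K * Real.exp (N / c * |l i|)) →
      (∏ i, v i ^ 2) * ‖vevFactor c x t μ l‖ ≤ C * ∏ i, (1 + l i ^ 2)⁻¹ := by
  -- The growth rate `2N/c` comes from the squared row bounds, and `2(N + 1)/c` from `∏ h(l_j,l_k)`,
  -- in which each rapidity occurs in `2(N + 1)` slots.
  obtain ⟨C₁, hC₁, hC₁'⟩ := exp_sub_sq_le ht (2 * (N / c) + 2 * (N + 1) / c)
  set A := ‖∏ m, Complex.exp (-tau x t (μ m))‖ with hA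
  have hA0 : 0 < A := norm_pos_iff.2 (Finset.prod_ne_zero_iff.2 fun _ _ => Complex.exp_ne_zero _)
  refine ⟨A * (N + 1).factorial * ((K ^ 2 + 1) * C₁) ^ (N + 1), by positivity,
    fun l v hv h1 h2 => ?_⟩
  have h3 : (∏ i, v i ^ 2) * ‖smatDet c μ l‖ ≤ _ :=
    prod_sq_mul_norm_det_bordered_le (Smat c μ l) v _ hv h1 h2
  have h4 : ‖(∏ j, ∏ k, hfun c (l j) (l k)) / ∏ j, ∏ k, hfun c (μ j) (μ k)‖
      ≤ ∏ j, Real.exp (2 * (N + 1) / c * |l j|) := by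
    refine norm_prod_div_prod_le (fun j => ∏ k, hfun c (l j) (l k)) _ ?_ fun j => ?_
    · calc ∏ j, ‖∏ k, hfun c (l j) (l k)‖
          ≤ ∏ j, ∏ k, (Real.exp (|l j| / c) * Real.exp (|l k| / c)) := by
            refine Finset.prod_le_prod (fun _ _ => norm_nonneg _) fun j _ => ?_
            rw [norm_prod]
            exact Finset.prod_le_prod (fun _ _ => norm_nonneg _) fun k _ => norm_hfun_le hc _ _
        _ = _ := by
            simp only [Finset.prod_mul_distrib, Finset.prod_const, Finset.card_univ,
              Fintype.card_fin, Finset.prod_pow]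
            rw [← mul_pow, ← Finset.prod_mul_distrib, ← Finset.prod_pow]
            refine Finset.prod_congr rfl fun j _ => ?_
            rw [← Real.exp_add, ← Real.exp_nat_mul]
            congr 1
            push_cast
            ring
    · rw [norm_prod]
      calc (1 : ℝ) = ∏ _k : Fin N, (1 : ℝ) := by simp
        _ ≤ _ := Finset.prod_le_prod (fun _ _ => zero_le_one) fun p _ => one_le_norm_hfun hc _ _
  have h5 : ‖vevFactor c x t μ l‖ = (∏ j, Real.exp (-t.im * l j ^ 2)) * A *
      ‖smatDet c μ l‖ * ‖(∏ j, ∏ k, hfun c (l j) (l k)) / ∏ j, ∏ k, hfun c (μ j) (μ k)‖ := by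
    rw [vevFactor, norm_mul, norm_mul, norm_mul, norm_prod, hA]
    simp only [norm_exp_tau]
    ring
  rw [h5]
  calc _ = A * (∏ j, Real.exp (-t.im * l j ^ 2)) * ((∏ i, v i ^ 2) * ‖smatDet c μ l‖) *
        ‖(∏ j, ∏ k, hfun c (l j) (l k)) / ∏ j, ∏ k, hfun c (μ j) (μ k)‖ := by ring
    _ ≤ A * (∏ j, Real.exp (-t.im * l j ^ 2)) *
        ((N + 1).factorial * ∏ i, (K * Real.exp (N / c * |l i|)) ^ 2) *
        ∏ j, Real.exp (2 * (N + 1) / c * |l j|) := by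
        have h6 : 0 ≤ ∏ j, Real.exp (-t.im * l j ^ 2) :=
          Finset.prod_nonneg fun _ _ => (Real.exp_pos _).le
        have h7 : 0 ≤ ∏ i, (K * Real.exp (N / c * |l i|)) ^ 2 :=
          Finset.prod_nonneg fun _ _ => sq_nonneg _
        exact mul_le_mul (mul_le_mul_of_nonneg_left h3 (by positivity)) h4 (norm_nonneg _)
          (by positivity)
    _ = A * (N + 1).factorial * ∏ j, (K ^ 2 * Real.exp ((2 * (N / c) + 2 * (N + 1) / c) * |l j|
          - t.im * l j ^ 2)) := by
        have h8 : ∀ j, K ^ 2 * Real.exp ((2 * (N / c) + 2 * (N + 1) / c) * |l j| - t.im * l j ^ 2)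
            = Real.exp (-t.im * l j ^ 2) * (K * Real.exp (N / c * |l j|)) ^ 2 *
              Real.exp (2 * (N + 1) / c * |l j|) := fun j => by
          rw [mul_pow, ← Real.exp_nat_mul, mul_left_comm, mul_assoc, ← Real.exp_add, ← Real.exp_add]
          congr 2
          push_cast
          ring
        simp only [h8, Finset.prod_mul_distrib]
        ring
    _ ≤ A * (N + 1).factorial * ∏ j, ((K ^ 2 + 1) * C₁ * (1 + l j ^ 2)⁻¹) := by
        refine mul_le_mul_of_nonneg_left (Finset.prod_le_prod (fun j _ => by positivity)
          fun j _ => ?_) (by positivity)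
        rw [mul_assoc]
        exact mul_le_mul (by linarith) (hC₁' _) (Real.exp_pos _).le (by positivity)
    _ = _ := by
        rw [Finset.prod_mul_distrib, Finset.prod_const, Finset.card_univ, Fintype.card_fin]
        ring

end Bounds

/-! ### Poisson summation with Gaussian means -/

section Poisson

open MeasureTheory

theorem summable_and_hasSum_prod {M : ℕ} (f : Fin M → ℤ → ℂ) (hf : ∀ j, Summable fun n => ‖f j n‖) :
    (Summable fun n : Fin M → ℤ => ‖∏ j, f j (n j)‖) ∧
      HasSum (fun n : Fin M → ℤ => ∏ j, f j (n j)) (∏ j, ∑' n, f j n) := by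
  induction M with
  | zero =>
    refine ⟨Summable.of_finite, ?_⟩
    simp only [Finset.univ_eq_empty, Finset.prod_empty]
    exact hasSum_unique _
  | succ M ih =>
    obtain ⟨h1, h2⟩ := ih (fun j => f j.succ) fun j => hf _
    obtain ⟨e, he⟩ : ∃ e : ℤ × (Fin M → ℤ) ≃ (Fin (M + 1) → ℤ), ∀ p, e p = Fin.cons p.1 p.2 :=
      ⟨Fin.consEquiv fun _ => ℤ, fun _ => rfl⟩
    set F : (Fin (M + 1) → ℤ) → ℂ := fun n => ∏ j, f j (n j) with hF
    have h3 : ∀ p : ℤ × (Fin M → ℤ), F (e p) = f 0 p.1 * ∏ j : Fin M, f j.succ (p.2 j) :=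
      fun p => by
        rw [hF, he]
        dsimp only
        rw [Fin.prod_univ_succ]
        simp only [Fin.cons_zero, Fin.cons_succ]
    set g : (Fin M → ℤ) → ℂ := fun n => ∏ j, f j.succ (n j) with hg
    set f₀ : ℤ → ℂ := f 0 with hf₀
    have hf0 : Summable fun n => ‖f₀ n‖ := hf 0
    have h1' : Summable fun n => ‖g n‖ := h1
    have h2' : HasSum g (∏ j : Fin M, ∑' n, f j.succ n) := h2
    constructor
    · refine (e.summable_iff (f := fun n => ‖F n‖)).1 ?_
      have h4 : (fun n => ‖F n‖) ∘ e
          = fun p : ℤ × (Fin M → ℤ) => ‖f₀ p.1 * g p.2‖ :=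
        funext fun p => congrArg norm (h3 p)
      rw [h4]
      exact Summable.mul_norm (f := f₀) (g := g) hf0 h1'
    · refine (e.hasSum_iff (f := F)).1 ?_
      have h4 : F ∘ e
          = fun p : ℤ × (Fin M → ℤ) => f₀ p.1 * g p.2 := funext h3
      rw [h4, Fin.prod_univ_succ, ← h2'.tsum_eq]
      have h5 := summable_mul_of_summable_norm (f := f₀) (g := g) hf0 h1'
      rw [tsum_mul_tsum_of_summable_norm (f := f₀) (g := g) hf0 h1']
      exact h5.hasSum

theorem summable_prod_of_nonneg {M : ℕ} (f : ℤ → ℝ) (h0 : ∀ n, 0 ≤ f n) (hf : Summable f) :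
    Summable fun n : Fin M → ℤ => ∏ j, f (n j) := by
  have h := (summable_and_hasSum_prod (M := M) (fun _ n => (f n : ℂ)) fun _ => by
    simpa [abs_of_nonneg (h0 _)] using hf).1
  refine h.congr fun n => ?_
  rw [← Complex.ofReal_prod, Complex.norm_real,
    Real.norm_of_nonneg (Finset.prod_nonneg fun _ _ => h0 _)]

theorem summable_inv_one_add_sq : Summable fun n : ℤ => (1 + (n : ℝ) ^ 2)⁻¹ := by
  have h : Summable fun n : ℤ => 1 / (n : ℝ) ^ 2 := Real.summable_one_div_int_pow.2 one_lt_two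
  have h2 : Summable fun n : ℤ => (if n = 0 then (1 : ℝ) else 0) :=
    summable_of_ne_finset_zero (s := {0}) fun n hn => by
      simp only [Finset.mem_singleton] at hn
      simp [hn]
  refine Summable.of_nonneg_of_le (fun n => by positivity) (fun n => ?_) (h.add h2)
  rcases eq_or_ne n 0 with rfl | hn
  · simp
  · have : (0 : ℝ) < (n : ℝ) ^ 2 := by positivity
    rw [if_neg hn, add_zero, inv_eq_one_div]
    gcongr
    linarith

theorem summable_exp_neg_mul_sq {ε : ℝ} (hε : 0 < ε) :
    Summable fun n : ℤ => Real.exp (-ε * (n : ℝ) ^ 2) := by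
  refine Summable.of_nonneg_of_le (fun n => (Real.exp_pos _).le) (fun n => ?_)
    (summable_inv_one_add_sq.mul_left (1 + 1 / ε))
  rw [neg_mul, Real.exp_neg, ← div_eq_mul_inv, inv_eq_one_div,
    div_le_div_iff₀ (Real.exp_pos _) (by positivity)]
  have h3 := Real.add_one_le_exp (ε * (n : ℝ) ^ 2)
  calc 1 * (1 + (n : ℝ) ^ 2) ≤ (1 + 1 / ε) * (ε * (n : ℝ) ^ 2 + 1) := by
        have h4 : (1 + 1 / ε) * (ε * (n : ℝ) ^ 2 + 1)
            = 1 + (n : ℝ) ^ 2 + 1 / ε + ε * (n : ℝ) ^ 2 := by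
          field_simp
          ring
        rw [h4]
        have : 0 ≤ 1 / ε + ε * (n : ℝ) ^ 2 := by positivity
        linarith
    _ ≤ _ := by gcongr

/-- The terms of the periodized heat kernel. -/
def heatKernel (ε : ℝ) (m : ℤ) (u : ℝ) : ℝ :=
  √(Real.pi / ε) * Real.exp (-(u - 2 * Real.pi * m) ^ 2 / (4 * ε))

/-- The functional equation of the theta function on the imaginary axis. -/
theorem tsum_gaussian_mul_exp {ε : ℝ} (hε : 0 < ε) (u : ℝ) :
    ∑' n : ℤ, ((Real.exp (-ε * (n : ℝ) ^ 2) : ℝ) : ℂ) * Complex.exp (Complex.I * u * n)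
      = ∑' m : ℤ, ((heatKernel ε m u : ℝ) : ℂ) := by
  have hπ : (Real.pi : ℂ) ≠ 0 := by exact_mod_cast Real.pi_ne_zero
  have hε' : (ε : ℂ) ≠ 0 := by exact_mod_cast hε.ne'
  -- With `z = u/2π` and modular parameter `iε/π`, the theta series is the Gaussian sum, and its
  -- transform is the sum over images `u - 2πm`.
  have h := jacobiTheta₂_functional_equation ((u : ℂ) / (2 * Real.pi)) (Complex.I * ε / Real.pi)
  rw [jacobiTheta₂, jacobiTheta₂, ← tsum_mul_left] at h
  have h1 : -Complex.I * (Complex.I * ε / Real.pi) = ((ε / Real.pi : ℝ) : ℂ) := by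
    push_cast
    rw [← mul_div_assoc, ← mul_assoc, neg_mul, Complex.I_mul_I, neg_neg, one_mul]
  have h2 : ((1 / 2 : ℝ) : ℂ) = 1 / 2 := by push_cast; rfl
  have h3 : 1 / (-Complex.I * (Complex.I * ε / Real.pi)) ^ (1 / 2 : ℂ)
      = ((√(Real.pi / ε) : ℝ) : ℂ) := by
    rw [h1, ← h2, ← Complex.ofReal_cpow (by positivity), ← Real.sqrt_eq_rpow,
      ← Complex.ofReal_one, ← Complex.ofReal_div, one_div, ← Real.sqrt_inv, inv_div]
  have hl : ∀ n : ℤ, ((Real.exp (-ε * (n : ℝ) ^ 2) : ℝ) : ℂ) * Complex.exp (Complex.I * u * n)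
      = jacobiTheta₂_term n ((u : ℂ) / (2 * Real.pi)) (Complex.I * ε / Real.pi) := fun n => by
    simp only [jacobiTheta₂_term]
    rw [Complex.ofReal_exp, ← Complex.exp_add]
    congr 1
    push_cast
    field_simp
    ring_nf
    simp only [Complex.I_sq]
    ring
  rw [tsum_congr hl, h]
  refine tsum_congr fun m => ?_
  simp only [jacobiTheta₂_term, heatKernel]
  rw [h3, mul_assoc, ← Complex.exp_add, Complex.ofReal_mul, Complex.ofReal_exp]
  congr 2
  push_cast
  field_simp
  ring_nf

/-- A form of Peetre's inequality: translating by `q` costs at most a quadratic factor in `q`, to be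
absorbed by a Gaussian. -/
theorem inv_one_add_sq_add_le (p q : ℝ) :
    (1 + (p + q) ^ 2)⁻¹ ≤ 2 * (1 + q ^ 2) * (1 + p ^ 2)⁻¹ := by
  rw [← div_eq_mul_inv, inv_eq_one_div, div_le_div_iff₀ (by positivity) (by positivity)]
  nlinarith [sq_nonneg (p + 2 * q), mul_nonneg (sq_nonneg q) (sq_nonneg (p + q))]

variable {M : ℕ}

theorem integrable_prod_inv_one_add_sq :
    Integrable fun u : Fin M → ℝ => ∏ j, (1 + u j ^ 2)⁻¹ := by
  rw [volume_pi]
  exact Integrable.fintype_prod (f := fun _ : Fin M => fun y : ℝ => (1 + y ^ 2)⁻¹)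
    fun _ => integrable_inv_one_add_sq

theorem integrable_of_norm_le_prod {H : (Fin M → ℝ) → ℂ} (hH : Measurable H) {C : ℝ}
    (hC : ∀ u, ‖H u‖ ≤ C * ∏ j, (1 + u j ^ 2)⁻¹) : Integrable H :=
  (integrable_prod_inv_one_add_sq.const_mul C).mono' hH.aestronglyMeasurable
    (Eventually.of_forall hC)

theorem integral_eq_integral_rescaled {E : Type*} [NormedAddCommGroup E] [NormedSpace ℝ E]
    (f : (Fin M → ℝ) → E) (a : Fin M → ℝ) {r : ℝ} (hr : 0 < r) :
    ∫ u, f u = ∫ y, r ^ M • f (a + r • y) := by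
  have h1 := Measure.integral_comp_smul volume (fun y : Fin M → ℝ => f (a + y)) r
  have h2 := integral_add_left_eq_self (μ := volume) f a
  rw [integral_smul, h1, h2, smul_smul, Module.finrank_fin_fun, abs_of_pos (by positivity),
    mul_inv_cancel₀ (by positivity), one_smul]

/-- The Gaussian mean after Poisson summation and rescaling around the lattice point `2πm`. -/
def rescaled (H : (Fin M → ℝ) → ℂ) (ε : ℝ) (m : Fin M → ℤ) (y : Fin M → ℝ) : ℂ :=
  ((∏ j, (2 * √Real.pi * Real.exp (-y j ^ 2)) : ℝ) : ℂ) *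
    H ((fun j => 2 * Real.pi * (m j : ℝ)) + (2 * √ε) • y)

/-- A bound uniform in `ε ≤ 1`, summable in `m` and integrable in `y`, for dominated convergence.
Peetre's factor is at most `2(1 + 4y²) ≤ 16 e^{y²/2}`, which consumes half of the exponent in `2√π
e^{-y²}`; hence `32√π e^{-y²/2}`. -/
theorem norm_rescaled_le {H : (Fin M → ℝ) → ℂ} {C : ℝ} (hC0 : 0 ≤ C)
    (hC : ∀ u, ‖H u‖ ≤ C * ∏ j, (1 + u j ^ 2)⁻¹) {ε : ℝ} (hε : 0 < ε) (hε1 : ε ≤ 1)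
    (m : Fin M → ℤ) (y : Fin M → ℝ) :
    ‖rescaled H ε m y‖ ≤ C * (∏ j, (1 + (m j : ℝ) ^ 2)⁻¹) *
      ∏ j, (32 * √Real.pi * Real.exp (-(1 / 2) * y j ^ 2)) := by
  have h1 : ∀ j, (1 + (2 * Real.pi * (m j : ℝ) + 2 * √ε * y j) ^ 2)⁻¹
      ≤ 16 * Real.exp (1 / 2 * y j ^ 2) * (1 + (m j : ℝ) ^ 2)⁻¹ := fun j => by
    refine (inv_one_add_sq_add_le _ _).trans ?_
    have h2 : (2 * √ε * y j) ^ 2 ≤ 4 * y j ^ 2 := by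
      rw [mul_pow, mul_pow, Real.sq_sqrt hε.le]
      nlinarith [sq_nonneg (y j)]
    have h3 := Real.add_one_le_exp (1 / 2 * y j ^ 2)
    have h4 : (m j : ℝ) ^ 2 ≤ (2 * Real.pi * (m j : ℝ)) ^ 2 := by
      rw [mul_pow]
      have : 1 ≤ (2 * Real.pi) ^ 2 := by nlinarith [Real.pi_gt_three]
      nlinarith [sq_nonneg (m j : ℝ)]
    refine mul_le_mul (by nlinarith) (inv_anti₀ (by positivity) (by linarith)) (by positivity)
      (by positivity)
  rw [rescaled, norm_mul, Complex.norm_real,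
    Real.norm_of_nonneg (Finset.prod_nonneg fun _ _ => by positivity)]
  calc _ ≤ (∏ j, (2 * √Real.pi * Real.exp (-y j ^ 2))) *
        (C * ∏ j, (16 * Real.exp (1 / 2 * y j ^ 2) * (1 + (m j : ℝ) ^ 2)⁻¹)) := by
        refine mul_le_mul_of_nonneg_left ((hC _).trans (mul_le_mul_of_nonneg_left ?_ hC0))
          (Finset.prod_nonneg fun _ _ => by positivity)
        refine Finset.prod_le_prod (fun _ _ => by positivity) fun j _ => ?_
        simpa using h1 j
    _ = _ := by
        rw [mul_left_comm, ← Finset.prod_mul_distrib, mul_assoc, ← Finset.prod_mul_distrib]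
        congr 1
        refine Finset.prod_congr rfl fun j _ => ?_
        have h5 : Real.exp (-(1 / 2) * y j ^ 2)
            = Real.exp (-y j ^ 2) * Real.exp (1 / 2 * y j ^ 2) := by
          rw [← Real.exp_add]
          ring_nf
        rw [h5]
        ring

theorem integrable_prod_gaussian (b a : ℝ) (hb : 0 < b) :
    Integrable fun y : Fin M → ℝ => ∏ j, (a * Real.exp (-b * y j ^ 2)) := by
  rw [volume_pi]
  exact Integrable.fintype_prod (f := fun _ : Fin M => fun y : ℝ => a * Real.exp (-b * y ^ 2))
    fun _ => (integrable_exp_neg_mul_sq hb).const_mul a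

theorem measurable_rescaled {H : (Fin M → ℝ) → ℂ} (hH : Measurable H) (ε : ℝ) (m : Fin M → ℤ) :
    Measurable (rescaled H ε m) := by
  unfold rescaled
  refine Measurable.mul ?_ (hH.comp (by fun_prop))
  fun_prop

theorem summable_integral_norm_rescaled {H : (Fin M → ℝ) → ℂ} {C : ℝ}
    (hC0 : 0 ≤ C) (hC : ∀ u, ‖H u‖ ≤ C * ∏ j, (1 + u j ^ 2)⁻¹) {ε : ℝ} (hε : 0 < ε) (hε1 : ε ≤ 1) :
    Summable fun m => ∫ y, ‖rescaled H ε m y‖ := by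
  have h1 := summable_prod_of_nonneg (M := M) (fun n => (1 + (n : ℝ) ^ 2)⁻¹)
    (fun n => by positivity) summable_inv_one_add_sq
  have h2 := integrable_prod_gaussian (M := M) (1 / 2) (32 * √Real.pi) (by norm_num)
  refine Summable.of_nonneg_of_le (fun m => integral_nonneg fun _ => norm_nonneg _) (fun m => ?_)
    ((h1.mul_left C).mul_right
      (∫ y : Fin M → ℝ, ∏ j, (32 * √Real.pi * Real.exp (-(1 / 2) * y j ^ 2))))
  rw [← integral_const_mul]
  refine integral_mono_of_nonneg (Eventually.of_forall fun _ => norm_nonneg _)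
    (h2.const_mul _) (Eventually.of_forall fun y => ?_)
  exact norm_rescaled_le hC0 hC hε hε1 m y

theorem heatKernel_nonneg (ε : ℝ) (m : ℤ) (u : ℝ) : 0 ≤ heatKernel ε m u := by
  unfold heatKernel
  positivity

theorem heatKernel_le {ε : ℝ} (hε : 0 < ε) (m : ℤ) (u : ℝ) : heatKernel ε m u ≤ √(Real.pi / ε) := by
  refine mul_le_of_le_one_right (Real.sqrt_nonneg _) ?_
  rw [Real.exp_le_one_iff, neg_div]
  exact neg_nonpos.2 (by positivity)

theorem measurable_heatKernel (ε : ℝ) (m : ℤ) : Measurable (heatKernel ε m) := by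
  unfold heatKernel
  fun_prop

theorem summable_heatKernel {ε : ℝ} (hε : 0 < ε) (u : ℝ) :
    Summable fun m : ℤ => heatKernel ε m u := by
  refine Summable.mul_left _ ?_
  refine Summable.of_nonneg_of_le (fun n => (Real.exp_pos _).le) (fun m => ?_)
    ((summable_inv_one_add_sq.mul_left (2 * (1 + u ^ 2))).mul_left (1 + 4 * ε))
  have h4 := inv_one_add_sq_add_le (-(2 * Real.pi * m)) u
  have h5 : (1 + (-(2 * Real.pi * (m : ℝ))) ^ 2)⁻¹ ≤ (1 + (m : ℝ) ^ 2)⁻¹ := by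
    refine inv_anti₀ (by positivity) ?_
    have : 1 ≤ (2 * Real.pi) ^ 2 := by nlinarith [Real.pi_gt_three]
    rw [neg_sq, mul_pow]
    nlinarith [sq_nonneg (m : ℝ)]
  have h6 : Real.exp (-(u - 2 * Real.pi * m) ^ 2 / (4 * ε))
      ≤ (1 + 4 * ε) * (1 + (-(2 * Real.pi * m) + u) ^ 2)⁻¹ := by
    have h7 : -(2 * Real.pi * (m : ℝ)) + u = u - 2 * Real.pi * m := by ring
    rw [neg_div, Real.exp_neg, ← div_eq_mul_inv, inv_eq_one_div,
      div_le_div_iff₀ (Real.exp_pos _) (by positivity), h7]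
    set w := (u - 2 * Real.pi * (m : ℝ)) ^ 2 with hw
    have hw0 : 0 ≤ w := sq_nonneg _
    have h3 := Real.add_one_le_exp (w / (4 * ε))
    calc 1 * (1 + w) ≤ (1 + 4 * ε) * (w / (4 * ε) + 1) := by
          have h8 : (1 + 4 * ε) * (w / (4 * ε) + 1) = 1 + w + w / (4 * ε) + 4 * ε := by
            field_simp
            ring
          rw [h8]
          have : 0 ≤ w / (4 * ε) := by positivity
          linarith
      _ ≤ _ := mul_le_mul_of_nonneg_left h3 (by positivity)
  refine h6.trans (mul_le_mul_of_nonneg_left ?_ (by positivity))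
  exact h4.trans (mul_le_mul_of_nonneg_left h5 (by positivity))

theorem exp_neg_mul_sum_sq (ε : ℝ) (n : Fin M → ℤ) :
    Real.exp (-ε * ∑ j, (n j : ℝ) ^ 2) = ∏ j, Real.exp (-ε * (n j : ℝ) ^ 2) := by
  rw [← Real.exp_sum, Finset.mul_sum]

theorem summable_exp_neg_mul_sum_sq {ε : ℝ} (hε : 0 < ε) :
    Summable fun n : Fin M → ℤ => Real.exp (-ε * ∑ j, (n j : ℝ) ^ 2) := by
  refine (summable_prod_of_nonneg (M := M) (fun n : ℤ => Real.exp (-ε * (n : ℝ) ^ 2))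
    (fun n => (Real.exp_pos _).le) (summable_exp_neg_mul_sq hε)).congr fun n => ?_
  exact (exp_neg_mul_sum_sq ε n).symm

theorem norm_prod_exp_I_mul (u : Fin M → ℝ) (n : Fin M → ℤ) :
    ‖∏ j, Complex.exp (Complex.I * u j * n j)‖ = 1 := by
  rw [norm_prod]
  refine Finset.prod_eq_one fun j _ => ?_
  rw [Complex.norm_exp]
  simp

theorem tsum_gaussian_mul_prod_exp {ε : ℝ} (hε : 0 < ε) (u : Fin M → ℝ) :
    ∑' n : Fin M → ℤ, ((Real.exp (-ε * ∑ j, (n j : ℝ) ^ 2) : ℝ) : ℂ) *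
        ∏ j, Complex.exp (Complex.I * u j * n j)
      = ∑' m : Fin M → ℤ, ∏ j, ((heatKernel ε (m j) (u j) : ℝ) : ℂ) := by
  have h2 := (summable_and_hasSum_prod (M := M) (fun j m => ((heatKernel ε m (u j) : ℝ) : ℂ))
    fun j => (summable_heatKernel hε (u j)).congr fun m => by
      rw [Complex.norm_real, Real.norm_of_nonneg (heatKernel_nonneg _ _ _)]).2
  have h3 := (summable_and_hasSum_prod (M := M) (fun j n =>
    ((Real.exp (-ε * (n : ℝ) ^ 2) : ℝ) : ℂ) * Complex.exp (Complex.I * u j * n)) fun j => by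
      refine (summable_exp_neg_mul_sq hε).congr fun n => ?_
      rw [norm_mul, Complex.norm_real, Real.norm_of_nonneg (Real.exp_pos _).le, Complex.norm_exp]
      simp).2
  rw [h2.tsum_eq, ← Finset.prod_congr rfl fun j _ => tsum_gaussian_mul_exp hε (u j),
    ← h3.tsum_eq]
  refine tsum_congr fun n => ?_
  rw [Finset.prod_mul_distrib, exp_neg_mul_sum_sq, Complex.ofReal_prod]

theorem smul_heatKernel_mul_eq_rescaled (H : (Fin M → ℝ) → ℂ) {ε : ℝ} (hε : 0 < ε)
    (m : Fin M → ℤ) (y : Fin M → ℝ) :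
    ((2 * √ε) ^ M : ℝ) • ((∏ j, ((heatKernel ε (m j)
        (((fun j => 2 * Real.pi * (m j : ℝ)) + (2 * √ε) • y) j) : ℝ) : ℂ)) *
        H ((fun j => 2 * Real.pi * (m j : ℝ)) + (2 * √ε) • y))
      = rescaled H ε m y := by
  rw [rescaled, Complex.real_smul, ← mul_assoc]
  congr 1
  have h2 : (2 * √ε) ^ M = ∏ _j : Fin M, (2 * √ε) := by simp
  rw [← Complex.ofReal_prod, ← Complex.ofReal_mul, h2, ← Finset.prod_mul_distrib]
  congr 1
  refine Finset.prod_congr rfl fun j _ => ?_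
  have hs : √ε ≠ 0 := (Real.sqrt_pos.2 hε).ne'
  rw [heatKernel, ← mul_assoc]
  congr 1
  · rw [Real.sqrt_div Real.pi_pos.le]
    field_simp
  · congr 1
    simp only [Pi.add_apply, Pi.smul_apply, smul_eq_mul, add_sub_cancel_left, mul_pow,
      Real.sq_sqrt hε.le]
    field_simp
    ring

/-- Each heat kernel has width of order `√ε`; centring at `2πm` and scaling by `2√ε` gives
`rescaled`, whose norm integrals are summable in `m`, so sum and integral may be exchanged. -/
theorem hasSum_integral_heatKernel_mul {H : (Fin M → ℝ) → ℂ} (hH : Measurable H) {C : ℝ}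
    (hC0 : 0 ≤ C) (hC : ∀ u, ‖H u‖ ≤ C * ∏ j, (1 + u j ^ 2)⁻¹) {ε : ℝ} (hε : 0 < ε) (hε1 : ε ≤ 1) :
    HasSum (fun m : Fin M → ℤ => ∫ y, rescaled H ε m y)
      (∫ u, ∑' m : Fin M → ℤ, (∏ j, ((heatKernel ε (m j) (u j) : ℝ) : ℂ)) * H u) := by
  have hHi := integrable_of_norm_le_prod hH hC
  set G : (Fin M → ℤ) → (Fin M → ℝ) → ℂ := fun m u =>
    (∏ j, ((heatKernel ε (m j) (u j) : ℝ) : ℂ)) * H u with hG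
  have hGm : ∀ m, Measurable (G m) := fun m => by
    refine Measurable.mul (Finset.measurable_prod _ fun j _ => ?_) hH
    exact Complex.measurable_ofReal.comp
      ((measurable_heatKernel ε (m j)).comp (measurable_pi_apply j))
  have hGint : ∀ m, Integrable (G m) := fun m => by
    refine (hHi.norm.const_mul (∏ _j : Fin M, √(Real.pi / ε))).mono'
      (hGm m).aestronglyMeasurable (Eventually.of_forall fun u => ?_)
    rw [norm_mul, norm_prod]
    refine mul_le_mul_of_nonneg_right (Finset.prod_le_prod (fun _ _ => norm_nonneg _) fun j _ => ?_)
      (norm_nonneg _)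
    rw [Complex.norm_real, Real.norm_of_nonneg (heatKernel_nonneg _ _ _)]
    exact heatKernel_le hε _ _
  have hr : 0 < 2 * √ε := by positivity
  have hGeq : ∀ m, ∫ u, G m u = ∫ y, rescaled H ε m y := fun m => by
    rw [integral_eq_integral_rescaled (G m) (fun j => 2 * Real.pi * (m j : ℝ)) hr]
    exact integral_congr_ae (Eventually.of_forall fun y =>
      smul_heatKernel_mul_eq_rescaled H hε m y)
  have hGnorm : ∀ m, ∫ u, ‖G m u‖ = ∫ y, ‖rescaled H ε m y‖ := fun m => by
    rw [integral_eq_integral_rescaled (fun u => ‖G m u‖) (fun j => 2 * Real.pi * (m j : ℝ)) hr]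
    refine integral_congr_ae (Eventually.of_forall fun y => ?_)
    have h := congrArg norm (smul_heatKernel_mul_eq_rescaled H hε m y)
    rw [norm_smul, Real.norm_of_nonneg (by positivity)] at h
    exact h
  have h5 := hasSum_integral_of_summable_integral_norm hGint (by
    simp only [hGnorm]
    exact summable_integral_norm_rescaled hC0 hC hε hε1)
  simpa only [hGeq] using h5

theorem hasSum_integral_gaussian_mul {H : (Fin M → ℝ) → ℂ} (hH : Measurable H) {C : ℝ}
    (hC : ∀ u, ‖H u‖ ≤ C * ∏ j, (1 + u j ^ 2)⁻¹) {ε : ℝ} (hε : 0 < ε) :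
    HasSum (fun n : Fin M → ℤ => ((Real.exp (-ε * ∑ j, (n j : ℝ) ^ 2) : ℝ) : ℂ) *
        ∫ u, H u * ∏ j, Complex.exp (Complex.I * u j * n j))
      (∫ u, ∑' n : Fin M → ℤ, (((Real.exp (-ε * ∑ j, (n j : ℝ) ^ 2) : ℝ) : ℂ) *
        ∏ j, Complex.exp (Complex.I * u j * n j)) * H u) := by
  have hHi := integrable_of_norm_le_prod hH hC
  set F : (Fin M → ℤ) → (Fin M → ℝ) → ℂ := fun n u =>
    (((Real.exp (-ε * ∑ j, (n j : ℝ) ^ 2) : ℝ) : ℂ) *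
      ∏ j, Complex.exp (Complex.I * u j * n j)) * H u with hF
  have hFn : ∀ n u, ‖F n u‖ = Real.exp (-ε * ∑ j, (n j : ℝ) ^ 2) * ‖H u‖ := fun n u => by
    rw [hF]
    dsimp only
    rw [norm_mul, norm_mul, norm_prod_exp_I_mul, mul_one, Complex.norm_real,
      Real.norm_of_nonneg (Real.exp_pos _).le]
  have hFm : ∀ n, Measurable (F n) := fun n => by
    refine (measurable_const.mul ?_).mul hH
    fun_prop
  have hFint : ∀ n, Integrable (F n) := fun n =>
    (hHi.norm.const_mul (Real.exp (-ε * ∑ j, (n j : ℝ) ^ 2))).mono'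
      (hFm n).aestronglyMeasurable (Eventually.of_forall fun u => (hFn n u).le)
  have hFsum : Summable fun n => ∫ u, ‖F n u‖ := by
    simp only [hFn, integral_const_mul]
    exact (summable_exp_neg_mul_sum_sq hε).mul_right _
  have h1 := hasSum_integral_of_summable_integral_norm hFint hFsum
  refine h1.congr_fun fun n => ?_
  rw [← integral_const_mul]
  refine integral_congr_ae (Eventually.of_forall fun u => ?_)
  simp only [hF]
  ring

/-- Poisson summation for Gaussian means of Fourier coefficients. -/
theorem tsum_gaussian_mul_integral {H : (Fin M → ℝ) → ℂ} (hH : Measurable H) {C : ℝ}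
    (hC0 : 0 ≤ C) (hC : ∀ u, ‖H u‖ ≤ C * ∏ j, (1 + u j ^ 2)⁻¹) {ε : ℝ} (hε : 0 < ε) (hε1 : ε ≤ 1) :
    ∑' n : Fin M → ℤ, ((Real.exp (-ε * ∑ j, (n j : ℝ) ^ 2) : ℝ) : ℂ) *
        ∫ u, H u * ∏ j, Complex.exp (Complex.I * u j * n j)
      = ∑' m : Fin M → ℤ, ∫ y, rescaled H ε m y := by
  rw [(hasSum_integral_gaussian_mul hH hC hε).tsum_eq,
    (hasSum_integral_heatKernel_mul hH hC0 hC hε hε1).tsum_eq]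
  refine integral_congr_ae (Eventually.of_forall fun u => ?_)
  dsimp only
  rw [tsum_mul_right, tsum_mul_right, tsum_gaussian_mul_prod_exp hε]

/-- As `ε → 0` the Gaussian means concentrate on the lattice `(2πℤ)^M`. -/
theorem tendsto_tsum_gaussian_mul_integral {H : (Fin M → ℝ) → ℂ} (hH : Measurable H) {C : ℝ}
    (hC0 : 0 ≤ C) (hC : ∀ u, ‖H u‖ ≤ C * ∏ j, (1 + u j ^ 2)⁻¹)
    (hcont : ∀ m : Fin M → ℤ, ContinuousAt H fun j => 2 * Real.pi * (m j : ℝ)) :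
    Tendsto (fun ε : ℝ => ∑' n : Fin M → ℤ, ((Real.exp (-ε * ∑ j, (n j : ℝ) ^ 2) : ℝ) : ℂ) *
        ∫ u, H u * ∏ j, Complex.exp (Complex.I * u j * n j)) (𝓝[>] 0)
      (𝓝 (∑' m : Fin M → ℤ, (2 * Real.pi : ℂ) ^ M * H fun j => 2 * Real.pi * (m j : ℝ))) := by
  have hsmall : ∀ᶠ ε in 𝓝[>] (0 : ℝ), 0 < ε ∧ ε ≤ 1 := by
    filter_upwards [Ioo_mem_nhdsGT (zero_lt_one (α := ℝ))] with ε hε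
    exact ⟨hε.1, hε.2.le⟩
  have h1 : (fun ε : ℝ => ∑' m : Fin M → ℤ, ∫ y, rescaled H ε m y) =ᶠ[𝓝[>] 0]
      fun ε : ℝ => ∑' n : Fin M → ℤ, ((Real.exp (-ε * ∑ j, (n j : ℝ) ^ 2) : ℝ) : ℂ) *
        ∫ u, H u * ∏ j, Complex.exp (Complex.I * u j * n j) := by
    filter_upwards [hsmall] with ε hε
    exact (tsum_gaussian_mul_integral hH hC0 hC hε.1 hε.2).symm
  refine Tendsto.congr' h1 ?_
  set B := ∫ y : Fin M → ℝ, ∏ j, (32 * √Real.pi * Real.exp (-(1 / 2) * y j ^ 2)) with hB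
  have hBi := integrable_prod_gaussian (M := M) (1 / 2) (32 * √Real.pi) (by norm_num)
  refine tendsto_tsum_of_dominated_convergence
    (bound := fun m : Fin M → ℤ => C * (∏ j, (1 + (m j : ℝ) ^ 2)⁻¹) * B) ?_ ?_ ?_
  · exact ((summable_prod_of_nonneg (M := M) (fun n => (1 + (n : ℝ) ^ 2)⁻¹)
      (fun n => by positivity) summable_inv_one_add_sq).mul_left C).mul_right B
  · intro m
    have hlim : (2 * Real.pi : ℂ) ^ M * H (fun j => 2 * Real.pi * (m j : ℝ))
        = ∫ y : Fin M → ℝ, ((∏ j, (2 * √Real.pi * Real.exp (-y j ^ 2)) : ℝ) : ℂ) *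
          H (fun j => 2 * Real.pi * (m j : ℝ)) := by
      -- Each coordinate contributes `2√π · √π`, which is the weight `2π` of the Poisson formula.
      have h2 : ∫ y : Fin M → ℝ, ∏ j, (2 * √Real.pi * Real.exp (-y j ^ 2)) = (2 * Real.pi) ^ M := by
        rw [integral_fintype_prod_volume_eq_pow fun y : ℝ => 2 * √Real.pi * Real.exp (-y ^ 2)]
        have h3 := integral_gaussian 1
        simp only [neg_mul, one_mul, div_one] at h3
        rw [integral_const_mul, h3, mul_assoc, Real.mul_self_sqrt Real.pi_pos.le, Fintype.card_fin]
      rw [integral_mul_const, integral_complex_ofReal, h2]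
      push_cast
      rfl
    rw [hlim]
    refine tendsto_integral_filter_of_dominated_convergence
      (fun y => C * (∏ j, (1 + (m j : ℝ) ^ 2)⁻¹) *
        ∏ j, (32 * √Real.pi * Real.exp (-(1 / 2) * y j ^ 2))) ?_ ?_ ?_ ?_
    · exact Eventually.of_forall fun ε => (measurable_rescaled hH ε m).aestronglyMeasurable
    · filter_upwards [hsmall] with ε hε
      exact Eventually.of_forall fun y => norm_rescaled_le hC0 hC hε.1 hε.2 m y
    · exact hBi.const_mul _
    · refine Eventually.of_forall fun y => ?_
      refine Tendsto.const_mul _ ((hcont m).tendsto.comp ?_)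
      have h3 : Tendsto (fun ε : ℝ => (fun j => 2 * Real.pi * (m j : ℝ)) + (2 * √ε) • y) (𝓝 0)
          (𝓝 ((fun j => 2 * Real.pi * (m j : ℝ)) + (2 * √(0 : ℝ)) • y)) :=
        Continuous.tendsto (by fun_prop) 0
      rw [Real.sqrt_zero, mul_zero, zero_smul, add_zero] at h3
      exact h3.mono_left nhdsWithin_le_nhds
  · filter_upwards [hsmall] with ε hε m
    rw [hB, ← integral_const_mul]
    exact norm_integral_le_of_norm_le (hBi.const_mul _)
      (Eventually.of_forall fun y => norm_rescaled_le hC0 hC hε.1 hε.2 m y)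

end Poisson

/-! ### Regularised sums of integrals -/

section Regularised

open MeasureTheory

variable {N : ℕ} {c L : ℝ}

/-- The square root of the factor of `poleCutoff` that belongs to the rapidity `y`. -/
def cutoffRoot (δ : ℝ) (μ : Fin N → ℝ) (y : ℝ) : ℝ :=
  √(∏ k, ((y - μ k) ^ 2 / ((y - μ k) ^ 2 + δ ^ 2)))

theorem poleCutoff_eq_prod_sq (δ : ℝ) (μ : Fin N → ℝ) (l : Fin (N + 1) → ℝ) :
    poleCutoff δ μ l = ∏ j, cutoffRoot δ μ (l j) ^ 2 :=
  Finset.prod_congr rfl fun j _ =>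
    (Real.sq_sqrt (Finset.prod_nonneg fun k _ => by positivity)).symm

theorem cutoff_factor_le_one (δ y : ℝ) : y ^ 2 / (y ^ 2 + δ ^ 2) ≤ 1 :=
  div_le_one_of_le₀ (by nlinarith [sq_nonneg δ]) (by positivity)

theorem cutoffRoot_le_one (δ : ℝ) (μ : Fin N → ℝ) (y : ℝ) : cutoffRoot δ μ y ≤ 1 :=
  Real.sqrt_le_one.2
    (Finset.prod_le_one (fun _ _ => by positivity) fun _ _ => cutoff_factor_le_one δ _)

theorem cutoffRoot_le {δ : ℝ} (hδ : 0 < δ) (μ : Fin N → ℝ) (y : ℝ) (k : Fin N) :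
    cutoffRoot δ μ y ≤ |y - μ k| / δ := by
  refine Real.sqrt_le_iff.2 ⟨by positivity, ?_⟩
  rw [← Finset.mul_prod_erase _ _ (Finset.mem_univ k)]
  refine (mul_le_of_le_one_right (by positivity)
    (Finset.prod_le_one (fun _ _ => by positivity) fun _ _ => cutoff_factor_le_one δ _)).trans ?_
  rw [div_pow, sq_abs]
  gcongr
  nlinarith [sq_nonneg (y - μ k)]

theorem cutoffRoot_div_le {δ : ℝ} (hδ : 0 < δ) (μ : Fin N → ℝ) (y : ℝ) (k : Fin N) :
    cutoffRoot δ μ y / |y - μ k| ≤ 1 / δ := by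
  rcases (abs_nonneg (y - μ k)).eq_or_lt with h | h
  · rw [← h, div_zero]
    positivity
  · rw [div_le_div_iff₀ h hδ, one_mul, ← le_div_iff₀ hδ]
    exact cutoffRoot_le hδ μ y k

theorem poleCutoff_nonneg (δ : ℝ) (μ : Fin N → ℝ) (l : Fin (N + 1) → ℝ) : 0 ≤ poleCutoff δ μ l :=
  Finset.prod_nonneg fun _ _ => Finset.prod_nonneg fun _ _ => by positivity

theorem poleCutoff_le_one (δ : ℝ) (μ : Fin N → ℝ) (l : Fin (N + 1) → ℝ) : poleCutoff δ μ l ≤ 1 :=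
  Finset.prod_le_one (fun _ _ => Finset.prod_nonneg fun _ _ => by positivity) fun _ _ =>
    Finset.prod_le_one (fun _ _ => by positivity) fun _ _ => cutoff_factor_le_one δ _

theorem continuous_poleCutoff {δ : ℝ} (hδ : 0 < δ) (μ : Fin N → ℝ) :
    Continuous (poleCutoff δ μ) := by
  unfold poleCutoff
  refine continuous_finsetProd _ fun j _ => continuous_finsetProd _ fun k _ => ?_
  refine Continuous.div (by fun_prop) (by fun_prop) fun l => ?_
  positivity

theorem tendsto_poleCutoff {μ : Fin N → ℝ} {l : Fin (N + 1) → ℝ} (hl : ∀ j k, l j ≠ μ k) :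
    Tendsto (fun δ : ℝ => poleCutoff δ μ l) (𝓝[>] 0) (𝓝 1) := by
  have h : Tendsto (fun δ : ℝ => poleCutoff δ μ l) (𝓝 0) (𝓝 (poleCutoff 0 μ l)) := by
    unfold poleCutoff
    refine tendsto_finsetProd _ fun j _ => tendsto_finsetProd _ fun k _ => ?_
    have h1 : (l j - μ k) ^ 2 + (0 : ℝ) ^ 2 ≠ 0 := by
      have := sub_ne_zero.2 (hl j k)
      positivity
    refine tendsto_const_nhds.div ?_ h1
    exact Continuous.tendsto (by fun_prop) 0
  have h0 : poleCutoff 0 μ l = 1 := by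
    refine Finset.prod_eq_one fun j _ => Finset.prod_eq_one fun k _ => ?_
    have := sub_ne_zero.2 (hl j k)
    rw [zero_pow two_ne_zero, add_zero, div_self (by positivity)]
  rw [h0] at h
  exact h.mono_left nhdsWithin_le_nhds

/-- The function `∏ S_jj · det [S | 1]` has at most two simple poles per rapidity, one from each
factor. Writing the cut-off as a square assigns one `cutoffRoot` to each, and this vanishes linearly
at every `μ_k`. -/
theorem poleCutoff_mul_norm_vevFactor_le (hc : 0 < c) (x : ℝ) {t : ℂ} (ht : 0 < t.im)
    (μ : Fin N → ℝ) {δ : ℝ} (hδ : 0 < δ) :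
    ∃ C : ℝ, 0 < C ∧ ∀ l : Fin (N + 1) → ℝ,
      poleCutoff δ μ l * ‖vevFactor c x t μ l‖ ≤ C * ∏ i, (1 + l i ^ 2)⁻¹ := by
  have hB := hBound_nonneg (c := c) μ
  obtain ⟨C, hC0, hC⟩ := prod_sq_mul_norm_vevFactor_le hc x ht μ (1 + 2 * c * hBound c μ / δ)
  refine ⟨C, hC0, fun l => ?_⟩
  rw [poleCutoff_eq_prod_sq]
  have hK : 0 ≤ 2 * c * hBound c μ / δ := by positivity
  refine hC l (fun i => cutoffRoot δ μ (l i)) (fun i => Real.sqrt_nonneg _) (fun i => ?_)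
    fun i k => ?_
  · refine (cutoffRoot_le_one δ μ (l i)).trans ?_
    have h1 : 1 ≤ Real.exp (N / c * |l i|) := Real.one_le_exp (by positivity)
    nlinarith
  · calc cutoffRoot δ μ (l i) * ‖Smat c μ l i k‖
        ≤ cutoffRoot δ μ (l i) *
          (2 * c * hBound c μ * Real.exp (N / c * |l i|) / |l i - μ k|) :=
          mul_le_mul_of_nonneg_left (norm_Smat_le hc μ l i k) (Real.sqrt_nonneg _)
      _ = (2 * c * hBound c μ * Real.exp (N / c * |l i|)) *
          (cutoffRoot δ μ (l i) / |l i - μ k|) := by ring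
      _ ≤ (2 * c * hBound c μ * Real.exp (N / c * |l i|)) * (1 / δ) :=
          mul_le_mul_of_nonneg_left (cutoffRoot_div_le hδ μ _ k) (by positivity)
      _ = 2 * c * hBound c μ / δ * Real.exp (N / c * |l i|) := by ring
      _ ≤ _ := mul_le_mul_of_nonneg_right (by linarith) (Real.exp_pos _).le

theorem norm_vevFactor_betheRoots_le (hN : Even N) (hc : 0 < c) (hL : 0 < L) (x : ℝ) {t : ℂ}
    (ht : 0 < t.im) {μ : Fin N → ℝ} (hμ : IsGroundState c L μ) :
    ∃ C : ℝ, 0 < C ∧ ∀ n, ‖vevFactor c x t μ (betheRoots hc hL n)‖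
      ≤ C * ∏ i, (1 + betheRoots hc hL n i ^ 2)⁻¹ := by
  have hB := hBound_nonneg (c := c) μ
  set A := (c * (L + N * (2 / c)) + 2) * hBound c μ with hA
  have hA0 : 0 ≤ A := by positivity
  obtain ⟨C, hC0, hC⟩ := prod_sq_mul_norm_vevFactor_le hc x ht μ (1 + A)
  refine ⟨C, hC0, fun n => ?_⟩
  have h := hC (betheRoots hc hL n) (fun _ => 1) (fun _ => zero_le_one) (fun i => ?_) fun i k => ?_
  · simpa only [one_pow, Finset.prod_const_one, one_mul] using h
  · have h1 : 1 ≤ Real.exp (N / c * |betheRoots hc hL n i|) := Real.one_le_exp (by positivity)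
    nlinarith
  · rw [one_mul]
    exact (norm_Smat_betheRoots_le hN hc hL hμ n i k).trans
      (mul_le_mul_of_nonneg_right (by linarith) (Real.exp_pos _).le)

/-- Since `φ̃_j` differs from `L l_j` by at most `Mπ`, decay in `l` transfers to decay in `u =
φ̃(l)`. -/
theorem exists_prod_inv_one_add_sq_le (c : ℝ) (hL : 0 < L) (M : ℕ) : ∃ A : ℝ, 0 < A ∧
    ∀ l : Fin M → ℝ, ∏ j, (1 + l j ^ 2)⁻¹ ≤ A * ∏ j, (1 + bethe c L l j ^ 2)⁻¹ := by
  set B := 1 + 2 * L ^ 2 + 2 * (M * Real.pi) ^ 2 with hB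
  have hB0 : 0 < B := by positivity
  refine ⟨B ^ M, by positivity, fun l => ?_⟩
  have h1 : B ^ M = ∏ _j : Fin M, B := by simp
  rw [h1, ← Finset.prod_mul_distrib]
  refine Finset.prod_le_prod (fun _ _ => by positivity) fun j _ => ?_
  rw [← div_eq_mul_inv, inv_eq_one_div, div_le_div_iff₀ (by positivity) (by positivity), one_mul]
  have h2 := sq_le_sq' (abs_le.1 (abs_bethe_sub_le (c := c) (L := L) l j)).1
    (abs_le.1 (abs_bethe_sub_le (c := c) (L := L) l j)).2
  set W := (M * Real.pi) ^ 2 with hW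
  have hW0 : 0 ≤ W := by positivity
  have h3 : bethe c L l j ^ 2 ≤ 2 * (L ^ 2 * l j ^ 2) + 2 * (bethe c L l j - L * l j) ^ 2 := by
    nlinarith [sq_nonneg (bethe c L l j - 2 * (L * l j))]
  have h4 : 0 ≤ W * l j ^ 2 := by positivity
  nlinarith [sq_nonneg L, sq_nonneg (l j)]

theorem integral_eq_integral_bethe {M : ℕ} (hc : 0 < c) (hL : 0 < L) (g : (Fin M → ℝ) → ℂ) :
    ∫ u, g u = ∫ l, ((gaudin c L l).det : ℂ) * g (bethe c L l) := by
  have h := integral_image_eq_integral_abs_det_fderiv_smul (μ := volume) MeasurableSet.univ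
    (fun l _ => (hasStrictFDerivAt_bethe (L := L) hc l).hasFDerivAt.hasFDerivWithinAt)
    (bethe_injective (M := M) hc hL).injOn g
  rw [Set.image_univ, (bethe_surjective hc hL).range_eq, Measure.restrict_univ] at h
  rw [h]
  refine integral_congr_ae (Eventually.of_forall fun l => ?_)
  have h1 : (LinearMap.toContinuousLinearMap (Matrix.toLin' (gaudin c L l))).det
      = (gaudin c L l).det := LinearMap.det_toLin' _
  dsimp only
  rw [h1, abs_of_pos (det_gaudin_pos hc hL l), Complex.real_smul]

theorem continuous_det_gaudin {M : ℕ} (hc : 0 < c) :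
    Continuous fun l : Fin M → ℝ => (gaudin c L l).det := by
  refine Continuous.matrix_det (continuous_matrix fun j k => ?_)
  have hK : ∀ j k : Fin M, Continuous fun l : Fin M → ℝ => Kfun c (l j) (l k) := fun j k => by
    unfold Kfun
    refine Continuous.div (by fun_prop) (by fun_prop) fun l => ?_
    positivity
  simp only [gaudin, Matrix.of_apply]
  refine Continuous.sub ?_ (hK j k)
  split_ifs
  · exact continuous_const.add (continuous_finsetSum _ fun i _ => hK j i)
  · exact continuous_const

/-- The plane wave and the scattering factors combine into the character `e^{i n_j φ̃_j(l)}`, which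
makes the integrals Fourier coefficients in `u = φ̃(l)`. -/
theorem exp_mul_prod_zpow_eq (hc : 0 < c) (n : Fin (N + 1) → ℤ) (l : Fin (N + 1) → ℝ)
    (j : Fin (N + 1)) :
    Complex.exp (Complex.I * L * l j * n j) *
        (∏ k, hfun c (l k) (l j) / hfun c (l j) (l k)) ^ (n j)
      = Complex.exp (Complex.I * bethe c L l j * n j) := by
  rw [← exp_phiValue hc, ← Complex.exp_int_mul, ← Complex.exp_add, phiValue_eq hc, bethe, counting]
  congr 1
  push_cast
  ring

/-- The part of the regularised integrand that does not depend on `n`. -/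
def cutoffDensity (c L hch x : ℝ) (t : ℂ) (μ : Fin N → ℝ) (δ : ℝ) (l : Fin (N + 1) → ℝ) : ℂ :=
  (poleCutoff δ μ l : ℂ) *
    (prefactor c L hch t μ * (1 / (2 * Real.pi : ℂ) ^ (N + 1)) * vevFactor c x t μ l)

theorem poleCutoff_mul_correlatorIntegrand (hc : 0 < c) (hch x : ℝ) (t : ℂ) (μ : Fin N → ℝ)
    (δ : ℝ) (n : Fin (N + 1) → ℤ) (l : Fin (N + 1) → ℝ) :
    (poleCutoff δ μ l : ℂ) * correlatorIntegrand c L hch x t μ n l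
      = cutoffDensity c L hch x t μ δ l *
        ∏ j, Complex.exp (Complex.I * bethe c L l j * n j) := by
  rw [correlatorIntegrand_eq, Finset.prod_congr rfl fun j _ => exp_mul_prod_zpow_eq hc n l j,
    cutoffDensity]
  ring

theorem measurable_cutoffDensity (hch x : ℝ) (t : ℂ) (μ : Fin N → ℝ) {δ : ℝ} (hδ : 0 < δ) :
    Measurable (cutoffDensity c L hch x t μ δ) :=
  (Complex.measurable_ofReal.comp (continuous_poleCutoff hδ μ).measurable).mul
    ((measurable_vevFactor x t μ).const_mul _)

theorem norm_cutoffDensity_le (hc : 0 < c) (L hch x : ℝ) {t : ℂ} (ht : 0 < t.im) (μ : Fin N → ℝ)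
    {δ : ℝ} (hδ : 0 < δ) : ∃ C : ℝ, 0 ≤ C ∧ ∀ l : Fin (N + 1) → ℝ,
      ‖cutoffDensity c L hch x t μ δ l‖ ≤ C * ∏ i, (1 + l i ^ 2)⁻¹ := by
  obtain ⟨C, hC0, hC⟩ := poleCutoff_mul_norm_vevFactor_le hc x ht μ hδ
  set P := prefactor c L hch t μ * (1 / (2 * Real.pi : ℂ) ^ (N + 1)) with hP
  refine ⟨‖P‖ * C, by positivity, fun l => ?_⟩
  rw [cutoffDensity, ← hP, norm_mul, norm_mul, Complex.norm_real,
    Real.norm_of_nonneg (poleCutoff_nonneg δ μ l)]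
  calc _ = ‖P‖ * (poleCutoff δ μ l * ‖vevFactor c x t μ l‖) := by ring
    _ ≤ ‖P‖ * (C * ∏ i, (1 + l i ^ 2)⁻¹) := mul_le_mul_of_nonneg_left (hC l) (norm_nonneg _)
    _ = _ := by ring

theorem integrable_poleCutoff_mul_correlatorIntegrand (hc : 0 < c) (hch x : ℝ) {t : ℂ}
    (ht : 0 < t.im) (μ : Fin N → ℝ) {δ : ℝ} (hδ : 0 < δ) (n : Fin (N + 1) → ℤ) :
    Integrable fun l => (poleCutoff δ μ l : ℂ) * correlatorIntegrand c L hch x t μ n l := by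
  obtain ⟨C, -, hC⟩ := norm_cutoffDensity_le hc L hch x ht μ hδ
  simp only [poleCutoff_mul_correlatorIntegrand hc]
  refine integrable_of_norm_le_prod (C := C) ?_ fun l => ?_
  · refine (measurable_cutoffDensity hch x t μ hδ).mul (Continuous.measurable ?_)
    refine continuous_finsetProd _ fun j _ => ?_
    have := (continuous_apply j).comp (continuous_bethe (c := c) (L := L) (M := N + 1))
    simp only [Function.comp_def] at this
    fun_prop
  · rw [norm_mul, norm_prod_exp_I_mul, mul_one]
    exact hC l

/-- The density in the variables `u = bethe l`. -/
def betheDensity (hc : 0 < c) (hL : 0 < L) (hch x : ℝ) (t : ℂ) (μ : Fin N → ℝ) (δ : ℝ)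
    (u : Fin (N + 1) → ℝ) : ℂ :=
  cutoffDensity c L hch x t μ δ ((betheHomeomorph hc hL).symm u) /
    ((gaudin c L ((betheHomeomorph hc hL).symm u)).det : ℂ)

theorem integral_poleCutoff_mul_correlatorIntegrand (hc : 0 < c) (hL : 0 < L) (hch x : ℝ) (t : ℂ)
    (μ : Fin N → ℝ) (δ : ℝ) (n : Fin (N + 1) → ℤ) :
    ∫ l, (poleCutoff δ μ l : ℂ) * correlatorIntegrand c L hch x t μ n l
      = ∫ u, betheDensity hc hL hch x t μ δ u * ∏ j, Complex.exp (Complex.I * u j * n j) := by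
  rw [integral_eq_integral_bethe hc hL fun u => betheDensity hc hL hch x t μ δ u *
    ∏ j, Complex.exp (Complex.I * u j * n j)]
  refine integral_congr_ae (Eventually.of_forall fun l => ?_)
  have h1 : (betheHomeomorph hc hL).symm (bethe c L l) = l :=
    (betheHomeomorph hc hL).symm_apply_apply l
  have h2 : ((gaudin c L l).det : ℂ) ≠ 0 := by exact_mod_cast (det_gaudin_pos hc hL l).ne'
  dsimp only
  rw [poleCutoff_mul_correlatorIntegrand hc, betheDensity, h1, ← mul_assoc, mul_div_cancel₀ _ h2]

theorem measurable_betheDensity (hc : 0 < c) (hL : 0 < L) (hch x : ℝ) (t : ℂ) (μ : Fin N → ℝ)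
    {δ : ℝ} (hδ : 0 < δ) : Measurable (betheDensity hc hL hch x t μ δ) := by
  have h := (betheHomeomorph (M := N + 1) hc hL).symm.continuous.measurable
  exact ((measurable_cutoffDensity hch x t μ hδ).comp h).div
    (Complex.measurable_ofReal.comp ((continuous_det_gaudin hc).measurable.comp h))

theorem norm_betheDensity_le (hc : 0 < c) (hL : 0 < L) (hch x : ℝ) {t : ℂ} (ht : 0 < t.im)
    (μ : Fin N → ℝ) {δ : ℝ} (hδ : 0 < δ) : ∃ C : ℝ, 0 ≤ C ∧ ∀ u : Fin (N + 1) → ℝ,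
      ‖betheDensity hc hL hch x t μ δ u‖ ≤ C * ∏ i, (1 + u i ^ 2)⁻¹ := by
  obtain ⟨C, hC0, hC⟩ := norm_cutoffDensity_le hc L hch x ht μ hδ
  obtain ⟨A, hA0, hA⟩ := exists_prod_inv_one_add_sq_le c hL (N + 1)
  refine ⟨C * A / L ^ (N + 1), by positivity, fun u => ?_⟩
  set l := (betheHomeomorph hc hL).symm u with hl
  have hu : bethe c L l = u := (betheHomeomorph hc hL).apply_symm_apply u
  rw [betheDensity, ← hl, norm_div, Complex.norm_real,
    Real.norm_of_nonneg (det_gaudin_pos hc hL l).le]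
  calc _ ≤ C * (A * ∏ i, (1 + u i ^ 2)⁻¹) / L ^ (N + 1) := by
        refine div_le_div₀ ?_ ((hC l).trans (mul_le_mul_of_nonneg_left ?_ hC0)) (by positivity)
          (pow_le_det_gaudin hc hL l)
        · exact mul_nonneg hC0 (mul_nonneg hA0.le (Finset.prod_nonneg fun _ _ => by positivity))
        · simpa only [hu] using hA l
    _ = _ := by ring

theorem continuousAt_betheDensity (hc : 0 < c) (hL : 0 < L) (hch x : ℝ) (t : ℂ) {μ : Fin N → ℝ}
    {δ : ℝ} (hδ : 0 < δ) {m : Fin (N + 1) → ℤ} (hm : ∀ j k, betheRoots hc hL m j ≠ μ k) :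
    ContinuousAt (betheDensity hc hL hch x t μ δ) fun j => 2 * Real.pi * (m j : ℝ) := by
  have h := (betheHomeomorph (M := N + 1) hc hL).symm.continuous.continuousAt
    (x := fun j => 2 * Real.pi * (m j : ℝ))
  have h1 : ContinuousAt (fun l => cutoffDensity c L hch x t μ δ l / ((gaudin c L l).det : ℂ))
      (betheRoots hc hL m) := by
    refine ContinuousAt.div ?_ (Complex.continuous_ofReal.comp
      (continuous_det_gaudin hc)).continuousAt ?_
    · exact (Complex.continuous_ofReal.comp (continuous_poleCutoff hδ μ)).continuousAt.mul
        (continuousAt_const.mul (continuousAt_vevFactor hc x t μ hm))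
    · exact_mod_cast (det_gaudin_pos hc hL _).ne'
  exact ContinuousAt.comp (g := fun l => cutoffDensity c L hch x t μ δ l /
    ((gaudin c L l).det : ℂ)) h1 h

theorem pow_mul_betheDensity (hc : 0 < c) (hL : 0 < L) (hch x : ℝ) (t : ℂ) (μ : Fin N → ℝ)
    (δ : ℝ) (m : Fin (N + 1) → ℤ) :
    (2 * Real.pi : ℂ) ^ (N + 1) * betheDensity hc hL hch x t μ δ (fun j => 2 * Real.pi * (m j : ℝ))
      = (poleCutoff δ μ (betheRoots hc hL m) : ℂ) *
        rootTerm c L hch x t μ (betheRoots hc hL m) := by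
  have hπ : (2 * Real.pi : ℂ) ^ (N + 1) ≠ 0 :=
    pow_ne_zero _ (mul_ne_zero two_ne_zero (by exact_mod_cast Real.pi_ne_zero))
  rw [betheDensity, cutoffDensity, rootTerm, ← betheRoots]
  field_simp

/-- On Bethe solutions the poles cancel, so the bound holds without cut-off. It decays in the
rapidities and therefore in the quantum numbers, because `φ̃_j = 2π n_j`. -/
theorem summable_rootTerm (hN : Even N) (hc : 0 < c) (hL : 0 < L) (hch x : ℝ) {t : ℂ}
    (ht : 0 < t.im) {μ : Fin N → ℝ} (hμ : IsGroundState c L μ) :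
    Summable fun n => rootTerm c L hch x t μ (betheRoots hc hL n) := by
  obtain ⟨C, hC0, hC⟩ := norm_vevFactor_betheRoots_le hN hc hL x ht hμ
  obtain ⟨A, hA0, hA⟩ := exists_prod_inv_one_add_sq_le c hL (N + 1)
  refine Summable.of_norm_bounded (((summable_prod_of_nonneg (M := N + 1)
    (fun n => (1 + (n : ℝ) ^ 2)⁻¹) (fun n => by positivity) summable_inv_one_add_sq).mul_left
    (‖prefactor c L hch t μ‖ * (C * A / L ^ (N + 1))))) fun n => ?_
  rw [rootTerm, norm_mul, norm_div, Complex.norm_real,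
    Real.norm_of_nonneg (det_gaudin_pos hc hL _).le, mul_assoc]
  refine mul_le_mul_of_nonneg_left ?_ (norm_nonneg _)
  have h1 : ∏ j, (1 + bethe c L (betheRoots hc hL n) j ^ 2)⁻¹ ≤ ∏ j, (1 + (n j : ℝ) ^ 2)⁻¹ := by
    rw [bethe_betheRoots]
    refine Finset.prod_le_prod (fun _ _ => by positivity) fun j _ => ?_
    refine inv_anti₀ (by positivity) ?_
    have : 1 ≤ (2 * Real.pi) ^ 2 := by nlinarith [Real.pi_gt_three]
    rw [mul_pow]
    nlinarith [sq_nonneg (n j : ℝ)]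
  calc _ ≤ C * (A * ∏ j, (1 + (n j : ℝ) ^ 2)⁻¹) / L ^ (N + 1) := by
        refine div_le_div₀ ?_ ((hC n).trans (mul_le_mul_of_nonneg_left ?_ hC0.le)) (by positivity)
          (pow_le_det_gaudin hc hL _)
        · exact mul_nonneg hC0.le (mul_nonneg hA0.le (Finset.prod_nonneg fun _ _ => by positivity))
        · exact (hA _).trans (mul_le_mul_of_nonneg_left h1 hA0.le)
    _ = _ := by ring

theorem hasSumIntegral_correlatorIntegrand (hN : Even N) (hc : 0 < c) (hL : 0 < L) (hch x : ℝ)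
    {t : ℂ} (ht : 0 < t.im) {μ : Fin N → ℝ} (hμ : IsGroundState c L μ)
    (hroot : ∀ (n : Fin (N + 1) → ℤ) j k, betheRoots hc hL n j ≠ μ k) :
    HasSumIntegral μ (correlatorIntegrand c L hch x t μ) (correlation c L hch x t μ) := by
  refine ⟨fun δ hδ n => integrable_poleCutoff_mul_correlatorIntegrand hc hch x ht μ hδ n,
    fun δ hδ ε hε => ?_, fun δ => ∑' m : Fin (N + 1) → ℤ,
      (poleCutoff δ μ (betheRoots hc hL m) : ℂ) * rootTerm c L hch x t μ (betheRoots hc hL m),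
    fun δ hδ => ?_, ?_⟩
  · obtain ⟨C, hC0, hC⟩ := norm_betheDensity_le hc hL hch x ht μ hδ
    simp only [integral_poleCutoff_mul_correlatorIntegrand hc hL]
    exact (hasSum_integral_gaussian_mul (measurable_betheDensity hc hL hch x t μ hδ) hC hε).summable
  · obtain ⟨C, hC0, hC⟩ := norm_betheDensity_le hc hL hch x ht μ hδ
    simp only [integral_poleCutoff_mul_correlatorIntegrand hc hL, ← pow_mul_betheDensity]
    exact tendsto_tsum_gaussian_mul_integral (measurable_betheDensity hc hL hch x t μ hδ) hC0 hC
      fun m => continuousAt_betheDensity hc hL hch x t hδ (hroot m)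
  -- The limit `δ → 0` is dominated by the series without cut-off, since the cut-off lies in `[0,
  -- 1]` and tends to `1` at each Bethe solution.
  · have hs := summable_rootTerm hN hc hL hch x ht hμ
    rw [← (summable_and_hasSum_correlation hc hL hch x t μ hs).2.tsum_eq]
    refine tendsto_tsum_of_dominated_convergence hs.norm (fun m => ?_)
      (Eventually.of_forall fun δ m => ?_)
    · have h := ((Complex.continuous_ofReal.tendsto 1).comp
        (tendsto_poleCutoff (hroot m))).mul_const (rootTerm c L hch x t μ (betheRoots hc hL m))
      simpa only [Complex.ofReal_one, one_mul, Function.comp_def] using h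
    · rw [norm_mul, Complex.norm_real, Real.norm_of_nonneg (poleCutoff_nonneg δ μ _)]
      exact mul_le_of_le_one_left (norm_nonneg _) (poleCutoff_le_one δ μ _)

end Regularised

end DualFields

end

/-! ### The form-factor series and its dual-field representations -/

theorem theorem2 (N : ℕ) (hN : Even N) (c L : ℝ) (hc : 0 < c) (hL : 0 < L)
    (hch x : ℝ) (t : ℂ) (μ : Fin N → ℝ) (hμ : DualFields.IsGroundState c L μ) :
    -- the vacuum expectation value, for each `n` and `l`
    (∀ (n : Fin (N + 1) → ℤ) (l : Fin (N + 1) → ℝ), (∀ j k, l j ≠ μ k) →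
      DualFields.dualFieldIntegrand c L hch x t μ n l
        = DualFields.correlatorIntegrand c L hch x t μ n l) ∧
    -- from here on no intermediate state shares a rapidity with the ground state
    ((∀ (n : Fin (N + 1) → ℤ) (l : Fin (N + 1) → ℝ),
        DualFields.IsBethe c L n l → ∀ j k, l j ≠ μ k) →
      -- the correlation function, for `t` in the upper half plane
      (0 < t.im →
        (Summable fun s : DualFields.ExcitedState N c L =>
          DualFields.formFactorTerm c L hch x t μ s.1) ∧
        DualFields.HasSumIntegral μ (DualFields.correlatorIntegrand c L hch x t μ)
          (DualFields.correlation c L hch x t μ) ∧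
        DualFields.HasSumIntegral μ (DualFields.dualFieldIntegrand c L hch x t μ)
          (DualFields.correlation c L hch x t μ)) ∧
      -- the representation in terms of the operator roots
      ∃ R : (Fin (N + 1) → ℤ) → ℂ,
        (∀ n, (∀ᶠ ε in 𝓝[>] (0 : ℝ), MeasureTheory.Integrable
            (DualFields.rootIntegrand c L hch x t μ ε n)) ∧
          Tendsto (fun ε : ℝ => ∫ l, DualFields.rootIntegrand c L hch x t μ ε n l)
            (𝓝[>] 0) (𝓝 (R n))) ∧
        (∀ n, ¬ Function.Injective n → R n = 0) ∧
        (∀ n l, StrictMono n → DualFields.IsBethe c L n l →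
          ∑ σ : Equiv.Perm (Fin (N + 1)), R (n ∘ σ)
            = DualFields.formFactorTerm c L hch x t μ l) ∧
        (0 < t.im → HasSum R (DualFields.correlation c L hch x t μ))) := by
  open DualFields in
  refine ⟨fun n l _ => dualFieldIntegrand_eq_correlatorIntegrand hc L hch x t μ n l,
    fun hroot => ?_⟩
  have hroot' : ∀ (n : Fin (N + 1) → ℤ) j k, betheRoots hc hL n j ≠ μ k := fun n =>
    hroot n _ ((isBethe_iff_eq_betheRoots hc hL n _).2 rfl)
  -- The witness for `R(n)` is the contribution of the ordered Bethe solution with quantum numbers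
  -- `n`; summing over its orderings restores the form factor.
  refine ⟨fun ht => ?_, fun n => rootTerm c L hch x t μ (betheRoots hc hL n),
    fun n => tendsto_integral_rootIntegrand hc hL hch x t μ n (hroot' n),
    fun n hn => rootTerm_eq_zero hc hL hch x t μ hn, fun n l _ hl => ?_, fun ht => ?_⟩
  · have h := hasSumIntegral_correlatorIntegrand hN hc hL hch x ht hμ hroot'
    have heq : dualFieldIntegrand c L hch x t μ = correlatorIntegrand c L hch x t μ := by
      funext n l
      exact dualFieldIntegrand_eq_correlatorIntegrand hc L hch x t μ n l
    exact ⟨(summable_and_hasSum_correlation hc hL hch x t μ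
      (summable_rootTerm hN hc hL hch x ht hμ)).1, h, heq ▸ h⟩
  · simp only [betheRoots_comp_perm, (isBethe_iff_eq_betheRoots hc hL n l).1 hl]
    exact sum_perm_rootTerm hch x t μ _
  · exact (summable_and_hasSum_correlation hc hL hch x t μ
      (summable_rootTerm hN hc hL hch x ht hμ)).2
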